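/- For $r\in\mathbb N$ let $d=d_r\ge 1$ be an integer, let $(\xi_{k\ell})_{1\le k<\ell\le r}$ be i.i.d. $0/1$ random variables with $\mathbb P(\xi_{k\ell}=1)=p_r$, and let $(v^{k\ell})_{1\le k<\ell\le r}$ be mutually independent random vectors in $\mathbb R^d$, independent of the $\xi_{k\ell}$ and not necessarily identically distributed. Suppose that (i) $\mathbb E\,v^{k\ell}(v^{k\ell})^{T}=d^{-1}I_d$ for all $r$ and all $k<\ell\le r$; (ii) for every sequence of deterministic $d_r\times d_r$ real matrices $D_r$ with operator norm $\|D_r\|=1$, $\ \sup_{k<\ell\le r}\operatorname{Var}\,(D_r v^{k\ell},v^{k\ell})\to 0$ as $r\to\infty$; (iii) for some constant $C$, independent of $r,k,\ell$, $\ \|v^{k\ell}\|_2\le C$ almost surely. Put $B_{k\ell}=B_{\ell k}=\xi_{k\ell}\,v^{k\ell}(v^{k\ell})^{T}$ for $k<\ell$, and let $\mathcal L$ be the block Laplacian, i.e. the symmetric $rd\times rd$ matrix of $d\times d$ blocks whose $k$-th diagonal block is $\sum_{j\ne k}B_{jk}$ and whose $(k,\ell)$ block for $k\ne\ell$ is $-B_{k\ell}$.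 Let $N_{\mathcal L}^{(r)}=\frac1{rd}\sum_i\delta_{\lambda_i(\mathcal L)}$ be its empirical spectral distribution. If $d_r\to\infty$ and $r p_r/d_r\to c$ as $r\to\infty$, for some $c\ge 0$, then $N_{\mathcal L}^{(r)}$ converges weakly in probability to the non-random probability measure $$ N_c(d\lambda)=\Big(1-\frac c2\Big)_+\delta_0(d\lambda)+\rho(\lambda)\,d\lambda,\qquad \rho(\lambda)=\frac{1}{4\pi\lambda}\sqrt{\big((c^+-\lambda)(\lambda-c^-)\big)_+},\quad c^{\pm}=(\sqrt2\pm\sqrt c)^2 , $$ that is, for every bounded continuous $f:\mathbb R\to\mathbb R$, $\int f\,dN_{\mathcal L}^{(r)}\to\int f\,dN_c$ in probability. In particular, for $c\ge 2$ the limit is absolutely continuous with density $\rho$. -/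

import Mathlib

open Filter Topology MeasureTheory ProbabilityTheory
open scoped ENNReal BoundedContinuousFunction

noncomputable section

/-- The index set of pairs `k < l` of elements of `{1, …, r}`. -/
abbrev EdgeIx (r : ℕ) : Type := {e : Fin r × Fin r // e.1 < e.2}

/-- The `d × d` block `B_{kl} = ξ_{kl} v^{kl} (v^{kl})ᵀ` for `k < l`, extended symmetrically
by `B_{lk} = B_{kl}`. (The value for `k = l` plays no role.) -/
def rankOneBlock {r d : ℕ} (x : EdgeIx r → ℝ) (u : EdgeIx r → EuclideanSpace ℝ (Fin d))
    (k l : Fin r) : Matrix (Fin d) (Fin d) ℝ :=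
  if h : k < l then x ⟨(k, l), h⟩ • Matrix.vecMulVec (u ⟨(k, l), h⟩).ofLp (u ⟨(k, l), h⟩).ofLp
  else if h : l < k then
    x ⟨(l, k), h⟩ • Matrix.vecMulVec (u ⟨(l, k), h⟩).ofLp (u ⟨(l, k), h⟩).ofLp
  else 0

/-- The block adjacency matrix `A = ((1 - δ_{kl}) B_{kl})_{k,l}`; the index `(k, a)` stands for
entry `a` of block `k`. -/
def blockAdjacency {r d : ℕ} (x : EdgeIx r → ℝ) (u : EdgeIx r → EuclideanSpace ℝ (Fin d)) :
    Matrix (Fin r × Fin d) (Fin r × Fin d) ℝ :=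
  Matrix.of fun i j => if i.1 = j.1 then 0 else rankOneBlock x u i.1 j.1 i.2 j.2

/-- The block Laplacian `L = (δ_{kl} ∑_{j ≠ k} B_{jl})_{k,l} - A`. -/
def blockLaplacian {r d : ℕ} (x : EdgeIx r → ℝ) (u : EdgeIx r → EuclideanSpace ℝ (Fin d)) :
    Matrix (Fin r × Fin d) (Fin r × Fin d) ℝ :=
  (Matrix.of fun i j =>
    if i.1 = j.1 then ∑ k ∈ Finset.univ.erase i.1, rankOneBlock x u k j.1 i.2 j.2 else 0)
    - blockAdjacency x u

theorem rankOneBlock_comm {r d : ℕ} (x : EdgeIx r → ℝ)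
    (u : EdgeIx r → EuclideanSpace ℝ (Fin d)) (k l : Fin r) :
    rankOneBlock x u k l = rankOneBlock x u l k := by
  unfold rankOneBlock
  rcases lt_trichotomy k l with h | h | h
  · simp [h, h.not_gt]
  · subst h; rfl
  · simp [h, h.not_gt]

theorem rankOneBlock_swap {r d : ℕ} (x : EdgeIx r → ℝ)
    (u : EdgeIx r → EuclideanSpace ℝ (Fin d)) (k l : Fin r) (a b : Fin d) :
    rankOneBlock x u k l a b = rankOneBlock x u k l b a := by
  unfold rankOneBlock
  split_ifs <;> simp [Matrix.vecMulVec_apply, mul_comm]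

theorem blockLaplacian_isHermitian {r d : ℕ} (x : EdgeIx r → ℝ)
    (u : EdgeIx r → EuclideanSpace ℝ (Fin d)) : (blockLaplacian x u).IsHermitian := by
  ext ⟨k, a⟩ ⟨l, b⟩
  by_cases h : k = l
  · subst h
    simp [blockLaplacian, blockAdjacency, rankOneBlock_swap x u _ _ b a]
  · simp [blockLaplacian, blockAdjacency, h, Ne.symm h, rankOneBlock_comm x u l k,
      rankOneBlock_swap x u _ _ b a]

/-- The empirical spectral distribution of a Hermitian `n × n` matrix: the mass `1 / n` is put at
each eigenvalue, with multiplicity. -/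
def empiricalSpectralDistribution {ι : Type*} [Fintype ι] [DecidableEq ι] {M : Matrix ι ι ℝ}
    (hM : M.IsHermitian) : Measure ℝ :=
  ((Fintype.card ι : ℝ≥0∞)⁻¹) • ∑ i, Measure.dirac (hM.eigenvalues i)

/-- The random measures `N r`, each on its own probability space `(Ω r, P r)`, converge weakly in
probability to the deterministic measure `ν`. -/
def ConvergesWeaklyInProbability {Ω : ℕ → Type*} [∀ r, MeasurableSpace (Ω r)]
    (P : ∀ r, Measure (Ω r)) (N : ∀ r, Ω r → Measure ℝ) (ν : Measure ℝ) : Prop :=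
  ∀ f : ℝ →ᵇ ℝ, ∀ ε : ℝ, 0 < ε →
    Tendsto (fun r => P r {ω | ε ≤ |∫ t, f t ∂(N r ω) - ∫ t, f t ∂ν|}) atTop (𝓝 0)

/-- Concentration of quadratic forms: `sup_e Var (D v_e, v_e) = o(1)` as `r → ∞`, for all
deterministic matrices `D = D_r` of operator norm one. -/
def HasConcentratedForms {Ω : ℕ → Type*} [∀ r, MeasurableSpace (Ω r)]
    (P : ∀ r, Measure (Ω r)) (d : ℕ → ℕ)
    (v : ∀ r, EdgeIx r → Ω r → EuclideanSpace ℝ (Fin (d r))) : Prop :=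
  ∀ D : ∀ r, Matrix (Fin (d r)) (Fin (d r)) ℝ,
    (∀ r, ‖Matrix.toEuclideanCLM (𝕜 := ℝ) (D r)‖ = 1) →
    Tendsto (fun r => ⨆ e : EdgeIx r,
      variance (fun ω => inner ℝ (Matrix.toEuclideanCLM (𝕜 := ℝ) (D r) (v r e ω)) (v r e ω)) (P r))
      atTop (𝓝 0)

/-- `ρ(t) = √(((c⁺ - t)(t - c⁻))₊) / (4 π t)` with `c^± = (√2 ± √c)²`. -/
def laplacianDensity (c t : ℝ) : ℝ :=
  1 / (4 * Real.pi * t) *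
    √(max (((√2 + √c) ^ 2 - t) * (t - (√2 - √c) ^ 2)) 0)

/-- The Marchenko–Pastur-type limit law: density `ρ`, and for `c < 2` also an atom at `0` of the
missing mass `1 - c / 2`. -/
def laplacianLimitLaw (c : ℝ) : Measure ℝ :=
  ENNReal.ofReal (1 - c / 2) • Measure.dirac 0
    + volume.withDensity (fun t => ENNReal.ofReal (laplacianDensity c t))

end

/-! Write `b e = ξ_e v_e`. Since `ξ_e` is 0 or 1, the block Laplacian is `L = ∑ e, w_e w_eᵀ` with
`w_e = (1_k - 1_l) ⊗ b e` for the edge `e = {k, l}`. Hence `L` is positive semidefinite, and it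
suffices to study the resolvent `G = (x + L)⁻¹` at real `x > 0`, indeed only at large `x`. Let `f k`
be the expected normalized trace of the diagonal block `k` of `G`.

The diagonal of `1 = x G + L G`, combined with the rank-one update formula, expresses `1 - x G_kk`
through ratios of quadratic forms in `b e`, taken with the resolvent from which `e` has been removed
(`one_sub_mul_blockTrace`). That resolvent is independent of `b e`, so concentration of quadratic
forms replaces the forms by normalized block traces. Three estimates simplify the result. Removing
an edge moves a block trace by `O(1/d)`. The diagonal block traces have variance `O(1/d)` by
`efron_stein`. The squares of the block traces in a row sum to at most `1/x²`, so the off-diagonal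
ones are negligible on average. Therefore `1 - x f k ≈ (p/d) ∑ l, f k / (1 + f k + f l)`
(`abs_meanBlockTrace_equation_le`). For large `x` this system is stable, and its solution is close
on average to the nonnegative `σ` with `1 - x σ = c σ / (1 + 2 σ)`
(`sum_abs_sub_le_of_approx_equation`).

The Stieltjes transform of the limit law is computed from an explicit antiderivative and satisfies
the same equation (`laplacianLimitLaw_stieltjes`). Finally, for measures on `[0, ∞)`, convergence of
`∫ 1/(t + x)` for all large `x` determines the weak limit: in the variable `u = 1/(t + x₀)` these
functions generate the polynomials, and Weierstrass approximation applies
(`convergesWeaklyInProbability_of_stieltjes`). -/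

/-! ### Resolvents of Gram sums: a priori bounds and rank-one updates. -/

section GramResolvent

open Matrix

set_option linter.unusedSectionVars false

variable {ι E : Type*} [Fintype ι] [DecidableEq ι] [Fintype E]

/-- The matrix `x + ∑ e, w_e w_eᵀ`. -/
def shiftedGram (x : ℝ) (W : E → ι → ℝ) : Matrix ι ι ℝ :=
  x • (1 : Matrix ι ι ℝ) + ∑ e, vecMulVec (W e) (W e)

/-- The resolvent `(x + ∑ e, w_e w_eᵀ)⁻¹`. -/
noncomputable def gramResolvent (x : ℝ) (W : E → ι → ℝ) : Matrix ι ι ℝ := (shiftedGram x W)⁻¹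

theorem shiftedGram_mulVec (x : ℝ) (W : E → ι → ℝ) (u : ι → ℝ) :
    shiftedGram x W *ᵥ u = x • u + ∑ e, (W e ⬝ᵥ u) • W e := by
  rw [shiftedGram, add_mulVec, smul_mulVec, one_mulVec, Matrix.sum_mulVec]
  congr 1
  refine Finset.sum_congr rfl fun e _ => ?_
  ext i
  simp [vecMulVec_mulVec, mul_comm]

theorem dotProduct_shiftedGram_mulVec (x : ℝ) (W : E → ι → ℝ) (u : ι → ℝ) :
    u ⬝ᵥ shiftedGram x W *ᵥ u = x * (u ⬝ᵥ u) + ∑ e, (W e ⬝ᵥ u) ^ 2 := by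
  rw [shiftedGram_mulVec, dotProduct_add, dotProduct_smul, dotProduct_sum, smul_eq_mul]
  congr 1
  refine Finset.sum_congr rfl fun e _ => ?_
  rw [dotProduct_smul, smul_eq_mul, dotProduct_comm u, sq]

theorem shiftedGram_transpose (x : ℝ) (W : E → ι → ℝ) :
    (shiftedGram x W)ᵀ = shiftedGram x W := by
  ext i j
  simp [shiftedGram, Matrix.sum_apply, vecMulVec_apply, mul_comm, Matrix.one_apply, eq_comm]

theorem shiftedGram_posDef {x : ℝ} (hx : 0 < x) (W : E → ι → ℝ) :
    (shiftedGram x W).PosDef := by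
  refine Matrix.PosDef.of_dotProduct_mulVec_pos ?_ fun u hu => ?_
  · rw [Matrix.IsHermitian, conjTranspose_eq_transpose_of_trivial, shiftedGram_transpose]
  · rw [star_trivial, dotProduct_shiftedGram_mulVec]
    have h1 : 0 < u ⬝ᵥ u := by
      have := dotProduct_star_self_pos_iff.2 hu
      rwa [star_trivial] at this
    have h2 : 0 ≤ ∑ e, (W e ⬝ᵥ u) ^ 2 := Finset.sum_nonneg fun _ _ => sq_nonneg _
    positivity

theorem shiftedGram_isUnit_det {x : ℝ} (hx : 0 < x) (W : E → ι → ℝ) :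
    IsUnit (shiftedGram x W).det :=
  (shiftedGram_posDef hx W).det_pos.ne'.isUnit

theorem shiftedGram_mul_gramResolvent {x : ℝ} (hx : 0 < x) (W : E → ι → ℝ) :
    shiftedGram x W * gramResolvent x W = 1 :=
  mul_nonsing_inv _ (shiftedGram_isUnit_det hx W)

theorem gramResolvent_mul_shiftedGram {x : ℝ} (hx : 0 < x) (W : E → ι → ℝ) :
    gramResolvent x W * shiftedGram x W = 1 :=
  nonsing_inv_mul _ (shiftedGram_isUnit_det hx W)

theorem gramResolvent_transpose (x : ℝ) (W : E → ι → ℝ) :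
    (gramResolvent x W)ᵀ = gramResolvent x W := by
  rw [gramResolvent, transpose_nonsing_inv, shiftedGram_transpose]

theorem gramResolvent_comm (x : ℝ) (W : E → ι → ℝ) (i j : ι) :
    gramResolvent x W i j = gramResolvent x W j i := by
  conv_lhs => rw [← gramResolvent_transpose]
  rfl

theorem dotProduct_gramResolvent_comm (x : ℝ) (W : E → ι → ℝ) (u v : ι → ℝ) :
    u ⬝ᵥ gramResolvent x W *ᵥ v = v ⬝ᵥ gramResolvent x W *ᵥ u := by
  rw [dotProduct_mulVec, ← mulVec_transpose, gramResolvent_transpose, dotProduct_comm]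

/-- The quadratic form of `x + ∑ e, w_e w_eᵀ` evaluated at `G u`. Both terms on the right are
nonnegative, so each is at most `u · G u`; the later bounds on `G` come from this. -/
theorem dotProduct_gramResolvent_self {x : ℝ} (hx : 0 < x) (W : E → ι → ℝ) (u : ι → ℝ) :
    u ⬝ᵥ gramResolvent x W *ᵥ u =
      x * (gramResolvent x W *ᵥ u ⬝ᵥ gramResolvent x W *ᵥ u)
        + ∑ e, (W e ⬝ᵥ gramResolvent x W *ᵥ u) ^ 2 := by
  rw [← dotProduct_shiftedGram_mulVec, mulVec_mulVec, shiftedGram_mul_gramResolvent hx, one_mulVec,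
    dotProduct_comm]

theorem dotProduct_self_nonneg_real (u : ι → ℝ) : 0 ≤ u ⬝ᵥ u :=
  Finset.sum_nonneg fun _ _ => mul_self_nonneg _

theorem sq_dotProduct_le (u v : ι → ℝ) : (u ⬝ᵥ v) ^ 2 ≤ (u ⬝ᵥ u) * (v ⬝ᵥ v) := by
  have := Finset.sum_mul_sq_le_sq_mul_sq Finset.univ u v
  simpa [dotProduct, sq] using this

theorem mul_dotProduct_gramResolvent_le {x : ℝ} (hx : 0 < x) (W : E → ι → ℝ) (u : ι → ℝ) :
    x * (gramResolvent x W *ᵥ u ⬝ᵥ gramResolvent x W *ᵥ u) ≤ u ⬝ᵥ gramResolvent x W *ᵥ u := by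
  rw [dotProduct_gramResolvent_self hx]
  exact le_add_of_nonneg_right (Finset.sum_nonneg fun _ _ => sq_nonneg _)

theorem dotProduct_gramResolvent_nonneg {x : ℝ} (hx : 0 < x) (W : E → ι → ℝ) (u : ι → ℝ) :
    0 ≤ u ⬝ᵥ gramResolvent x W *ᵥ u :=
  (mul_nonneg hx.le (dotProduct_self_nonneg_real _)).trans (mul_dotProduct_gramResolvent_le hx W u)

/-- With `q = u · G u`, Cauchy–Schwarz gives `q² ≤ |u|² |G u|² ≤ |u|² q / x`; divide by `q` when it
is positive. -/
theorem dotProduct_gramResolvent_le {x : ℝ} (hx : 0 < x) (W : E → ι → ℝ) (u : ι → ℝ) :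
    u ⬝ᵥ gramResolvent x W *ᵥ u ≤ (u ⬝ᵥ u) / x := by
  rw [le_div_iff₀ hx]
  have h1 := mul_dotProduct_gramResolvent_le hx W u
  have h2 := sq_dotProduct_le u (gramResolvent x W *ᵥ u)
  have h0 := dotProduct_gramResolvent_nonneg hx W u
  set q := u ⬝ᵥ gramResolvent x W *ᵥ u
  rcases h0.eq_or_lt with h | h
  · rw [← h]; simpa using dotProduct_self_nonneg_real u
  · have h3 : (u ⬝ᵥ u) * (x * (gramResolvent x W *ᵥ u ⬝ᵥ gramResolvent x W *ᵥ u)) ≤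
        (u ⬝ᵥ u) * q := mul_le_mul_of_nonneg_left h1 (dotProduct_self_nonneg_real u)
    nlinarith

theorem gramResolvent_mulVec_sq_le {x : ℝ} (hx : 0 < x) (W : E → ι → ℝ) (u : ι → ℝ) :
    gramResolvent x W *ᵥ u ⬝ᵥ gramResolvent x W *ᵥ u ≤ (u ⬝ᵥ u) / x ^ 2 := by
  have h1 := mul_dotProduct_gramResolvent_le hx W u
  have h2 := dotProduct_gramResolvent_le hx W u
  rw [le_div_iff₀ hx] at h2
  rw [le_div_iff₀ (by positivity)]
  nlinarith

theorem gramResolvent_diag_le {x : ℝ} (hx : 0 < x) (W : E → ι → ℝ) (i : ι) :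
    gramResolvent x W i i ≤ 1 / x := by
  have := dotProduct_gramResolvent_le hx W (Pi.single i 1)
  simpa using this

theorem gramResolvent_diag_nonneg {x : ℝ} (hx : 0 < x) (W : E → ι → ℝ) (i : ι) :
    0 ≤ gramResolvent x W i i := by
  have := dotProduct_gramResolvent_nonneg hx W (Pi.single i 1)
  simpa using this

/-- The energy identity at a basis vector. The bound does not depend on the number of edges, which
is what makes the sum over edges in the variance estimate converge. -/
theorem sum_sq_gramResolvent_mulVec_apply_le {x : ℝ} (hx : 0 < x) (W : E → ι → ℝ) (i : ι) :
    ∑ e, ((gramResolvent x W *ᵥ W e) i) ^ 2 ≤ 1 / x := by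
  have h := dotProduct_gramResolvent_self hx W (Pi.single i 1)
  have h1 : ∀ e, W e ⬝ᵥ gramResolvent x W *ᵥ Pi.single i 1 = (gramResolvent x W *ᵥ W e) i := by
    intro e
    rw [dotProduct_gramResolvent_comm]
    simp
  simp only [h1] at h
  have h2 := gramResolvent_diag_le hx W i
  have h3 := dotProduct_self_nonneg_real (gramResolvent x W *ᵥ Pi.single i 1)
  have h4 : Pi.single i 1 ⬝ᵥ gramResolvent x W *ᵥ Pi.single i 1 = gramResolvent x W i i := by simp
  nlinarith

theorem sum_sq_gramResolvent_apply_le {x : ℝ} (hx : 0 < x) (W : E → ι → ℝ) (i : ι) :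
    ∑ j, (gramResolvent x W i j) ^ 2 ≤ 1 / x ^ 2 := by
  have h := gramResolvent_mulVec_sq_le hx W (Pi.single i 1)
  simp only [mulVec_single_one, single_one_dotProduct, Pi.single_eq_same] at h
  refine le_trans (le_of_eq ?_) h
  refine Finset.sum_congr rfl fun j _ => ?_
  rw [gramResolvent_comm, sq]
  rfl

/-- The identity `1 = x G + (∑ e, w_e w_eᵀ) G` read on the diagonal. -/
theorem one_sub_mul_gramResolvent_diag {x : ℝ} (hx : 0 < x) (W : E → ι → ℝ) (i : ι) :
    1 - x * gramResolvent x W i i = ∑ e, W e i * (gramResolvent x W *ᵥ W e) i := by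
  have h := congrFun (congrArg (fun M => M *ᵥ Pi.single i (1 : ℝ))
    (shiftedGram_mul_gramResolvent hx W)) i
  simp only [← mulVec_mulVec, one_mulVec, Pi.single_eq_same] at h
  rw [shiftedGram_mulVec, Pi.add_apply, Finset.sum_apply] at h
  have h1 : ∀ e, W e ⬝ᵥ gramResolvent x W *ᵥ Pi.single i 1 = (gramResolvent x W *ᵥ W e) i := by
    intro e
    rw [dotProduct_gramResolvent_comm]
    simp
  simp only [h1, Pi.smul_apply, smul_eq_mul] at h
  rw [← h]
  simp [mul_comm]

section RankOne

variable [DecidableEq E]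

/-- Removing an edge is modelled by resetting its vector to `0`, so the index type never changes. -/
theorem shiftedGram_update_zero (x : ℝ) (W : E → ι → ℝ) (e : E) :
    shiftedGram x W = shiftedGram x (Function.update W e 0) + vecMulVec (W e) (W e) := by
  rw [shiftedGram, shiftedGram, ← Finset.add_sum_erase _ _ (Finset.mem_univ e),
    ← Finset.add_sum_erase Finset.univ (fun e' => vecMulVec (Function.update W e 0 e') _)
      (Finset.mem_univ e)]
  have : ∑ e' ∈ Finset.univ.erase e,
      vecMulVec (Function.update W e 0 e') (Function.update W e 0 e') =
      ∑ e' ∈ Finset.univ.erase e, vecMulVec (W e') (W e') := by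
    refine Finset.sum_congr rfl fun e' he' => ?_
    rw [Function.update_of_ne (Finset.ne_of_mem_erase he')]
  rw [this]
  simp only [Function.update_self, vecMulVec_zero, zero_add]
  abel

/-- Sherman–Morrison: apply `x + ∑ e, w_e w_eᵀ` to `G' w`, where `G'` is the resolvent without `w`,
and invert. -/
theorem gramResolvent_update_mulVec {x : ℝ} (hx : 0 < x) (W : E → ι → ℝ) (e : E) :
    gramResolvent x (Function.update W e 0) *ᵥ W e =
      (1 + W e ⬝ᵥ gramResolvent x (Function.update W e 0) *ᵥ W e) •
        gramResolvent x W *ᵥ W e := by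
  set G' := gramResolvent x (Function.update W e 0)
  have h : shiftedGram x W *ᵥ (G' *ᵥ W e) = (1 + W e ⬝ᵥ G' *ᵥ W e) • W e := by
    rw [shiftedGram_update_zero x W e, add_mulVec, mulVec_mulVec,
      shiftedGram_mul_gramResolvent hx, one_mulVec, add_smul, one_smul]
    congr 1
    ext i
    rw [vecMulVec_mulVec]
    simp [mul_comm]
  have h2 := congrArg (fun u => gramResolvent x W *ᵥ u) h
  simpa [mulVec_mulVec, gramResolvent_mul_shiftedGram hx, mulVec_smul, ← Matrix.mul_assoc] using h2

/-- The resolvent identity `G' - G = G (w wᵀ) G'`, entrywise. -/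
theorem gramResolvent_update_sub {x : ℝ} (hx : 0 < x) (W : E → ι → ℝ) (e : E) (i j : ι) :
    gramResolvent x (Function.update W e 0) i j - gramResolvent x W i j =
      (gramResolvent x W *ᵥ W e) i * (gramResolvent x (Function.update W e 0) *ᵥ W e) j := by
  set G' := gramResolvent x (Function.update W e 0) with hG'
  have h : G' - gramResolvent x W =
      gramResolvent x W * vecMulVec (W e) (W e) * G' := by
    have h1 : vecMulVec (W e) (W e) = shiftedGram x W - shiftedGram x (Function.update W e 0) := by
      rw [shiftedGram_update_zero x W e]; abel
    rw [h1, Matrix.mul_sub, gramResolvent_mul_shiftedGram hx, Matrix.sub_mul, Matrix.one_mul,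
      Matrix.mul_assoc, shiftedGram_mul_gramResolvent hx, Matrix.mul_one]
  have h2 := congrFun (congrFun h i) j
  rw [Matrix.sub_apply] at h2
  rw [h2, mul_vecMulVec, vecMulVec_mul, vecMulVec_apply, ← mulVec_transpose, hG',
    gramResolvent_transpose]

end RankOne

end GramResolvent

/-! ### Efron–Stein inequality and resampling on product spaces. -/

section EfronStein

variable {E X : Type*} [Fintype E] [DecidableEq E] [MeasurableSpace X]
  (μ : E → Measure X) [∀ e, IsProbabilityMeasure (μ e)]

theorem measurePreserving_pi_ite (S : Finset E) :
    MeasurePreserving (fun (u : E → X × X) e => if e ∈ S then (u e).2 else (u e).1)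
      (Measure.pi fun e => (μ e).prod (μ e)) (Measure.pi μ) := by
  have h : ∀ e, MeasurePreserving (fun w : X × X => if e ∈ S then w.2 else w.1)
      ((μ e).prod (μ e)) (μ e) := by
    intro e
    by_cases he : e ∈ S
    · simpa [he] using measurePreserving_snd (μ := μ e) (ν := μ e)
    · simpa [he] using measurePreserving_fst (μ := μ e) (ν := μ e)
  exact measurePreserving_pi _ _ h

theorem measurePreserving_pi_swap (e : E) :
    MeasurePreserving (fun (u : E → X × X) e' => if e' = e then (u e').swap else u e')
      (Measure.pi fun e => (μ e).prod (μ e)) (Measure.pi fun e => (μ e).prod (μ e)) := by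
  have h : ∀ e', MeasurePreserving (fun w : X × X => if e' = e then w.swap else w)
      ((μ e').prod (μ e')) ((μ e').prod (μ e')) := by
    intro e'
    by_cases he : e' = e
    · simpa [he] using Measure.measurePreserving_swap (μ := μ e) (ν := μ e)
    · simp only [he, if_false]; exact MeasurePreserving.id _
  exact measurePreserving_pi _ _ h

theorem MeasureTheory.MeasurePreserving.integral_comp_of_measurable {α β : Type*}
    [MeasurableSpace α] [MeasurableSpace β] {ρ : Measure α} {σ : Measure β} {T : α → β}
    (hT : MeasurePreserving T ρ σ) {g : β → ℝ} (hg : Measurable g) :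
    ∫ u, g (T u) ∂ρ = ∫ y, g y ∂σ := by
  rw [← hT.map_eq, integral_map hT.measurable.aemeasurable hg.aestronglyMeasurable]

theorem integrable_of_abs_le {α : Type*} [MeasurableSpace α] {ρ : Measure α} [IsFiniteMeasure ρ]
    {g : α → ℝ} {K : ℝ} (hg : Measurable g) (hK : ∀ y, |g y| ≤ K) : Integrable g ρ :=
  Integrable.of_bound hg.aestronglyMeasurable K (ae_of_all _ hK)

/-- An independent redraw of one coordinate preserves the product law. It is used to integrate over
`b e` while the resolvent without `e` stays frozen. -/
theorem integral_pi_resample {Φ : (E → X) → ℝ} (hΦ : Measurable Φ)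
    (hi : Integrable Φ (Measure.pi μ)) (e : E) :
    Integrable (fun y => ∫ t, Φ (Function.update y e t) ∂μ e) (Measure.pi μ) ∧
    ∫ y, Φ y ∂Measure.pi μ = ∫ y, ∫ t, Φ (Function.update y e t) ∂μ e ∂Measure.pi μ := by
  have hupd : Measurable fun w : (E → X) × (E → X) => Φ (Function.update w.1 e (w.2 e)) := by
    refine hΦ.comp (measurable_pi_lambda _ fun e' => ?_)
    by_cases h : e' = e
    · subst h; simp only [Function.update_self]; fun_prop
    · simp only [Function.update_of_ne h]; fun_prop
  have hT := measurePreserving_arrowProdEquivProdArrow X X E μ μ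
  have h1 : ∀ u : E → X × X, Φ (fun e' => if e' ∈ ({e} : Finset E) then (u e').2 else (u e').1) =
      (fun w : (E → X) × (E → X) => Φ (Function.update w.1 e (w.2 e)))
        (MeasurableEquiv.arrowProdEquivProdArrow X X E u) := by
    intro u
    change _ = Φ (Function.update (fun i => (u i).1) e (u e).2)
    congr 1
    ext e'
    by_cases h : e' = e
    · subst h; simp
    · simp [h]
  have hi' : Integrable (fun w : (E → X) × (E → X) => Φ (Function.update w.1 e (w.2 e)))
      ((Measure.pi μ).prod (Measure.pi μ)) := by
    have h2 := (measurePreserving_pi_ite μ {e}).integrable_comp_of_integrable hi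
    rw [← hT.integrable_comp hupd.aestronglyMeasurable]
    exact h2.congr (ae_of_all _ h1)
  have h3 : ∀ y, ∫ z, Φ (Function.update y e (z e)) ∂Measure.pi μ =
      ∫ t, Φ (Function.update y e t) ∂μ e := fun y =>
    (measurePreserving_eval μ e).integral_comp_of_measurable (hΦ.comp (measurable_update y))
  refine ⟨hi'.integral_prod_left.congr (ae_of_all _ h3), ?_⟩
  rw [← (measurePreserving_pi_ite μ {e}).integral_comp_of_measurable hΦ]
  simp only [h1]
  rw [hT.integral_comp_of_measurable hupd, integral_prod _ hi']
  exact integral_congr_ae (ae_of_all _ h3)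

/-- Variance bound of Efron–Stein type: the variance of a bounded function of independent variables
is controlled by the mean square effects of resetting a single variable. -/
theorem efron_stein {F : (E → X) → ℝ} {K : ℝ} (hF : Measurable F) (hK : ∀ y, |F y| ≤ K) (x₀ : X) :
    ∫ y, (F y - ∫ z, F z ∂Measure.pi μ) ^ 2 ∂Measure.pi μ ≤
      2 * ∑ e, ∫ y, (F y - F (Function.update y e x₀)) ^ 2 ∂Measure.pi μ := by
  set ν := Measure.pi μ
  set ν₂ := Measure.pi fun e => (μ e).prod (μ e)
  -- From two independent copies, `Y S` takes the second copy on `S` and the first elsewhere; it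
  -- interpolates between the two copies.
  let Y : Finset E → (E → X × X) → E → X := fun S u e => if e ∈ S then (u e).2 else (u e).1
  have hY : ∀ S, MeasurePreserving (Y S) ν₂ ν := measurePreserving_pi_ite μ
  have hFY : ∀ S, Measurable fun u => F (Y S u) := fun S => hF.comp (hY S).measurable
  have hK0 : 0 ≤ K := by
    obtain ⟨y⟩ : Nonempty (E → X) := ⟨fun _ => x₀⟩
    exact (abs_nonneg _).trans (hK y)
  have hintM : ∀ {g h : (E → X × X) → ℝ}, Measurable g → Measurable h → (∀ u, |g u| ≤ K) →
      (∀ u, |h u| ≤ 2 * K) → Integrable (fun u => g u * h u) ν₂ := by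
    intro g h hg hh hgb hhb
    refine integrable_of_abs_le (hg.mul hh) (K := K * (2 * K)) fun u => ?_
    rw [abs_mul]
    exact mul_le_mul (hgb u) (hhb u) (abs_nonneg _) hK0
  have hsub : ∀ a b : ℝ, |a| ≤ K → |b| ≤ K → |a - b| ≤ 2 * K := fun a b ha hb =>
    (abs_sub a b).trans (by linarith)
  have hupd : ∀ e, Measurable fun y : E → X => Function.update y e x₀ := fun e =>
    measurable_update_left
  let V : E → ℝ := fun e => ∫ y, (F y - F (Function.update y e x₀)) ^ 2 ∂ν
  have hVm : ∀ e, Measurable fun y => (F y - F (Function.update y e x₀)) ^ 2 := fun e =>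
    (hF.sub (hF.comp (hupd e))).pow_const 2
  have hsq : ∀ a : ℝ, |a| ≤ 2 * K → |a ^ 2| ≤ (2 * K) ^ 2 := fun a ha => by
    rw [abs_pow]; exact pow_le_pow_left₀ (abs_nonneg _) ha 2
  -- Two configurations that differ only at `e` have the same reset value, so `(a - b)² ≤ 2 (a - m)²
  -- + 2 (b - m)²` gives the factor 4.
  have hdiff : ∀ (S T : Finset E) (e : E),
      (∀ u, Function.update (Y S u) e x₀ = Function.update (Y T u) e x₀) →
      ∫ u, (F (Y S u) - F (Y T u)) ^ 2 ∂ν₂ ≤ 4 * V e := by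
    intro S T e hST
    have h1 : ∀ S, ∫ u, (F (Y S u) - F (Function.update (Y S u) e x₀)) ^ 2 ∂ν₂ = V e := fun S =>
      (hY S).integral_comp_of_measurable (hVm e)
    have hi : ∀ S, Integrable (fun u => (F (Y S u) - F (Function.update (Y S u) e x₀)) ^ 2) ν₂ :=
      fun S => integrable_of_abs_le ((hVm e).comp (hY S).measurable) (K := (2 * K) ^ 2)
        fun u => hsq _ (hsub _ _ (hK _) (hK _))
    calc ∫ u, (F (Y S u) - F (Y T u)) ^ 2 ∂ν₂
        ≤ ∫ u, (2 * (F (Y S u) - F (Function.update (Y S u) e x₀)) ^ 2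
            + 2 * (F (Y T u) - F (Function.update (Y T u) e x₀)) ^ 2) ∂ν₂ := by
          refine integral_mono (integrable_of_abs_le (((hFY S).sub (hFY T)).pow_const 2)
            (K := (2 * K) ^ 2) fun u => hsq _ (hsub _ _ (hK _) (hK _)))
            (((hi S).const_mul 2).add ((hi T).const_mul 2)) fun u => ?_
          change (F (Y S u) - F (Y T u)) ^ 2 ≤ _
          rw [hST u]
          set m := F (Function.update (Y T u) e x₀)
          nlinarith [sq_nonneg ((F (Y S u) - m) + (F (Y T u) - m))]
      _ = 4 * V e := by
          rw [integral_add ((hi S).const_mul 2) ((hi T).const_mul 2), integral_const_mul,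
            integral_const_mul, h1, h1]
          ring
  -- Exchanging the two copies at `e` interchanges `Y S` with `Y (insert e S)` and turns `Y ∅` into
  -- `Y {e}`. Averaging the two expressions leaves half the integral of a product of two increments
  -- at `e`, each controlled by `V e`.
  have hstep : ∀ (S : Finset E) (e : E), e ∉ S →
      ∫ u, F (Y ∅ u) * (F (Y S u) - F (Y (insert e S) u)) ∂ν₂ ≤ 2 * V e := by
    intro S e he
    let σ : (E → X × X) → E → X × X := fun u e' => if e' = e then (u e').swap else u e'
    have hσ : MeasurePreserving σ ν₂ ν₂ := measurePreserving_pi_swap μ e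
    have s1 : ∀ u, Y ∅ (σ u) = Y {e} u := fun u => by
      ext e'; by_cases h : e' = e <;> simp [Y, σ, h]
    have s2 : ∀ u, Y S (σ u) = Y (insert e S) u := fun u => by
      ext e'
      by_cases h : e' = e
      · subst h; simp [Y, σ, he]
      · simp [Y, σ, h]
    have s3 : ∀ u, Y (insert e S) (σ u) = Y S u := fun u => by
      ext e'
      by_cases h : e' = e
      · subst h; simp [Y, σ, he]
      · simp [Y, σ, h]
    have hm : ∀ T, Measurable fun u => F (Y T u) * (F (Y S u) - F (Y (insert e S) u)) := fun T =>
      (hFY T).mul ((hFY S).sub (hFY _))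
    have hi : ∀ T, Integrable (fun u => F (Y T u) * (F (Y S u) - F (Y (insert e S) u))) ν₂ :=
      fun T => hintM (hFY T) ((hFY S).sub (hFY _)) (fun u => hK _) fun u => hsub _ _ (hK _) (hK _)
    have hswap := hσ.integral_comp_of_measurable (hm ∅)
    simp only [s1, s2, s3] at hswap
    have hneg : ∫ u, F (Y {e} u) * (F (Y (insert e S) u) - F (Y S u)) ∂ν₂ =
        -∫ u, F (Y {e} u) * (F (Y S u) - F (Y (insert e S) u)) ∂ν₂ := by
      rw [← integral_neg]
      exact integral_congr_ae (ae_of_all _ fun u => by ring)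
    rw [hneg] at hswap
    have hsum : 2 * ∫ u, F (Y ∅ u) * (F (Y S u) - F (Y (insert e S) u)) ∂ν₂ =
        ∫ u, (F (Y ∅ u) - F (Y {e} u)) * (F (Y S u) - F (Y (insert e S) u)) ∂ν₂ := by
      have : ∫ u, (F (Y ∅ u) - F (Y {e} u)) * (F (Y S u) - F (Y (insert e S) u)) ∂ν₂ =
          ∫ u, F (Y ∅ u) * (F (Y S u) - F (Y (insert e S) u)) ∂ν₂ -
          ∫ u, F (Y {e} u) * (F (Y S u) - F (Y (insert e S) u)) ∂ν₂ := by
        rw [← integral_sub (hi ∅) (hi {e})]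
        exact integral_congr_ae (ae_of_all _ fun u => by ring)
      rw [this]; linarith
    have hi2 : ∀ T T', Integrable (fun u => (F (Y T u) - F (Y T' u)) ^ 2) ν₂ := fun T T' =>
      integrable_of_abs_le (((hFY T).sub (hFY T')).pow_const 2) (K := (2 * K) ^ 2)
        fun u => hsq _ (hsub _ _ (hK _) (hK _))
    have hle : ∫ u, (F (Y ∅ u) - F (Y {e} u)) * (F (Y S u) - F (Y (insert e S) u)) ∂ν₂ ≤
        ∫ u, ((1 / 2) * (F (Y ∅ u) - F (Y {e} u)) ^ 2 +
          (1 / 2) * (F (Y S u) - F (Y (insert e S) u)) ^ 2) ∂ν₂ := by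
      refine integral_mono ?_ (((hi2 _ _).const_mul _).add ((hi2 _ _).const_mul _)) fun u => ?_
      · have := (hi ∅).sub (hi {e})
        refine this.congr (ae_of_all _ fun u => ?_)
        simp only [Pi.sub_apply]; ring
      · simp only
        nlinarith [sq_nonneg ((F (Y ∅ u) - F (Y {e} u)) - (F (Y S u) - F (Y (insert e S) u)))]
    rw [integral_add ((hi2 _ _).const_mul _) ((hi2 _ _).const_mul _), integral_const_mul,
      integral_const_mul] at hle
    have h1 := hdiff ∅ {e} e fun u => by
      ext e'; by_cases h : e' = e
      · subst h; simp
      · simp [Y, h]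
    have h2 := hdiff S (insert e S) e fun u => by
      ext e'; by_cases h : e' = e
      · subst h; simp
      · simp [Y, h]
    linarith
  -- Telescoping. At `S = univ` the configurations `Y ∅` and `Y univ` are independent, and the left
  -- side is the variance.
  have htel : ∀ S : Finset E,
      ∫ u, F (Y ∅ u) * (F (Y ∅ u) - F (Y S u)) ∂ν₂ ≤ 2 * ∑ e ∈ S, V e := by
    intro S
    induction S using Finset.induction_on with
    | empty => simp
    | insert e S he ih =>
      rw [Finset.sum_insert he]
      have : ∫ u, F (Y ∅ u) * (F (Y ∅ u) - F (Y (insert e S) u)) ∂ν₂ =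
          ∫ u, F (Y ∅ u) * (F (Y ∅ u) - F (Y S u)) ∂ν₂ +
          ∫ u, F (Y ∅ u) * (F (Y S u) - F (Y (insert e S) u)) ∂ν₂ := by
        have hi : ∀ S T, Integrable (fun u => F (Y ∅ u) * (F (Y S u) - F (Y T u))) ν₂ :=
          fun S T => hintM (hFY _) ((hFY S).sub (hFY T)) (fun u => hK _)
            fun u => hsub _ _ (hK _) (hK _)
        rw [← integral_add (hi _ _) (hi _ _)]
        exact integral_congr_ae (ae_of_all _ fun u => by ring)
      rw [this]
      have := hstep S e he
      linarith
  have hFi : Integrable F ν := integrable_of_abs_le hF hK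
  have hF2 : Integrable (fun y => F y ^ 2) ν := integrable_of_abs_le (hF.pow_const 2) (K := K ^ 2)
    fun y => by rw [abs_pow]; exact pow_le_pow_left₀ (abs_nonneg _) (hK y) 2
  have hprod : ∫ u, F (Y ∅ u) * F (Y Finset.univ u) ∂ν₂ = (∫ y, F y ∂ν) * ∫ y, F y ∂ν := by
    rw [← integral_prod_mul]
    have hm : Measurable fun w : (E → X) × (E → X) => F w.1 * F w.2 :=
      (hF.comp measurable_fst).mul (hF.comp measurable_snd)
    rw [← (measurePreserving_arrowProdEquivProdArrow X X E μ μ).integral_comp_of_measurable hm]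
    refine integral_congr_ae (ae_of_all _ fun u => ?_)
    simp only [Y, Finset.notMem_empty, Finset.mem_univ, if_true, if_false]
    rfl
  have hfin := htel Finset.univ
  have hexp : ∫ u, F (Y ∅ u) * (F (Y ∅ u) - F (Y Finset.univ u)) ∂ν₂ =
      ∫ y, F y ^ 2 ∂ν - (∫ y, F y ∂ν) * ∫ y, F y ∂ν := by
    rw [← hprod, ← (hY ∅).integral_comp_of_measurable (hF.pow_const 2), ← integral_sub]
    · exact integral_congr_ae (ae_of_all _ fun u => by ring)
    · exact (hY ∅).integrable_comp_of_integrable hF2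
    · refine integrable_of_abs_le ((hFY _).mul (hFY _)) (K := K * K) fun u => ?_
      rw [abs_mul]
      exact mul_le_mul (hK _) (hK _) (abs_nonneg _) hK0
  have hvar : ∫ y, (F y - ∫ z, F z ∂ν) ^ 2 ∂ν = ∫ y, F y ^ 2 ∂ν - (∫ y, F y ∂ν) * ∫ y, F y ∂ν := by
    set m := ∫ z, F z ∂ν with hm
    have : ∀ y, (F y - m) ^ 2 = F y ^ 2 - 2 * m * F y + m ^ 2 := fun y => by ring
    simp only [this]
    have hd : Integrable (fun y => F y ^ 2 - 2 * m * F y) ν := hF2.sub (hFi.const_mul _)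
    rw [integral_add hd (integrable_const _),
      integral_sub hF2 (hFi.const_mul _), integral_const_mul, ← hm]
    simp
    ring
  rw [hvar, ← hexp]
  exact hfin

end EfronStein

/-! ### Block traces of the edge resolvent and their sensitivity to one edge. -/

section BlockResolvent

open Matrix

variable {V E : Type*} [Fintype V] [DecidableEq V] [Fintype E] [DecidableEq E] {d : ℕ}

/-- The vector supported on block `k` with value `u` there. -/
def blockSingle (k : V) (u : Fin d → ℝ) : V × Fin d → ℝ := fun i => if i.1 = k then u i.2 else 0

/-- The vector `(1_{s e} - 1_{t e}) ⊗ b_e`. -/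
def edgeVector (s t : E → V) (b : E → EuclideanSpace ℝ (Fin d)) (e : E) : V × Fin d → ℝ :=
  blockSingle (s e) (b e).ofLp - blockSingle (t e) (b e).ofLp

/-- The resolvent of the block Laplacian with edge vectors `b`. -/
noncomputable def edgeResolvent (s t : E → V) (x : ℝ) (b : E → EuclideanSpace ℝ (Fin d)) :
    Matrix (V × Fin d) (V × Fin d) ℝ := gramResolvent x (edgeVector s t b)

/-- The normalized trace of the block `(k, l)`. -/
noncomputable def blockTrace (G : Matrix (V × Fin d) (V × Fin d) ℝ) (k l : V) : ℝ :=
  (d : ℝ)⁻¹ * ∑ a, G (k, a) (l, a)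

/-- The block `(k, l)`. -/
def matrixBlock (G : Matrix (V × Fin d) (V × Fin d) ℝ) (k l : V) : Matrix (Fin d) (Fin d) ℝ :=
  Matrix.of fun a b => G (k, a) (l, b)

set_option linter.unusedSectionVars false

theorem blockSingle_dotProduct (k : V) (u : Fin d → ℝ) (w : V × Fin d → ℝ) :
    blockSingle k u ⬝ᵥ w = ∑ a, u a * w (k, a) := by
  rw [dotProduct, Fintype.sum_prod_type, Finset.sum_eq_single k]
  · simp [blockSingle]
  · intro l _ hl; simp [blockSingle, hl]
  · simp

theorem mulVec_blockSingle_apply (G : Matrix (V × Fin d) (V × Fin d) ℝ) (k l : V)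
    (u : Fin d → ℝ) (a : Fin d) :
    (G *ᵥ blockSingle l u) (k, a) = (matrixBlock G k l *ᵥ u) a := by
  rw [mulVec, dotProduct_comm, blockSingle_dotProduct, mulVec, dotProduct_comm]
  rfl

theorem blockSingle_dotProduct_mulVec (G : Matrix (V × Fin d) (V × Fin d) ℝ) (k l : V)
    (u w : Fin d → ℝ) :
    blockSingle k u ⬝ᵥ G *ᵥ blockSingle l w = u ⬝ᵥ matrixBlock G k l *ᵥ w := by
  rw [blockSingle_dotProduct]
  simp only [mulVec_blockSingle_apply]
  rfl

theorem trace_matrixBlock (G : Matrix (V × Fin d) (V × Fin d) ℝ) (k l : V) :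
    (d : ℝ)⁻¹ * (matrixBlock G k l).trace = blockTrace G k l := rfl

theorem edgeVector_update (s t : E → V) (b : E → EuclideanSpace ℝ (Fin d)) (e : E) :
    edgeVector s t (Function.update b e 0) = Function.update (edgeVector s t b) e 0 := by
  ext e' i
  by_cases h : e' = e
  · subst h; simp [edgeVector, blockSingle]
  · simp [edgeVector, Function.update_of_ne h]

theorem dotProduct_ofLp_self (u : EuclideanSpace ℝ (Fin d)) : u.ofLp ⬝ᵥ u.ofLp = ‖u‖ ^ 2 := by
  rw [EuclideanSpace.norm_sq_eq]
  simp [dotProduct, sq]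

theorem edgeVector_dotProduct_self {s t : E → V} (hst : ∀ e, s e ≠ t e)
    (b : E → EuclideanSpace ℝ (Fin d)) (e : E) :
    edgeVector s t b e ⬝ᵥ edgeVector s t b e = 2 * ‖b e‖ ^ 2 := by
  have h := hst e
  rw [← dotProduct_ofLp_self]
  nth_rw 1 [edgeVector]
  rw [sub_dotProduct, blockSingle_dotProduct, blockSingle_dotProduct]
  simp [edgeVector, blockSingle, h, h.symm, dotProduct]
  ring

/-- The factor `1 + q` trades `G' w` for `G w`, so that both factors contain the full resolvent and
can be summed over all edges. -/
theorem edgeResolvent_update_sub (s t : E → V) {x : ℝ} (hx : 0 < x)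
    (b : E → EuclideanSpace ℝ (Fin d)) (e : E) (k l : V) :
    blockTrace (edgeResolvent s t x (Function.update b e 0)) k l -
      blockTrace (edgeResolvent s t x b) k l =
    (d : ℝ)⁻¹ * ((1 + edgeVector s t b e ⬝ᵥ
      edgeResolvent s t x (Function.update b e 0) *ᵥ edgeVector s t b e) *
      ∑ a, (edgeResolvent s t x b *ᵥ edgeVector s t b e) (k, a) *
        (edgeResolvent s t x b *ᵥ edgeVector s t b e) (l, a)) := by
  rw [blockTrace, blockTrace, ← mul_sub, ← Finset.sum_sub_distrib]
  congr 1
  rw [Finset.mul_sum]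
  refine Finset.sum_congr rfl fun a _ => ?_
  simp only [edgeResolvent, edgeVector_update]
  rw [gramResolvent_update_sub hx, congrFun (gramResolvent_update_mulVec hx _ e) (l, a)]
  simp only [Pi.smul_apply, smul_eq_mul]
  ring

theorem sum_sq_block_le (w : V × Fin d → ℝ) (k : V) : ∑ a, w (k, a) ^ 2 ≤ w ⬝ᵥ w := by
  have h : w ⬝ᵥ w = ∑ l, ∑ a, w (l, a) ^ 2 := by
    simp only [dotProduct, Fintype.sum_prod_type, sq]
  rw [h]
  exact Finset.single_le_sum (f := fun l => ∑ a, w (l, a) ^ 2)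
    (fun l _ => Finset.sum_nonneg fun a _ => sq_nonneg _) (Finset.mem_univ k)

/-- From `x |G' w|² ≤ q` and `G' w = (1 + q) G w` one gets `x (1 + q)² |G w|² ≤ q ≤ 1 + q`. No bound
on the size of `w` is needed. -/
theorem one_add_mul_sq_edgeResolvent_le (s t : E → V) {x : ℝ} (hx : 0 < x)
    (b : E → EuclideanSpace ℝ (Fin d)) (e : E) :
    (1 + edgeVector s t b e ⬝ᵥ
      edgeResolvent s t x (Function.update b e 0) *ᵥ edgeVector s t b e) *
      (edgeResolvent s t x b *ᵥ edgeVector s t b e ⬝ᵥ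
        edgeResolvent s t x b *ᵥ edgeVector s t b e) ≤ 1 / x := by
  simp only [edgeResolvent, edgeVector_update]
  set W := edgeVector s t b
  have h1 := mul_dotProduct_gramResolvent_le hx (Function.update W e 0) (W e)
  have h0 := dotProduct_gramResolvent_nonneg hx (Function.update W e 0) (W e)
  rw [gramResolvent_update_mulVec hx] at h1
  nth_rw 3 [← gramResolvent_update_mulVec hx] at h1
  set q := W e ⬝ᵥ gramResolvent x (Function.update W e 0) *ᵥ W e
  simp only [smul_dotProduct, dotProduct_smul, smul_eq_mul] at h1
  set S := gramResolvent x W *ᵥ W e ⬝ᵥ gramResolvent x W *ᵥ W e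
  rw [le_div_iff₀ hx]
  have h2 : (1 + q) * ((1 + q) * S * x) ≤ (1 + q) * 1 := by nlinarith
  exact le_of_mul_le_mul_left h2 (by linarith)

theorem abs_blockTrace_update_sub_le (s t : E → V) {x : ℝ} (hx : 0 < x)
    (b : E → EuclideanSpace ℝ (Fin d)) (e : E) (k l : V) :
    |blockTrace (edgeResolvent s t x (Function.update b e 0)) k l -
      blockTrace (edgeResolvent s t x b) k l| ≤ 1 / (d * x) := by
  rw [edgeResolvent_update_sub s t hx, abs_mul, abs_of_nonneg (by positivity : (0 : ℝ) ≤ (d : ℝ)⁻¹)]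
  have h0 := dotProduct_gramResolvent_nonneg hx
    (edgeVector s t (Function.update b e 0)) (edgeVector s t b e)
  have h1 := one_add_mul_sq_edgeResolvent_le s t hx b e
  rw [edgeResolvent] at h1 ⊢
  set q := edgeVector s t b e ⬝ᵥ
    gramResolvent x (edgeVector s t (Function.update b e 0)) *ᵥ edgeVector s t b e
  set w := edgeResolvent s t x b *ᵥ edgeVector s t b e
  have h2 : |∑ a, w (k, a) * w (l, a)| ≤ w ⬝ᵥ w := by
    have h3 := sum_sq_block_le w k
    have h4 := sum_sq_block_le w l
    calc |∑ a, w (k, a) * w (l, a)| ≤ ∑ a, |w (k, a) * w (l, a)| := Finset.abs_sum_le_sum_abs _ _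
      _ ≤ ∑ a, (1 / 2 * w (k, a) ^ 2 + 1 / 2 * w (l, a) ^ 2) := by
        refine Finset.sum_le_sum fun a _ => ?_
        rw [abs_le]
        constructor <;> nlinarith [sq_nonneg (w (k, a) + w (l, a)), sq_nonneg (w (k, a) - w (l, a))]
      _ ≤ w ⬝ᵥ w := by
        rw [Finset.sum_add_distrib, ← Finset.mul_sum, ← Finset.mul_sum]
        linarith
  rw [abs_mul, abs_of_nonneg (by linarith : 0 ≤ 1 + q)]
  calc (d : ℝ)⁻¹ * ((1 + q) * |∑ a, w (k, a) * w (l, a)|) ≤ (d : ℝ)⁻¹ * (1 / x) :=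
        mul_le_mul_of_nonneg_left
          ((mul_le_mul_of_nonneg_left h2 (by linarith)).trans h1) (by positivity)
    _ = 1 / (d * x) := by rw [one_div, one_div, mul_inv]

/-- In each square one factor is bounded by `1/(d x)`. The other is kept as `∑ a, (G w_e)(k, a)²`,
up to a constant over `d`, and summed over all edges by the energy bound. The total is `O(1/d)`
however many edges there are. -/
theorem sum_sq_blockTrace_update_sub_le {s t : E → V} (hst : ∀ e, s e ≠ t e) {x C : ℝ} (hx : 0 < x)
    (hd : 0 < d) (b : E → EuclideanSpace ℝ (Fin d)) (hb : ∀ e, ‖b e‖ ≤ C) (k : V) :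
    ∑ e, (blockTrace (edgeResolvent s t x b) k k -
      blockTrace (edgeResolvent s t x (Function.update b e 0)) k k) ^ 2 ≤
      (1 + 2 * C ^ 2 / x) / (d * x ^ 2) := by
  have hd' : (0 : ℝ) < d := by exact_mod_cast hd
  set w := fun e => edgeResolvent s t x b *ᵥ edgeVector s t b e
  have h1 : ∀ e, (blockTrace (edgeResolvent s t x b) k k -
      blockTrace (edgeResolvent s t x (Function.update b e 0)) k k) ^ 2 ≤
      (1 + 2 * C ^ 2 / x) / (d ^ 2 * x) * ∑ a, w e (k, a) ^ 2 := by
    intro e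
    have h2 := edgeResolvent_update_sub s t hx b e k k
    have h3 := abs_blockTrace_update_sub_le s t hx b e k k
    have h0 := dotProduct_gramResolvent_nonneg hx
      (edgeVector s t (Function.update b e 0)) (edgeVector s t b e)
    have h4 := dotProduct_gramResolvent_le hx
      (edgeVector s t (Function.update b e 0)) (edgeVector s t b e)
    rw [edgeVector_dotProduct_self hst] at h4
    set D := blockTrace (edgeResolvent s t x (Function.update b e 0)) k k -
      blockTrace (edgeResolvent s t x b) k k with hD
    have hD' : (blockTrace (edgeResolvent s t x b) k k -
      blockTrace (edgeResolvent s t x (Function.update b e 0)) k k) = -D := by rw [hD]; ring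
    rw [hD', neg_sq]
    simp only [← sq] at h2
    change D = (d : ℝ)⁻¹ * ((1 + edgeVector s t b e ⬝ᵥ gramResolvent x
      (edgeVector s t (Function.update b e 0)) *ᵥ edgeVector s t b e) * ∑ a, w e (k, a) ^ 2) at h2
    set q := edgeVector s t b e ⬝ᵥ
      gramResolvent x (edgeVector s t (Function.update b e 0)) *ᵥ edgeVector s t b e
    have hS : 0 ≤ ∑ a, w e (k, a) ^ 2 := Finset.sum_nonneg fun _ _ => sq_nonneg _
    have hq : q ≤ 2 * C ^ 2 / x := by
      refine h4.trans ?_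
      have := hb e
      gcongr
    have hD0 : 0 ≤ D := by
      rw [h2]
      have : 0 ≤ 1 + q := by linarith
      positivity
    calc D ^ 2 = D * D := sq D
      _ ≤ 1 / (d * x) * ((d : ℝ)⁻¹ * ((1 + 2 * C ^ 2 / x) * ∑ a, w e (k, a) ^ 2)) := by
        refine mul_le_mul ((le_abs_self _).trans h3) ?_ hD0 (by positivity)
        rw [h2]
        gcongr
      _ = _ := by field_simp
  refine (Finset.sum_le_sum fun e _ => h1 e).trans ?_
  rw [← Finset.mul_sum, Finset.sum_comm]
  have h5 : ∑ a, ∑ e, w e (k, a) ^ 2 ≤ d * (1 / x) := by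
    refine (Finset.sum_le_sum fun a _ => sum_sq_gramResolvent_mulVec_apply_le hx _ (k, a)).trans ?_
    simp
  calc (1 + 2 * C ^ 2 / x) / (d ^ 2 * x) * ∑ a, ∑ e, w e (k, a) ^ 2
      ≤ (1 + 2 * C ^ 2 / x) / (d ^ 2 * x) * (d * (1 / x)) := by gcongr
    _ = _ := by field_simp

/-- Cauchy–Schwarz inside each block, then the `ℓ²` bound `1/x` on the rows of `G`. It makes a
typical off-diagonal block trace of size at most `r^(-1/2)`. -/
theorem sum_sq_blockTrace_le (s t : E → V) {x : ℝ} (hx : 0 < x) (hd : 0 < d)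
    (b : E → EuclideanSpace ℝ (Fin d)) (k : V) :
    ∑ l, (blockTrace (edgeResolvent s t x b) k l) ^ 2 ≤ 1 / x ^ 2 := by
  have hd' : (0 : ℝ) < d := by exact_mod_cast hd
  set G := edgeResolvent s t x b
  have h1 : ∀ l, (blockTrace G k l) ^ 2 ≤ (d : ℝ)⁻¹ * ∑ a, G (k, a) (l, a) ^ 2 := by
    intro l
    have := sq_sum_le_card_mul_sum_sq (s := Finset.univ) (f := fun a => G (k, a) (l, a))
    rw [Finset.card_univ, Fintype.card_fin] at this
    rw [blockTrace, mul_pow]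
    calc ((d : ℝ)⁻¹) ^ 2 * (∑ a, G (k, a) (l, a)) ^ 2
        ≤ ((d : ℝ)⁻¹) ^ 2 * (d * ∑ a, G (k, a) (l, a) ^ 2) := by gcongr
      _ = _ := by field_simp
  refine (Finset.sum_le_sum fun l _ => h1 l).trans ?_
  rw [← Finset.mul_sum, Finset.sum_comm]
  have h2 : ∀ a, ∑ l, G (k, a) (l, a) ^ 2 ≤ 1 / x ^ 2 := by
    intro a
    refine le_trans ?_ (sum_sq_gramResolvent_apply_le hx (edgeVector s t b) (k, a))
    rw [Fintype.sum_prod_type]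
    refine Finset.sum_le_sum fun l _ => ?_
    exact Finset.single_le_sum (f := fun c => G (k, a) (l, c) ^ 2)
      (fun _ _ => sq_nonneg _) (Finset.mem_univ a)
  calc (d : ℝ)⁻¹ * ∑ a, ∑ l, G (k, a) (l, a) ^ 2 ≤ (d : ℝ)⁻¹ * (d * (1 / x ^ 2)) := by
        gcongr
        refine (Finset.sum_le_sum fun a _ => h2 a).trans ?_
        simp
    _ = _ := by field_simp

theorem abs_blockTrace_le (s t : E → V) {x : ℝ} (hx : 0 < x) (hd : 0 < d)
    (b : E → EuclideanSpace ℝ (Fin d)) (k l : V) :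
    |blockTrace (edgeResolvent s t x b) k l| ≤ 1 / x := by
  have h := (Finset.single_le_sum (f := fun l => (blockTrace (edgeResolvent s t x b) k l) ^ 2)
    (fun _ _ => sq_nonneg _) (Finset.mem_univ l)).trans (sum_sq_blockTrace_le s t hx hd b k)
  rw [← _root_.one_div_pow] at h
  exact abs_le_of_sq_le_sq h (by positivity)

theorem blockTrace_diag_nonneg (s t : E → V) {x : ℝ} (hx : 0 < x)
    (b : E → EuclideanSpace ℝ (Fin d)) (k : V) :
    0 ≤ blockTrace (edgeResolvent s t x b) k k :=
  mul_nonneg (by positivity) (Finset.sum_nonneg fun _ _ => gramResolvent_diag_nonneg hx _ _)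

theorem sum_abs_blockTrace_le (s t : E → V) {x : ℝ} (hx : 0 < x) (hd : 0 < d)
    (b : E → EuclideanSpace ℝ (Fin d)) (k : V) :
    ∑ l, |blockTrace (edgeResolvent s t x b) k l| ≤ √(Fintype.card V) / x := by
  have h1 := sum_sq_blockTrace_le s t hx hd b k
  have h2 := sq_sum_le_card_mul_sum_sq (s := Finset.univ)
    (f := fun l => |blockTrace (edgeResolvent s t x b) k l|)
  simp only [sq_abs, Finset.card_univ] at h2
  have h3 : √(Fintype.card V) / x = √((Fintype.card V) * (1 / x ^ 2)) := by
    rw [mul_one_div, Real.sqrt_div' _ (by positivity), Real.sqrt_sq hx.le]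
  rw [h3]
  exact Real.le_sqrt_of_sq_le (h2.trans (by gcongr))

theorem continuous_edgeResolvent (s t : E → V) {x : ℝ} (hx : 0 < x) :
    Continuous fun b : E → EuclideanSpace ℝ (Fin d) => edgeResolvent s t x b := by
  have h : Continuous fun b : E → EuclideanSpace ℝ (Fin d) =>
      shiftedGram x (edgeVector s t b) := by
    refine continuous_matrix fun i j => ?_
    simp only [shiftedGram, Matrix.add_apply, Matrix.sum_apply, vecMulVec_apply, edgeVector,
      Pi.sub_apply, blockSingle]
    refine continuous_const.add (continuous_finsetSum _ fun e _ => ?_)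
    refine Continuous.mul (Continuous.sub ?_ ?_) (Continuous.sub ?_ ?_) <;> split_ifs <;> fun_prop
  simp only [edgeResolvent, gramResolvent, Matrix.inv_def, Ring.inverse_eq_inv']
  exact (h.matrix_det.inv₀ fun b => (shiftedGram_posDef hx _).det_pos.ne').smul h.matrix_adjugate

theorem measurable_blockTrace (s t : E → V) {x : ℝ} (hx : 0 < x) (k l : V) :
    Measurable fun b : E → EuclideanSpace ℝ (Fin d) => blockTrace (edgeResolvent s t x b) k l := by
  refine Continuous.measurable ?_
  have h := continuous_edgeResolvent (d := d) s t hx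
  unfold blockTrace
  exact continuous_const.mul (continuous_finsetSum _ fun a _ => h.matrix_elem _ _)

end BlockResolvent

/-! ### The self-consistent equation: stability, and the exact identity behind it. -/

section SelfConsistentEquation

open Matrix

theorem abs_ratio_sub_le {a b s : ℝ} (ha : 0 ≤ a) (hb : 0 ≤ b) (hs : 0 ≤ s) :
    |a / (1 + a + b) - s / (1 + s + s)| ≤ |a - s| + |b - s| := by
  have h : a / (1 + a + b) - s / (1 + s + s) =
      ((1 + s) * (a - s) - s * (b - s)) / ((1 + a + b) * (1 + s + s)) := by
    field_simp; ring
  rw [h, abs_div, abs_of_pos (by positivity : 0 < (1 + a + b) * (1 + s + s)),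
    div_le_iff₀ (by positivity)]
  have h1 : |(1 + s) * (a - s) - s * (b - s)| ≤ (1 + s) * |a - s| + s * |b - s| := by
    refine (abs_sub _ _).trans ?_
    rw [abs_mul, abs_mul, abs_of_nonneg hs, abs_of_nonneg (by linarith : 0 ≤ 1 + s)]
  have h2 : (1 + s + s) ≤ (1 + a + b) * (1 + s + s) := by nlinarith
  have h3 := mul_le_mul_of_nonneg_left h2 (add_nonneg (abs_nonneg (a - s)) (abs_nonneg (b - s)))
  nlinarith [abs_nonneg (a - s), abs_nonneg (b - s)]

theorem abs_div_one_add_sub_le {τ σ a B : ℝ} (hσ : 0 ≤ σ) (ha : 0 ≤ a) (hB : a ≤ B) :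
    |τ / (1 + σ) - a / (1 + B)| ≤ |τ - a| + |σ - B| := by
  have hB0 : 0 ≤ B := ha.trans hB
  have h : τ / (1 + σ) - a / (1 + B) =
      ((1 + B) * (τ - a) - a * (σ - B)) / ((1 + σ) * (1 + B)) := by
    field_simp; ring
  rw [h, abs_div, abs_of_pos (by positivity : 0 < (1 + σ) * (1 + B)), div_le_iff₀ (by positivity)]
  have h1 : |(1 + B) * (τ - a) - a * (σ - B)| ≤ (1 + B) * |τ - a| + a * |σ - B| := by
    refine (abs_sub _ _).trans ?_
    rw [abs_mul, abs_mul, abs_of_nonneg ha, abs_of_nonneg (by linarith : 0 ≤ 1 + B)]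
  have h2 : (1 + B) ≤ (1 + σ) * (1 + B) := by nlinarith
  have h3 := mul_le_mul_of_nonneg_left h2 (add_nonneg (abs_nonneg (τ - a)) (abs_nonneg (σ - B)))
  nlinarith [abs_nonneg (τ - a), abs_nonneg (σ - B)]

/-- Stability of the self-consistent equation `1 - x f = c f / (1 + 2 f)` for large `x`. -/
theorem sum_abs_sub_le_of_approx_equation {V : Type*} [Fintype V] [DecidableEq V] [Nonempty V]
    {x c q s ε : ℝ} {f : V → ℝ} (hq : 0 ≤ q) (hf : ∀ k, 0 ≤ f k) (hs : 0 ≤ s)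
    (hseq : 1 - x * s = c * (s / (1 + s + s)))
    (hfeq : ∀ k, |1 - x * f k - q * ∑ l ∈ Finset.univ.erase k, f k / (1 + f k + f l)| ≤ ε)
    (hx : 0 ≤ x) :
    (x - 2 * (Fintype.card V * q)) * ∑ k, |f k - s| ≤
      Fintype.card V * (ε + |Fintype.card V * q - c| + q) := by
  set r : ℝ := ((Fintype.card V : ℕ) : ℝ) with hr
  set φ := s / (1 + s + s)
  have hφ0 : 0 ≤ φ := by positivity
  have hφ1 : φ ≤ 1 := by rw [div_le_one (by positivity)]; linarith
  set M := ∑ k, |f k - s|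
  have hk : ∀ k, x * |f k - s| ≤ ε + |r * q - c| + q + r * q * |f k - s| + q * M := by
    intro k
    set S := ∑ l ∈ Finset.univ.erase k, f k / (1 + f k + f l) with hS
    have h1 : |S - (r - 1) * φ| ≤ r * |f k - s| + M := by
      have hc : ((Finset.univ.erase k).card : ℝ) = r - 1 := by
        rw [Finset.card_erase_of_mem (Finset.mem_univ k), Finset.card_univ,
          Nat.cast_sub Fintype.card_pos, Nat.cast_one]
      have : S - (r - 1) * φ = ∑ l ∈ Finset.univ.erase k, (f k / (1 + f k + f l) - φ) := by
        rw [Finset.sum_sub_distrib, Finset.sum_const, nsmul_eq_mul, hc]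
      rw [this]
      refine (Finset.abs_sum_le_sum_abs _ _).trans ?_
      refine (Finset.sum_le_sum fun l _ => abs_ratio_sub_le (hf k) (hf l) hs).trans ?_
      refine (Finset.sum_le_sum_of_subset_of_nonneg (Finset.erase_subset _ _)
        fun l _ _ => add_nonneg (abs_nonneg _) (abs_nonneg _)).trans ?_
      rw [Finset.sum_add_distrib]
      simp [hr, M]
    -- Difference of the approximate and exact equations. The vertex sum has `r - 1` terms, so
    -- comparing `r q` with `c` leaves the extra `q φ`.
    have h2 : x * (s - f k) = (1 - x * f k - q * S) + q * (S - (r - 1) * φ) +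
        (r * q - c) * φ - q * φ := by linear_combination -hseq
    have h3 : x * |f k - s| = |x * (s - f k)| := by
      rw [abs_mul, abs_of_nonneg hx, abs_sub_comm]
    rw [h3, h2]
    have h4 : |q * (S - (r - 1) * φ)| ≤ q * (r * |f k - s| + M) := by
      rw [abs_mul, abs_of_nonneg hq]; exact mul_le_mul_of_nonneg_left h1 hq
    have h5 : |(r * q - c) * φ| ≤ |r * q - c| := by
      rw [abs_mul, abs_of_nonneg hφ0]
      exact mul_le_of_le_one_right (abs_nonneg _) hφ1
    have h6 : |q * φ| ≤ q := by
      rw [abs_of_nonneg (mul_nonneg hq hφ0)]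
      exact mul_le_of_le_one_right hq hφ1
    have h7 := hfeq k
    calc _ ≤ |1 - x * f k - q * S| + |q * (S - (r - 1) * φ)| + |(r * q - c) * φ| + |q * φ| :=
          (abs_sub _ _).trans (by gcongr; exact abs_add_three _ _ _)
      _ ≤ _ := by linarith
  -- Summed over `k`, each of the terms `r q |f k - s|` and `q M` contributes `r q M`, whence the
  -- factor `x - 2 r q`.
  have hsum := Finset.sum_le_sum fun k (_ : k ∈ Finset.univ) => hk k
  rw [← Finset.mul_sum] at hsum
  simp only [Finset.sum_add_distrib, ← Finset.mul_sum, Finset.sum_const, Finset.card_univ,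
    nsmul_eq_mul] at hsum
  rw [← hr] at hsum
  change x * M ≤ r * ε + r * |r * q - c| + r * q + r * q * M + q * (r * M) at hsum
  linarith

/-- Integrate `|h| ≤ h² / (2K) + K / 2`. -/
theorem integral_abs_le_of_integral_sq_le {α : Type*} [MeasurableSpace α] {ρ : Measure α}
    [IsProbabilityMeasure ρ] {h : α → ℝ} {K : ℝ} (hK : 0 < K) (h1 : Integrable h ρ)
    (h2 : Integrable (fun y => h y ^ 2) ρ) (hle : ∫ y, h y ^ 2 ∂ρ ≤ K ^ 2) :
    ∫ y, |h y| ∂ρ ≤ K := by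
  have h3 : ∫ y, |h y| ∂ρ ≤ ∫ y, ((2 * K)⁻¹ * h y ^ 2 + K / 2) ∂ρ := by
    refine integral_mono h1.abs ((h2.const_mul _).add (integrable_const _)) fun y => ?_
    have h4 : 0 ≤ (2 * K)⁻¹ * (|h y| - K) ^ 2 := by positivity
    have h5 : (2 * K)⁻¹ * (|h y| - K) ^ 2 = (2 * K)⁻¹ * h y ^ 2 + K / 2 - |h y| := by
      rw [sub_sq, sq_abs]; field_simp; ring
    linarith
  rw [integral_add (h2.const_mul _) (integrable_const _), integral_const_mul] at h3
  simp only [integral_const, probReal_univ, smul_eq_mul, one_mul] at h3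
  have h4 : (2 * K)⁻¹ * ∫ y, h y ^ 2 ∂ρ ≤ (2 * K)⁻¹ * K ^ 2 := by gcongr
  have h5 : (2 * K)⁻¹ * K ^ 2 = K / 2 := by field_simp
  linarith

variable {V E : Type*} [Fintype V] [DecidableEq V] [Fintype E] [DecidableEq E] {d : ℕ}

set_option linter.unusedSectionVars false

/-- The contribution of an edge `{k, l}` with vector `u` to the diagonal block `k` of `L (x + L)⁻¹`,
in terms of the resolvent `G` without that edge. -/
noncomputable def edgeRatio (G : Matrix (V × Fin d) (V × Fin d) ℝ) (k l : V)
    (u : EuclideanSpace ℝ (Fin d)) : ℝ :=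
  (u.ofLp ⬝ᵥ (matrixBlock G k k - matrixBlock G k l) *ᵥ u.ofLp) /
    (1 + u.ofLp ⬝ᵥ (matrixBlock G k k - matrixBlock G k l +
      (matrixBlock G l l - matrixBlock G l k)) *ᵥ u.ofLp)

theorem blockSingle_sub_quadratic (G : Matrix (V × Fin d) (V × Fin d) ℝ) (k l : V)
    (u : Fin d → ℝ) :
    (blockSingle k u - blockSingle l u) ⬝ᵥ G *ᵥ (blockSingle k u - blockSingle l u) =
    u ⬝ᵥ (matrixBlock G k k - matrixBlock G k l +
      (matrixBlock G l l - matrixBlock G l k)) *ᵥ u := by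
  simp only [mulVec_sub, sub_dotProduct, dotProduct_sub, blockSingle_dotProduct_mulVec,
    add_mulVec, sub_mulVec, dotProduct_add]
  ring

/-- The vector `w_e` lives on the two endpoint blocks only, and Sherman–Morrison gives `G w_e = G'
w_e / (1 + q)`. Every occurrence of `b e` is thereby made explicit. -/
theorem sum_edgeVector_mul_edgeResolvent {s t : E → V} (hst : ∀ e, s e ≠ t e) {x : ℝ} (hx : 0 < x)
    (b : E → EuclideanSpace ℝ (Fin d)) (k : V) (e : E) :
    ∑ a, edgeVector s t b e (k, a) * (edgeResolvent s t x b *ᵥ edgeVector s t b e) (k, a) =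
      (if k = s e then edgeRatio (edgeResolvent s t x (Function.update b e 0)) (s e) (t e) (b e)
        else 0) +
      (if k = t e then edgeRatio (edgeResolvent s t x (Function.update b e 0)) (t e) (s e) (b e)
        else 0) := by
  set G := edgeResolvent s t x (Function.update b e 0) with hG
  set w := edgeResolvent s t x b *ᵥ edgeVector s t b e with hw
  set q := edgeVector s t b e ⬝ᵥ G *ᵥ edgeVector s t b e with hq
  have hq0 : 0 ≤ q := dotProduct_gramResolvent_nonneg hx _ _
  have hGw : G *ᵥ edgeVector s t b e = (1 + q) • w := by
    simp only [hq, hG, hw, edgeResolvent, edgeVector_update]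
    exact gramResolvent_update_mulVec hx _ _
  have hqs : q = (b e).ofLp ⬝ᵥ (matrixBlock G (s e) (s e) - matrixBlock G (s e) (t e) +
      (matrixBlock G (t e) (t e) - matrixBlock G (t e) (s e))) *ᵥ (b e).ofLp := by
    rw [← blockSingle_sub_quadratic]; rfl
  have hs : blockSingle (s e) (b e).ofLp ⬝ᵥ w = edgeRatio G (s e) (t e) (b e) := by
    rw [edgeRatio, ← hqs, eq_div_iff (by linarith), mul_comm, ← smul_eq_mul, ← dotProduct_smul,
      ← hGw, edgeVector, mulVec_sub, dotProduct_sub, blockSingle_dotProduct_mulVec,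
      blockSingle_dotProduct_mulVec, sub_mulVec, dotProduct_sub]
  have ht : -(blockSingle (t e) (b e).ofLp ⬝ᵥ w) = edgeRatio G (t e) (s e) (b e) := by
    rw [edgeRatio, add_comm (matrixBlock G (t e) (t e) - _), ← hqs, eq_div_iff (by linarith),
      neg_mul, mul_comm, ← smul_eq_mul, ← dotProduct_smul,
      ← hGw, edgeVector, mulVec_sub, dotProduct_sub, blockSingle_dotProduct_mulVec,
      blockSingle_dotProduct_mulVec, sub_mulVec, dotProduct_sub]
    ring
  rw [← hs, ← ht, blockSingle_dotProduct, blockSingle_dotProduct]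
  have h := hst e
  by_cases h1 : k = s e
  · subst h1; simp [edgeVector, blockSingle, h]
  · by_cases h2 : k = t e
    · subst h2; simp [edgeVector, blockSingle, h1]
    · simp [edgeVector, blockSingle, h1, h2]

theorem one_sub_mul_blockTrace {s t : E → V} (hst : ∀ e, s e ≠ t e) {x : ℝ} (hx : 0 < x)
    (hd : 0 < d) (b : E → EuclideanSpace ℝ (Fin d)) (k : V) :
    1 - x * blockTrace (edgeResolvent s t x b) k k = (d : ℝ)⁻¹ * ∑ e,
      ((if k = s e then edgeRatio (edgeResolvent s t x (Function.update b e 0)) (s e) (t e) (b e)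
        else 0) +
      (if k = t e then edgeRatio (edgeResolvent s t x (Function.update b e 0)) (t e) (s e) (b e)
        else 0)) := by
  have hd' : (0 : ℝ) < d := by exact_mod_cast hd
  simp only [← sum_edgeVector_mul_edgeResolvent hst hx]
  rw [Finset.sum_comm]
  have h := Finset.sum_congr rfl fun a (_ : a ∈ (Finset.univ : Finset (Fin d))) =>
    one_sub_mul_gramResolvent_diag hx (edgeVector s t b) (k, a)
  simp only [edgeResolvent]
  rw [← h, Finset.sum_sub_distrib, ← Finset.mul_sum, blockTrace]
  simp only [Finset.sum_const, Finset.card_univ, Fintype.card_fin, nsmul_eq_mul, mul_one]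
  field_simp

theorem blockTrace_comm (s t : E → V) (x : ℝ) (b : E → EuclideanSpace ℝ (Fin d)) (k l : V) :
    blockTrace (edgeResolvent s t x b) k l = blockTrace (edgeResolvent s t x b) l k := by
  unfold blockTrace
  congr 1
  exact Finset.sum_congr rfl fun a _ => gramResolvent_comm _ _ _ _

/-- A block is a compression of `G`, whose norm is at most `1/x`. -/
theorem norm_matrixBlock_le (s t : E → V) {x : ℝ} (hx : 0 < x)
    (b : E → EuclideanSpace ℝ (Fin d)) (k l : V) :
    ‖toEuclideanCLM (𝕜 := ℝ) (matrixBlock (edgeResolvent s t x b) k l)‖ ≤ 1 / x := by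
  refine ContinuousLinearMap.opNorm_le_bound _ (by positivity) fun u => ?_
  refine le_of_sq_le_sq ?_ (by positivity)
  rw [mul_pow, ← dotProduct_ofLp_self, ← dotProduct_ofLp_self]
  have h := gramResolvent_mulVec_sq_le hx (edgeVector s t b) (blockSingle l u.ofLp)
  have h2 := sum_sq_block_le (edgeResolvent s t x b *ᵥ blockSingle l u.ofLp) k
  have h3 : blockSingle l u.ofLp ⬝ᵥ blockSingle l u.ofLp = u.ofLp ⬝ᵥ u.ofLp := by
    rw [blockSingle_dotProduct]; simp [blockSingle, dotProduct]
  rw [h3] at h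
  have h4 : (toEuclideanCLM (𝕜 := ℝ) (matrixBlock (edgeResolvent s t x b) k l) u).ofLp =
      matrixBlock (edgeResolvent s t x b) k l *ᵥ u.ofLp := by
    simp
  rw [h4]
  calc _ = ∑ a, (edgeResolvent s t x b *ᵥ blockSingle l u.ofLp) (k, a) ^ 2 := by
        simp only [mulVec_blockSingle_apply, dotProduct, sq]
    _ ≤ _ := h2
    _ ≤ _ := h
    _ = _ := by field_simp

/-- The law `μ` is that of a vector which vanishes with probability `1 - p` and is otherwise
isotropic with concentrated quadratic forms, up to an error `p η`. -/
def HasQuadraticRatios (μ : Measure (EuclideanSpace ℝ (Fin d))) (p η : ℝ) : Prop :=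
  ∀ D₁ D₂ : Matrix (Fin d) (Fin d) ℝ, ‖toEuclideanCLM (𝕜 := ℝ) D₁‖ ≤ 4 →
    ‖toEuclideanCLM (𝕜 := ℝ) D₂‖ ≤ 4 → (∀ u, 0 ≤ u ⬝ᵥ D₂ *ᵥ u) →
    |∫ u, (u.ofLp ⬝ᵥ D₁ *ᵥ u.ofLp) / (1 + u.ofLp ⬝ᵥ D₂ *ᵥ u.ofLp) ∂μ -
      p * (((d : ℝ)⁻¹ * D₁.trace) / (1 + (d : ℝ)⁻¹ * D₂.trace))| ≤ p * η

end SelfConsistentEquation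

/-! ### Independent edge vectors: approximate equation for the mean block traces. -/

section ProductModel

open Matrix

variable {V E : Type*} [Fintype V] [DecidableEq V] [Fintype E] [DecidableEq E] {d : ℕ}
  {s t : E → V} {x C p η : ℝ} {μ : E → Measure (EuclideanSpace ℝ (Fin d))}
  [∀ e, IsProbabilityMeasure (μ e)]

set_option linter.unusedSectionVars false

theorem integrable_blockTrace (μ : E → Measure (EuclideanSpace ℝ (Fin d)))
    [∀ e, IsProbabilityMeasure (μ e)] (s t : E → V) (hx : 0 < x) (hd : 0 < d) (k l : V) :
    Integrable (fun b => blockTrace (edgeResolvent s t x b) k l) (Measure.pi μ) :=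
  integrable_of_abs_le (measurable_blockTrace s t hx k l) fun b => abs_blockTrace_le s t hx hd b k l

/-- The expected normalized trace of a diagonal block. -/
noncomputable def meanBlockTrace (μ : E → Measure (EuclideanSpace ℝ (Fin d))) (s t : E → V) (x : ℝ)
    (k : V) : ℝ :=
  ∫ b, blockTrace (edgeResolvent s t x b) k k ∂Measure.pi μ

theorem meanBlockTrace_nonneg (hx : 0 < x) (k : V) : 0 ≤ meanBlockTrace μ s t x k :=
  integral_nonneg fun b => blockTrace_diag_nonneg s t hx b k

theorem ae_pi_norm_le (hC : ∀ e, ∀ᵐ u ∂μ e, ‖u‖ ≤ C) :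
    ∀ᵐ b ∂Measure.pi μ, ∀ e, ‖b e‖ ≤ C :=
  eventually_all.2 fun e => Measure.tendsto_eval_ae_ae.eventually (hC e)

theorem integral_abs_blockTrace_sub_le (hst : ∀ e, s e ≠ t e) (hx : 1 ≤ x) (hd : 0 < d)
    (hC : ∀ e, ∀ᵐ u ∂μ e, ‖u‖ ≤ C) (k : V) :
    ∫ b, |blockTrace (edgeResolvent s t x b) k k - meanBlockTrace μ s t x k| ∂Measure.pi μ ≤
      √(2 * (1 + 2 * C ^ 2) / d) := by
  have hx0 : 0 < x := by linarith
  have hd' : (0 : ℝ) < d := by exact_mod_cast hd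
  set g := fun b : E → EuclideanSpace ℝ (Fin d) => blockTrace (edgeResolvent s t x b) k k with hg
  have hgm : Measurable g := measurable_blockTrace s t hx0 k k
  have hgb : ∀ b, |g b| ≤ 1 / x := fun b => abs_blockTrace_le s t hx0 hd b k k
  have hgi : Integrable g (Measure.pi μ) := integrable_blockTrace μ s t hx0 hd k k
  refine integral_abs_le_of_integral_sq_le (by positivity) (hgi.sub (integrable_const _)) ?_ ?_
  · refine integrable_of_abs_le ((hgm.sub_const _).pow_const 2)
      (K := (1 / x + |meanBlockTrace μ s t x k|) ^ 2) fun b => ?_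
    rw [abs_pow]
    exact pow_le_pow_left₀ (abs_nonneg _) ((abs_sub _ _).trans (by gcongr; exact hgb b)) 2
  rw [Real.sq_sqrt (by positivity)]
  -- The reset value `0` means deletion of the edge.
  refine (efron_stein μ hgm hgb 0).trans ?_
  have hgu : ∀ e, Integrable (fun b => (g b - g (Function.update b e 0)) ^ 2) (Measure.pi μ) := by
    intro e
    refine integrable_of_abs_le ((hgm.sub (hgm.comp measurable_update_left)).pow_const 2)
      (K := (1 / x + 1 / x) ^ 2) fun b => ?_
    rw [abs_pow]
    exact pow_le_pow_left₀ (abs_nonneg _) ((abs_sub _ _).trans (add_le_add (hgb b) (hgb _))) 2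
  rw [← integral_finsetSum _ fun e _ => hgu e, mul_div_assoc]
  refine mul_le_mul_of_nonneg_left ?_ zero_le_two
  have h1 : ∫ b, ∑ e, (g b - g (Function.update b e 0)) ^ 2 ∂Measure.pi μ ≤
      ∫ b, (1 + 2 * C ^ 2 / x) / (d * x ^ 2) ∂Measure.pi μ := by
    refine integral_mono_ae (integrable_finsetSum _ fun e _ => hgu e) (integrable_const _) ?_
    filter_upwards [ae_pi_norm_le hC] with b hb
    exact sum_sq_blockTrace_update_sub_le hst hx0 hd b hb k
  refine h1.trans ?_
  simp only [integral_const, probReal_univ, smul_eq_mul, one_mul]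
  have h2 : 2 * C ^ 2 / x ≤ 2 * C ^ 2 := div_le_self (by positivity) hx
  have h3 : (d : ℝ) ≤ d * x ^ 2 := le_mul_of_one_le_right hd'.le (one_le_pow₀ hx)
  gcongr

theorem edgeResolvent_quadratic_nonneg (s t : E → V) (hx : 0 < x)
    (b : E → EuclideanSpace ℝ (Fin d)) (k l : V) (u : Fin d → ℝ) :
    0 ≤ u ⬝ᵥ (matrixBlock (edgeResolvent s t x b) k k - matrixBlock (edgeResolvent s t x b) k l +
      (matrixBlock (edgeResolvent s t x b) l l - matrixBlock (edgeResolvent s t x b) l k)) *ᵥ u := by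
  rw [← blockSingle_sub_quadratic]
  exact dotProduct_gramResolvent_nonneg hx _ _

theorem trace_nonneg_of_quadratic_nonneg {D : Matrix (Fin d) (Fin d) ℝ}
    (hD : ∀ u, 0 ≤ u ⬝ᵥ D *ᵥ u) : 0 ≤ D.trace :=
  Finset.sum_nonneg fun a _ => by simpa using hD (Pi.single a 1)

/-- For a fixed environment `y`, only `u` is random. The ratio is first replaced by normalized
traces without the edge, then by those with it, then by `a` and `b`. Each block trace moves by at
most `1/d`; the numerator contains two of them and the denominator four, hence `6 / d`. -/
theorem abs_integral_edgeRatio_sub_le (hx : 1 ≤ x) (hd : 0 < d) (hp : 0 ≤ p) {e : E}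
    (hμ : HasQuadraticRatios (μ e) p η) (y : E → EuclideanSpace ℝ (Fin d)) {k l : V}
    {a b : ℝ} (ha : 0 ≤ a) (hb : 0 ≤ b) :
    |∫ u, edgeRatio (edgeResolvent s t x (Function.update y e 0)) k l u ∂μ e -
      p * (a / (1 + (a + b)))| ≤
      p * (η + 2 * |blockTrace (edgeResolvent s t x y) k k - a| +
        |blockTrace (edgeResolvent s t x y) l l - b| +
        3 * |blockTrace (edgeResolvent s t x y) k l| + 6 / d) := by
  have hx0 : 0 < x := by linarith
  have hd' : (0 : ℝ) < d := by exact_mod_cast hd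
  set G := edgeResolvent s t x (Function.update y e 0) with hG
  set D₁ := matrixBlock G k k - matrixBlock G k l with hD₁
  set D₂ := matrixBlock G k k - matrixBlock G k l + (matrixBlock G l l - matrixBlock G l k) with hD₂
  have hn : ∀ k l, ‖toEuclideanCLM (𝕜 := ℝ) (matrixBlock G k l)‖ ≤ 1 := fun k l =>
    (norm_matrixBlock_le s t hx0 _ k l).trans (by rw [div_le_one hx0]; exact hx)
  have hn1 : ∀ k l, ‖toEuclideanCLM (𝕜 := ℝ) (matrixBlock G k k - matrixBlock G k l)‖ ≤ 2 := by
    intro k l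
    rw [map_sub]
    exact (norm_sub_le _ _).trans (by linarith [hn k k, hn k l])
  -- Four blocks of norm at most `1/x ≤ 1`: this is the 4 in `HasQuadraticRatios`.
  have hn2 : ‖toEuclideanCLM (𝕜 := ℝ) D₂‖ ≤ 4 := by
    rw [hD₂, map_add]
    exact (norm_add_le _ _).trans (by linarith [hn1 k l, hn1 l k])
  have hpos := edgeResolvent_quadratic_nonneg s t hx0 (Function.update y e 0) k l
  have h1 := hμ D₁ D₂ ((hn1 k l).trans (by norm_num)) hn2 hpos
  have hσ : 0 ≤ (d : ℝ)⁻¹ * D₂.trace :=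
    mul_nonneg (by positivity) (trace_nonneg_of_quadratic_nonneg hpos)
  have h2 := abs_div_one_add_sub_le (τ := (d : ℝ)⁻¹ * D₁.trace) hσ ha (le_add_of_nonneg_right hb)
  have e1 : (d : ℝ)⁻¹ * D₁.trace = blockTrace G k k - blockTrace G k l := by
    rw [hD₁, trace_sub, mul_sub, trace_matrixBlock, trace_matrixBlock]
  have e2 : (d : ℝ)⁻¹ * D₂.trace = blockTrace G k k + blockTrace G l l - 2 * blockTrace G k l := by
    rw [hD₂, trace_add, trace_sub, trace_sub, mul_add, mul_sub, mul_sub, trace_matrixBlock,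
      trace_matrixBlock, trace_matrixBlock, trace_matrixBlock, hG, blockTrace_comm s t x _ l k]
    ring
  have hc : ∀ k l, |blockTrace G k l - blockTrace (edgeResolvent s t x y) k l| ≤ 1 / d := fun k l =>
    (abs_blockTrace_update_sub_le s t hx0 y e k l).trans
      (one_div_le_one_div_of_le hd' (le_mul_of_one_le_right hd'.le hx))
  have c1 := abs_le.1 (hc k k)
  have c2 := abs_le.1 (hc k l)
  have c3 := abs_le.1 (hc l l)
  have a1 := abs_le.1 (le_refl |blockTrace (edgeResolvent s t x y) k k - a|)
  have a2 := abs_le.1 (le_refl |blockTrace (edgeResolvent s t x y) k l|)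
  have a3 := abs_le.1 (le_refl |blockTrace (edgeResolvent s t x y) l l - b|)
  have t1 : |(d : ℝ)⁻¹ * D₁.trace - a| ≤ |blockTrace (edgeResolvent s t x y) k k - a| +
      |blockTrace (edgeResolvent s t x y) k l| + 2 * (1 / d) := by
    rw [e1, abs_le]; constructor <;> linarith
  have t2 : |(d : ℝ)⁻¹ * D₂.trace - (a + b)| ≤ |blockTrace (edgeResolvent s t x y) k k - a| +
      |blockTrace (edgeResolvent s t x y) l l - b| +
      2 * |blockTrace (edgeResolvent s t x y) k l| + 4 * (1 / d) := by
    rw [e2, abs_le]; constructor <;> linarith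
  have h3 : |p * (((d : ℝ)⁻¹ * D₁.trace) / (1 + (d : ℝ)⁻¹ * D₂.trace)) - p * (a / (1 + (a + b)))| ≤
      p * (2 * |blockTrace (edgeResolvent s t x y) k k - a| +
        |blockTrace (edgeResolvent s t x y) l l - b| +
        3 * |blockTrace (edgeResolvent s t x y) k l| + 6 / d) := by
    rw [← mul_sub, abs_mul, abs_of_nonneg hp]
    refine mul_le_mul_of_nonneg_left (h2.trans ?_) hp
    have : (6 : ℝ) / d = 6 * (1 / d) := by ring
    rw [this]
    linarith
  refine (abs_sub_le _ (p * (((d : ℝ)⁻¹ * D₁.trace) / (1 + (d : ℝ)⁻¹ * D₂.trace))) _).trans ?_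
  have h4 : |∫ u, edgeRatio G k l u ∂μ e -
      p * (((d : ℝ)⁻¹ * D₁.trace) / (1 + (d : ℝ)⁻¹ * D₂.trace))| ≤ p * η := h1
  linarith

theorem measurable_edgeRatio (s t : E → V) (hx : 0 < x) (e : E) (k l : V) :
    Measurable fun b : E → EuclideanSpace ℝ (Fin d) =>
      edgeRatio (edgeResolvent s t x (Function.update b e 0)) k l (b e) := by
  have hG : ∀ i j, Measurable fun b : E → EuclideanSpace ℝ (Fin d) =>
      edgeResolvent s t x (Function.update b e 0) i j := fun i j =>
    ((continuous_edgeResolvent s t hx).matrix_elem i j).measurable.comp measurable_update_left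
  have hb : ∀ a, Measurable fun b : E → EuclideanSpace ℝ (Fin d) => b e a := fun a => by fun_prop
  simp only [edgeRatio, dotProduct, mulVec, Matrix.sub_apply, Matrix.add_apply, matrixBlock,
    Matrix.of_apply]
  refine Measurable.div ?_ (measurable_const.add ?_)
  · exact Finset.measurable_sum _ fun a _ => (hb a).mul (Finset.measurable_sum _ fun c _ =>
      ((hG _ _).sub (hG _ _)).mul (hb c))
  · exact Finset.measurable_sum _ fun a _ => (hb a).mul (Finset.measurable_sum _ fun c _ =>
      (((hG _ _).sub (hG _ _)).add ((hG _ _).sub (hG _ _))).mul (hb c))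

theorem abs_quadratic_le (D : Matrix (Fin d) (Fin d) ℝ) (u : EuclideanSpace ℝ (Fin d)) :
    |u.ofLp ⬝ᵥ D *ᵥ u.ofLp| ≤ ‖toEuclideanCLM (𝕜 := ℝ) D‖ * ‖u‖ ^ 2 := by
  have h : u.ofLp ⬝ᵥ D *ᵥ u.ofLp = inner ℝ (toEuclideanCLM (𝕜 := ℝ) D u) u := by
    simp [PiLp.inner_apply, dotProduct]
  rw [h]
  refine (abs_real_inner_le_norm _ _).trans ?_
  have := (toEuclideanCLM (𝕜 := ℝ) D).le_opNorm u
  nlinarith [norm_nonneg u]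

theorem integrable_edgeRatio (hx : 1 ≤ x) (hC : ∀ e, ∀ᵐ u ∂μ e, ‖u‖ ≤ C) (e : E) (k l : V) :
    Integrable (fun b : E → EuclideanSpace ℝ (Fin d) =>
      edgeRatio (edgeResolvent s t x (Function.update b e 0)) k l (b e)) (Measure.pi μ) := by
  have hx0 : 0 < x := by linarith
  refine Integrable.of_bound (measurable_edgeRatio s t hx0 e k l).aestronglyMeasurable (2 * C ^ 2) ?_
  filter_upwards [ae_pi_norm_le hC] with b hb
  have hpos := edgeResolvent_quadratic_nonneg s t hx0 (Function.update b e 0) k l (b e).ofLp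
  set G := edgeResolvent s t x (Function.update b e 0)
  have hn : ∀ k l, ‖toEuclideanCLM (𝕜 := ℝ) (matrixBlock G k l)‖ ≤ 1 := fun k l =>
    (norm_matrixBlock_le s t hx0 _ k l).trans (by rw [div_le_one hx0]; exact hx)
  have hn1 : ‖toEuclideanCLM (𝕜 := ℝ) (matrixBlock G k k - matrixBlock G k l)‖ ≤ 2 := by
    rw [map_sub]
    exact (norm_sub_le _ _).trans (by linarith [hn k k, hn k l])
  rw [edgeRatio, Real.norm_eq_abs, abs_div, abs_of_nonneg (by linarith : (0 : ℝ) ≤ 1 + _)]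
  refine (div_le_self (abs_nonneg _) (by linarith)).trans ?_
  refine (abs_quadratic_le _ _).trans ?_
  have := hb e
  gcongr

theorem abs_mean_edgeRatio_sub_le (hst : ∀ e, s e ≠ t e) (hx : 1 ≤ x) (hd : 0 < d) (hp : 0 ≤ p)
    (hC : ∀ e, ∀ᵐ u ∂μ e, ‖u‖ ≤ C) {e : E} (hμ : HasQuadraticRatios (μ e) p η) (k l : V) :
    |∫ b, edgeRatio (edgeResolvent s t x (Function.update b e 0)) k l (b e) ∂Measure.pi μ -
      p * (meanBlockTrace μ s t x k /
        (1 + (meanBlockTrace μ s t x k + meanBlockTrace μ s t x l)))| ≤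
      p * (η + 3 * √(2 * (1 + 2 * C ^ 2) / d) +
        3 * ∫ b, |blockTrace (edgeResolvent s t x b) k l| ∂Measure.pi μ + 6 / d) := by
  have hx0 : 0 < x := by linarith
  set a := meanBlockTrace μ s t x k with ha_def
  set a' := meanBlockTrace μ s t x l with ha'_def
  have ha : 0 ≤ a := meanBlockTrace_nonneg hx0 k
  have ha' : 0 ≤ a' := meanBlockTrace_nonneg hx0 l
  obtain ⟨h1, h2⟩ := integral_pi_resample μ (measurable_edgeRatio s t hx0 e k l)
    (integrable_edgeRatio hx hC e k l) e
  simp only [Function.update_idem, Function.update_self] at h1 h2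
  rw [h2]
  have h3 : ∫ y, ∫ u, edgeRatio (edgeResolvent s t x (Function.update y e 0)) k l u ∂μ e
      ∂Measure.pi μ - p * (a / (1 + (a + a'))) =
      ∫ y, (∫ u, edgeRatio (edgeResolvent s t x (Function.update y e 0)) k l u ∂μ e -
        p * (a / (1 + (a + a')))) ∂Measure.pi μ := by
    rw [integral_sub h1 (integrable_const _)]
    simp
  rw [h3]
  refine abs_integral_le_integral_abs.trans ?_
  have i1 : ∀ k, Integrable (fun b =>
      |blockTrace (edgeResolvent s t x b) k k - meanBlockTrace μ s t x k|) (Measure.pi μ) := fun k =>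
    ((integrable_blockTrace μ s t hx0 hd k k).sub (integrable_const _)).abs
  have i2 : Integrable (fun b => |blockTrace (edgeResolvent s t x b) k l|) (Measure.pi μ) :=
    (integrable_blockTrace μ s t hx0 hd k l).abs
  have j1 : Integrable (fun b => η +
      2 * |blockTrace (edgeResolvent s t x b) k k - a|) (Measure.pi μ) :=
    (integrable_const _).add ((i1 k).const_mul 2)
  have j2 : Integrable (fun b => η + 2 * |blockTrace (edgeResolvent s t x b) k k - a| +
      |blockTrace (edgeResolvent s t x b) l l - a'|) (Measure.pi μ) := j1.add (i1 l)
  have j3 : Integrable (fun b => η + 2 * |blockTrace (edgeResolvent s t x b) k k - a| +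
      |blockTrace (edgeResolvent s t x b) l l - a'| +
      3 * |blockTrace (edgeResolvent s t x b) k l|) (Measure.pi μ) := j2.add (i2.const_mul 3)
  have h4 := integral_mono (h1.sub (integrable_const (p * (a / (1 + (a + a')))))).abs
    ((j3.add (integrable_const (6 / (d : ℝ)))).const_mul p)
    fun y => abs_integral_edgeRatio_sub_le hx hd hp hμ y ha ha'
  refine h4.trans ?_
  rw [integral_const_mul]
  refine mul_le_mul_of_nonneg_left ?_ hp
  simp only [Pi.add_apply]
  rw [integral_add j3 (integrable_const _), integral_add j2 (i2.const_mul 3),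
    integral_add j1 (i1 l), integral_add (integrable_const _) ((i1 k).const_mul 2),
    integral_const_mul, integral_const_mul]
  simp only [integral_const, probReal_univ, smul_eq_mul, one_mul]
  have hk := integral_abs_blockTrace_sub_le hst hx hd hC k
  have hl := integral_abs_blockTrace_sub_le hst hx hd hC l
  linarith

/-- The edges of the complete graph: each vertex `k` is joined exactly once to each `l ≠ k`. -/
def IsCompleteEdgeSet (s t : E → V) : Prop :=
  ∀ (k : V) (F : V → ℝ), ∑ e, ((if k = s e then F (t e) else 0) + if k = t e then F (s e) else 0) =
    ∑ l ∈ Finset.univ.erase k, F l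

/-- Average the exact identity and sum the edge errors at `k`. The off-diagonal traces of row `k`
sum to at most `√r` in mean, which relative to `r` edges gives `3 / √r`. -/
theorem abs_meanBlockTrace_equation_le [Nonempty V] (hst : ∀ e, s e ≠ t e)
    (hcomp : IsCompleteEdgeSet s t)
    (hx : 1 ≤ x) (hd : 0 < d) (hp : 0 ≤ p) (hη : 0 ≤ η)
    (hC : ∀ e, ∀ᵐ u ∂μ e, ‖u‖ ≤ C) (hμ : ∀ e, HasQuadraticRatios (μ e) p η) (k : V) :
    |1 - x * meanBlockTrace μ s t x k - p / d * ∑ l ∈ Finset.univ.erase k,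
      meanBlockTrace μ s t x k / (1 + meanBlockTrace μ s t x k + meanBlockTrace μ s t x l)| ≤
      Fintype.card V * p / d * (η + 3 * √(2 * (1 + 2 * C ^ 2) / d) + 6 / d +
        3 / √(Fintype.card V)) := by
  have hx0 : 0 < x := by linarith
  have hd' : (0 : ℝ) < d := by exact_mod_cast hd
  have hr : (0 : ℝ) < ((Fintype.card V : ℕ) : ℝ) := by exact_mod_cast Fintype.card_pos
  set f := meanBlockTrace μ s t x with hf
  set I : E → V → V → ℝ := fun e k l =>
    ∫ b, edgeRatio (edgeResolvent s t x (Function.update b e 0)) k l (b e) ∂Measure.pi μ with hI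
  have hmean : 1 - x * f k = (d : ℝ)⁻¹ * ∑ e, ((if k = s e then I e (s e) (t e) else 0) +
      (if k = t e then I e (t e) (s e) else 0)) := by
    have hi : ∀ (q : Prop) [Decidable q] (e : E) (k l : V), Integrable (fun b => if q then
        edgeRatio (edgeResolvent s t x (Function.update b e 0)) k l (b e) else 0)
        (Measure.pi μ) := by
      intro q _ e k l
      by_cases hq : q
      · simpa [hq] using integrable_edgeRatio hx hC e k l
      · simp [hq]
    have h1 : 1 - x * f k = ∫ b, (1 - x * blockTrace (edgeResolvent s t x b) k k)
        ∂Measure.pi μ := by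
      rw [integral_sub (integrable_const _)
        ((integrable_blockTrace μ s t hx0 hd k k).const_mul x), integral_const_mul]
      simp [hf, meanBlockTrace]
    rw [h1]
    simp only [one_sub_mul_blockTrace hst hx0 hd]
    rw [integral_const_mul]
    congr 1
    refine (integral_finsetSum _ fun e _ => (hi (k = s e) e (s e) (t e)).add
      (hi (k = t e) e (t e) (s e))).trans (Finset.sum_congr rfl fun e _ => ?_)
    simp only [Pi.add_apply]
    rw [integral_add (hi _ e _ _) (hi _ e _ _)]
    congr 1 <;> split_ifs <;> simp [hI]
  have hsum : p / d * ∑ l ∈ Finset.univ.erase k, f k / (1 + f k + f l) =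
      (d : ℝ)⁻¹ * ∑ e, ((if k = s e then p * (f (s e) / (1 + (f (s e) + f (t e)))) else 0) +
      (if k = t e then p * (f (t e) / (1 + (f (t e) + f (s e)))) else 0)) := by
    rw [← hcomp k fun l => f k / (1 + f k + f l), Finset.mul_sum, Finset.mul_sum]
    refine Finset.sum_congr rfl fun e _ => ?_
    rw [mul_add, mul_add]
    congr 1 <;> split_ifs with h
    · subst h; rw [← add_assoc]; field_simp
    · simp
    · subst h; rw [← add_assoc]; field_simp
    · simp
  set err : V → ℝ := fun l => p * (η + 3 * √(2 * (1 + 2 * C ^ 2) / d) +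
        3 * ∫ b, |blockTrace (edgeResolvent s t x b) k l| ∂Measure.pi μ + 6 / d) with herr
  have hE : ∀ e k l, |I e k l - p * (f k / (1 + (f k + f l)))| ≤
      p * (η + 3 * √(2 * (1 + 2 * C ^ 2) / d) +
        3 * ∫ b, |blockTrace (edgeResolvent s t x b) k l| ∂Measure.pi μ + 6 / d) := fun e k l =>
    abs_mean_edgeRatio_sub_le hst hx hd hp hC (hμ e) k l
  rw [hmean, hsum, ← mul_sub, ← Finset.sum_sub_distrib, abs_mul, abs_of_pos (by positivity)]
  have hbound : |∑ e, (((if k = s e then I e (s e) (t e) else 0) +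
      (if k = t e then I e (t e) (s e) else 0)) -
      ((if k = s e then p * (f (s e) / (1 + (f (s e) + f (t e)))) else 0) +
      (if k = t e then p * (f (t e) / (1 + (f (t e) + f (s e)))) else 0)))| ≤
      ∑ l ∈ Finset.univ.erase k, err l := by
    rw [← hcomp k err]
    refine (Finset.abs_sum_le_sum_abs _ _).trans (Finset.sum_le_sum fun e _ => ?_)
    rw [add_sub_add_comm]
    refine (abs_add_le _ _).trans (add_le_add ?_ ?_)
    · split_ifs with h
      · rw [herr]; simp only [h]; exact hE e _ _
      · simp
    · split_ifs with h
      · rw [herr]; simp only [h]; exact hE e _ _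
      · simp
  have herr0 : ∀ l, 0 ≤ err l := fun l => by
    have : 0 ≤ ∫ b, |blockTrace (edgeResolvent s t x b) k l| ∂Measure.pi μ :=
      integral_nonneg fun b => abs_nonneg _
    positivity
  have hoff : ∑ l, ∫ b, |blockTrace (edgeResolvent s t x b) k l| ∂Measure.pi μ ≤
      √(Fintype.card V) := by
    rw [← integral_finsetSum _ fun l _ => (integrable_blockTrace μ s t hx0 hd k l).abs]
    have : ∫ b, ∑ l, |blockTrace (edgeResolvent s t x b) k l| ∂Measure.pi μ ≤
        ∫ b, √(Fintype.card V) / x ∂Measure.pi μ :=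
      integral_mono (integrable_finsetSum _ fun l _ =>
        (integrable_blockTrace μ s t hx0 hd k l).abs) (integrable_const _)
        fun b => sum_abs_blockTrace_le s t hx0 hd b k
    refine this.trans ?_
    simp only [integral_const, probReal_univ, smul_eq_mul, one_mul]
    exact div_le_self (Real.sqrt_nonneg _) hx
  have htot : ∑ l ∈ Finset.univ.erase k, err l ≤
      p * (Fintype.card V * (η + 3 * √(2 * (1 + 2 * C ^ 2) / d) + 6 / d) +
        3 * √(Fintype.card V)) := by
    refine (Finset.sum_le_sum_of_subset_of_nonneg (Finset.erase_subset _ _)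
      fun l _ _ => herr0 l).trans ?_
    rw [herr, ← Finset.mul_sum]
    refine mul_le_mul_of_nonneg_left ?_ hp
    simp only [Finset.sum_add_distrib, ← Finset.mul_sum, Finset.sum_const, Finset.card_univ,
      nsmul_eq_mul]
    linarith
  refine (mul_le_mul_of_nonneg_left (hbound.trans htot) (by positivity)).trans (le_of_eq ?_)
  have hsq : √((Fintype.card V : ℕ) : ℝ) ^ 2 = ((Fintype.card V : ℕ) : ℝ) := Real.sq_sqrt hr.le
  have hsq0 : 0 < √((Fintype.card V : ℕ) : ℝ) := Real.sqrt_pos.2 hr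
  field_simp
  linear_combination (3 * p * d) * hsq

/-- The normalized trace of the resolvent is close to the solution `σ` of the limiting equation. -/
theorem integral_abs_trace_sub_le [Nonempty V] (hst : ∀ e, s e ≠ t e) (hcomp : IsCompleteEdgeSet s t)
    (hx : 1 ≤ x) (hd : 0 < d) (hp : 0 ≤ p) (hη : 0 ≤ η)
    (hC : ∀ e, ∀ᵐ u ∂μ e, ‖u‖ ≤ C) (hμ : ∀ e, HasQuadraticRatios (μ e) p η)
    {c σ : ℝ} (hσ : 0 ≤ σ) (hσeq : 1 - x * σ = c * (σ / (1 + σ + σ)))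
    (hxp : 2 * (Fintype.card V * p / d) + 1 ≤ x) :
    ∫ b, |((Fintype.card V : ℝ) * d)⁻¹ * (edgeResolvent s t x b).trace - σ| ∂Measure.pi μ ≤
      √(2 * (1 + 2 * C ^ 2) / d) + (Fintype.card V * p / d *
        (η + 3 * √(2 * (1 + 2 * C ^ 2) / d) + 6 / d + 3 / √(Fintype.card V)) +
        |Fintype.card V * p / d - c| + p / d) := by
  have hx0 : 0 < x := by linarith
  have hd' : (0 : ℝ) < d := by exact_mod_cast hd
  have hr : (0 : ℝ) < ((Fintype.card V : ℕ) : ℝ) := by exact_mod_cast Fintype.card_pos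
  set f := meanBlockTrace μ s t x with hf
  have h1 := sum_abs_sub_le_of_approx_equation (q := p / d) (by positivity)
    (fun k => meanBlockTrace_nonneg (μ := μ) (s := s) (t := t) hx0 k) hσ hσeq
    (abs_meanBlockTrace_equation_le hst hcomp hx hd hp hη hC hμ) hx0.le
  rw [← mul_div_assoc, ← hf] at h1
  set ε := Fintype.card V * p / d *
        (η + 3 * √(2 * (1 + 2 * C ^ 2) / d) + 6 / d + 3 / √(Fintype.card V)) with hε
  have hM0 : 0 ≤ ∑ k, |f k - σ| := Finset.sum_nonneg fun _ _ => abs_nonneg _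
  -- By `hxp` the stability factor `x - 2 r p / d` is at least 1.
  have h2 : ∑ k, |f k - σ| ≤ Fintype.card V * (ε + |Fintype.card V * p / d - c| + p / d) := by
    refine le_trans ?_ h1
    exact le_mul_of_one_le_left hM0 (by linarith)
  have htr : ∀ b : E → EuclideanSpace ℝ (Fin d), ((Fintype.card V : ℝ) * d)⁻¹ * (edgeResolvent s t x b).trace - σ =
      (Fintype.card V : ℝ)⁻¹ * ∑ k, ((blockTrace (edgeResolvent s t x b) k k - f k) +
        (f k - σ)) := by
    intro b
    have : (edgeResolvent s t x b).trace =
        d * ∑ k, blockTrace (edgeResolvent s t x b) k k := by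
      rw [Matrix.trace, Fintype.sum_prod_type, Finset.mul_sum]
      refine Finset.sum_congr rfl fun k _ => ?_
      rw [blockTrace, mul_inv_cancel_left₀ hd'.ne']
      rfl
    rw [this]
    simp only [sub_add_sub_cancel, Finset.sum_sub_distrib, Finset.sum_const, Finset.card_univ,
      nsmul_eq_mul]
    field_simp
  have hi : ∀ k, Integrable (fun b => |blockTrace (edgeResolvent s t x b) k k - f k|)
      (Measure.pi μ) := fun k =>
    ((integrable_blockTrace μ s t hx0 hd k k).sub (integrable_const _)).abs
  have hi' : ∀ k, Integrable (fun b => |blockTrace (edgeResolvent s t x b) k k - f k| + |f k - σ|)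
      (Measure.pi μ) := fun k => (hi k).add (integrable_const _)
  have hi2 : Integrable (fun b => (Fintype.card V : ℝ)⁻¹ *
      ∑ k, (|blockTrace (edgeResolvent s t x b) k k - f k| + |f k - σ|)) (Measure.pi μ) :=
    (integrable_finsetSum _ fun k _ => hi' k).const_mul _
  have h3 : ∫ b, |((Fintype.card V : ℝ) * d)⁻¹ * (edgeResolvent s t x b).trace - σ|
      ∂Measure.pi μ ≤ ∫ b, (Fintype.card V : ℝ)⁻¹ *
      ∑ k, (|blockTrace (edgeResolvent s t x b) k k - f k| + |f k - σ|) ∂Measure.pi μ := by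
    refine integral_mono_of_nonneg (ae_of_all _ fun b => abs_nonneg _) hi2 (ae_of_all _ fun b => ?_)
    simp only
    rw [htr, abs_mul, abs_of_pos (by positivity)]
    refine mul_le_mul_of_nonneg_left ?_ (by positivity)
    exact (Finset.abs_sum_le_sum_abs _ _).trans (Finset.sum_le_sum fun k _ => abs_add_le _ _)
  refine h3.trans ?_
  rw [integral_const_mul, integral_finsetSum _ fun k _ => hi' k]
  have h4 : ∑ k, ∫ b, (|blockTrace (edgeResolvent s t x b) k k - f k| + |f k - σ|) ∂Measure.pi μ ≤
      Fintype.card V * √(2 * (1 + 2 * C ^ 2) / d) + ∑ k, |f k - σ| := by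
    have : ∀ k, ∫ b, (|blockTrace (edgeResolvent s t x b) k k - f k| + |f k - σ|) ∂Measure.pi μ ≤
        √(2 * (1 + 2 * C ^ 2) / d) + |f k - σ| := by
      intro k
      rw [integral_add (hi k) (integrable_const _)]
      simp only [integral_const, probReal_univ, smul_eq_mul, one_mul]
      have := integral_abs_blockTrace_sub_le hst hx hd hC k
      gcongr
    refine (Finset.sum_le_sum fun k _ => this k).trans ?_
    rw [Finset.sum_add_distrib]
    simp
  calc _ ≤ (Fintype.card V : ℝ)⁻¹ * (Fintype.card V * √(2 * (1 + 2 * C ^ 2) / d) +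
        Fintype.card V * (ε + |Fintype.card V * p / d - c| + p / d)) := by
        refine mul_le_mul_of_nonneg_left ?_ (by positivity)
        exact h4.trans (by linarith)
    _ = _ := by field_simp

end ProductModel

/-! ### Mass and Stieltjes transform of the limit law. -/

section MarchenkoPasturIntegral

/-- An antiderivative of `√((B - s) (s - A)) / s`. -/
noncomputable def sqrtDivPrimitive (A B s : ℝ) : ℝ :=
  √((B - s) * (s - A)) + (A + B) / 2 * Real.arcsin ((2 * s - A - B) / (B - A))
    - √(A * B) * Real.arcsin (((A + B) * s - 2 * A * B) / (s * (B - A)))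

theorem hasDerivAt_sqrtDivPrimitive {A B s : ℝ} (hA : 0 ≤ A) (hs : s ∈ Set.Ioo A B) :
    HasDerivAt (sqrtDivPrimitive A B) (√((B - s) * (s - A)) / s) s := by
  obtain ⟨h1, h2⟩ := hs
  have hs0 : 0 < s := hA.trans_lt h1
  have hB : 0 < B := hs0.trans h2
  have hBA : 0 < B - A := by linarith
  have hQ : 0 < (B - s) * (s - A) := mul_pos (by linarith) (by linarith)
  set R := √((B - s) * (s - A)) with hR
  have hR0 : 0 < R := Real.sqrt_pos.2 hQ
  have hRsq : R ^ 2 = (B - s) * (s - A) := Real.sq_sqrt hQ.le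
  have hd1 : HasDerivAt (fun s => √((B - s) * (s - A))) (((-1) * (s - A) + (B - s) * 1) / (2 * R)) s :=
    (((hasDerivAt_id' s).const_sub B).mul ((hasDerivAt_id' s).sub_const A)).sqrt hQ.ne'
  -- A perfect square, so the derivative of the arcsine is a rational expression in `R`; `hw` below
  -- plays the same role for the second arcsine.
  have hv : 1 - ((2 * s - A - B) / (B - A)) ^ 2 = (2 * R / (B - A)) ^ 2 := by
    field_simp
    rw [hRsq]; ring
  have hne1 : (2 * s - A - B) / (B - A) ≠ -1 := by
    rw [Ne, div_eq_iff hBA.ne']; intro h; linarith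
  have hne2 : (2 * s - A - B) / (B - A) ≠ 1 := by
    rw [Ne, div_eq_iff hBA.ne']; intro h; linarith
  have hd2 : HasDerivAt (fun s => Real.arcsin ((2 * s - A - B) / (B - A))) (1 / R) s := by
    have h := (Real.hasDerivAt_arcsin hne1 hne2).comp s
      (((((hasDerivAt_id' s).const_mul 2).sub_const A).sub_const B).div_const (B - A))
    rw [hv, Real.sqrt_sq (by positivity)] at h
    refine h.congr_deriv ?_
    field_simp
  have hd3 : HasDerivAt (fun s => √(A * B) *
      Real.arcsin (((A + B) * s - 2 * A * B) / (s * (B - A)))) (A * B / (s * R)) s := by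
    -- For `A = 0` the coefficient `√(A * B)` kills the second arcsine term.
    rcases hA.eq_or_lt with hA0 | hA0
    · subst hA0
      simpa using hasDerivAt_const s (0 : ℝ)
    have hAB : 0 < √(A * B) := Real.sqrt_pos.2 (by positivity)
    have hABsq : √(A * B) ^ 2 = A * B := Real.sq_sqrt (by positivity)
    have hw : 1 - (((A + B) * s - 2 * A * B) / (s * (B - A))) ^ 2 =
        (2 * √(A * B) * R / (s * (B - A))) ^ 2 := by
      field_simp
      rw [hRsq, hABsq]; ring
    have hpos : 0 < (2 * √(A * B) * R / (s * (B - A))) ^ 2 := by positivity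
    have hn1 : ((A + B) * s - 2 * A * B) / (s * (B - A)) ≠ -1 := by
      intro h; rw [h] at hw; linarith
    have hn2 : ((A + B) * s - 2 * A * B) / (s * (B - A)) ≠ 1 := by
      intro h; rw [h] at hw; linarith
    have h := ((Real.hasDerivAt_arcsin hn1 hn2).comp s
      ((((hasDerivAt_id' s).const_mul (A + B)).sub_const (2 * A * B)).div
        ((hasDerivAt_id' s).mul_const (B - A)) (by positivity))).const_mul (√(A * B))
    rw [hw, Real.sqrt_sq (by positivity)] at h
    refine h.congr_deriv ?_
    field_simp
    ring
  have h := (hd1.add (hd2.const_mul ((A + B) / 2))).sub hd3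
  refine h.congr_deriv ?_
  field_simp
  rw [hRsq]
  ring

theorem continuousOn_sqrtDivPrimitive {A B : ℝ} (hA : 0 ≤ A) (hAB : A < B) :
    ContinuousOn (sqrtDivPrimitive A B) (Set.Icc A B) := by
  unfold sqrtDivPrimitive
  refine ContinuousOn.sub (by fun_prop) ?_
  rcases hA.eq_or_lt with hA0 | hA0
  · subst hA0; simpa using continuousOn_const
  · refine continuousOn_const.mul (Real.continuous_arcsin.comp_continuousOn ?_)
    refine ContinuousOn.div (by fun_prop) (by fun_prop) fun s hs => ?_
    have : 0 < s := hA0.trans_le hs.1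
    have : 0 < B - A := by linarith
    positivity

theorem sqrtDivPrimitive_sub {A B : ℝ} (hA : 0 ≤ A) (hAB : A < B) :
    sqrtDivPrimitive A B B - sqrtDivPrimitive A B A = Real.pi * ((A + B) / 2 - √(A * B)) := by
  have hBA : B - A ≠ 0 := by linarith [hAB]
  have hB : 0 < B := by linarith
  have e1 : (2 * B - A - B) / (B - A) = 1 := by field_simp; ring
  have e2 : (2 * A - A - B) / (B - A) = -1 := by field_simp; ring
  have e3 : ((A + B) * B - 2 * A * B) / (B * (B - A)) = 1 := by field_simp; ring
  unfold sqrtDivPrimitive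
  rw [e1, e2, e3]
  rcases hA.eq_or_lt with hA0 | hA0
  · subst hA0; simp; ring
  · have e4 : ((A + B) * A - 2 * A * B) / (A * (B - A)) = -1 := by field_simp; ring
    rw [e4]; simp; ring

/-- The integrand may be singular at `A = 0`, but it is the nonnegative derivative of a function
continuous up to the endpoints, hence integrable. -/
theorem intervalIntegrable_sqrt_div {A B : ℝ} (hA : 0 ≤ A) (hAB : A < B) :
    IntervalIntegrable (fun s => √((B - s) * (s - A)) / s) volume A B := by
  rw [intervalIntegrable_iff_integrableOn_Ioc_of_le hAB.le]
  exact intervalIntegral.integrableOn_deriv_of_nonneg (continuousOn_sqrtDivPrimitive hA hAB)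
    (fun s hs => hasDerivAt_sqrtDivPrimitive hA hs)
    fun s hs => div_nonneg (Real.sqrt_nonneg _) (hA.trans hs.1.le)

theorem integral_sqrt_div {A B : ℝ} (hA : 0 ≤ A) (hAB : A < B) :
    ∫ s in A..B, √((B - s) * (s - A)) / s = Real.pi * ((A + B) / 2 - √(A * B)) := by
  rw [intervalIntegral.integral_eq_sub_of_hasDerivAt_of_le hAB.le
    (continuousOn_sqrtDivPrimitive hA hAB) (fun s hs => hasDerivAt_sqrtDivPrimitive hA hs)
    (intervalIntegrable_sqrt_div hA hAB), sqrtDivPrimitive_sub hA hAB]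

theorem intervalIntegrable_sqrt_div_add {a b y : ℝ} (h : 0 ≤ a + y) (hab : a < b) :
    IntervalIntegrable (fun t => √((b - t) * (t - a)) / (t + y)) volume a b := by
  have := (intervalIntegrable_sqrt_div h (show a + y < b + y by linarith)).comp_add_right y
  simpa using this

theorem integral_sqrt_div_add {a b y : ℝ} (h : 0 ≤ a + y) (hab : a < b) :
    ∫ t in a..b, √((b - t) * (t - a)) / (t + y) =
      Real.pi * ((a + b) / 2 + y - √((a + y) * (b + y))) := by
  have h1 := integral_sqrt_div h (show a + y < b + y by linarith)
  rw [← intervalIntegral.integral_comp_add_right] at h1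
  simp only [add_sub_add_right_eq_sub] at h1
  rw [h1]; congr 1; ring

/-- The interval is open on the left so that `t > 0` on it, even when `c = 2` and the left edge is
`0`. -/
theorem laplacianDensity_eq (c t : ℝ) :
    laplacianDensity c t = (Set.Ioc ((√2 - √c) ^ 2) ((√2 + √c) ^ 2)).indicator (fun t =>
      1 / (4 * Real.pi) * (√(((√2 + √c) ^ 2 - t) * (t - (√2 - √c) ^ 2)) / t)) t := by
  have hab : (√2 - √c) ^ 2 ≤ (√2 + √c) ^ 2 := by
    nlinarith [mul_nonneg (Real.sqrt_nonneg 2) (Real.sqrt_nonneg c)]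
  unfold laplacianDensity
  by_cases ht : t ∈ Set.Ioc ((√2 - √c) ^ 2) ((√2 + √c) ^ 2)
  · rw [Set.indicator_of_mem ht, max_eq_left]
    · field_simp
    · exact mul_nonneg (by linarith [ht.2]) (by linarith [ht.1])
  · rw [Set.indicator_of_notMem ht, max_eq_right]
    · simp
    · by_cases h : (√2 - √c) ^ 2 < t
      · have : (√2 + √c) ^ 2 < t := by
          by_contra h'
          exact ht ⟨h, not_lt.1 h'⟩
        exact mul_nonpos_of_nonpos_of_nonneg (by linarith) (by linarith)
      · exact mul_nonpos_of_nonneg_of_nonpos (by linarith) (by linarith)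

theorem laplacianDensity_nonneg (c t : ℝ) : 0 ≤ laplacianDensity c t := by
  rw [laplacianDensity_eq]
  refine Set.indicator_nonneg (fun s hs => ?_) t
  have : 0 < s := (sq_nonneg _).trans_lt hs.1
  positivity

theorem integrable_laplacianDensity {c : ℝ} (hc : 0 ≤ c) : Integrable (laplacianDensity c) := by
  have h : laplacianDensity c = _ := funext (laplacianDensity_eq c)
  rw [h, integrable_indicator_iff measurableSet_Ioc]
  rcases hc.eq_or_lt with hc0 | hc0
  · subst hc0; simp
  have hab : (√2 - √c) ^ 2 < (√2 + √c) ^ 2 := by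
    nlinarith [mul_pos (Real.sqrt_pos.2 (show (0 : ℝ) < 2 by norm_num)) (Real.sqrt_pos.2 hc0)]
  exact ((intervalIntegrable_iff_integrableOn_Ioc_of_le hab.le).1
    (intervalIntegrable_sqrt_div (sq_nonneg _) hab)).const_mul _

theorem edge_sum_mul {c : ℝ} (hc : 0 ≤ c) :
    (√2 - √c) ^ 2 + (√2 + √c) ^ 2 = 4 + 2 * c ∧
      (√2 - √c) ^ 2 * (√2 + √c) ^ 2 = (2 - c) ^ 2 := by
  have h2 : √2 ^ 2 = 2 := Real.sq_sqrt (by norm_num)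
  have h3 : √c ^ 2 = c := Real.sq_sqrt hc
  constructor
  · linear_combination 2 * h2 + 2 * h3
  · rw [← mul_pow]
    congr 1
    linear_combination h2 - h3

/-- The value `y = 0` gives the mass of the density and `y = x` its Stieltjes transform; `c > 0`
keeps the interval nondegenerate. -/
theorem integral_laplacianDensity_div {c y : ℝ} (hc : 0 < c) (hy : 0 ≤ y) :
    ∫ t, 1 / (4 * Real.pi) *
      ((Set.Ioc ((√2 - √c) ^ 2) ((√2 + √c) ^ 2)).indicator (fun t =>
      √(((√2 + √c) ^ 2 - t) * (t - (√2 - √c) ^ 2)) / (t + y)) t) =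
      (2 + c + y - √((y + c - 2) ^ 2 + 8 * y)) / 4 := by
  have hab : (√2 - √c) ^ 2 < (√2 + √c) ^ 2 := by
    nlinarith [mul_pos (Real.sqrt_pos.2 (show (0 : ℝ) < 2 by norm_num)) (Real.sqrt_pos.2 hc)]
  obtain ⟨h1, h2⟩ := edge_sum_mul hc.le
  rw [integral_const_mul, integral_indicator measurableSet_Ioc,
    ← intervalIntegral.integral_of_le hab.le,
    integral_sqrt_div_add (by positivity) hab]
  have h3 : ((√2 - √c) ^ 2 + y) * ((√2 + √c) ^ 2 + y) = (y + c - 2) ^ 2 + 8 * y := by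
    linear_combination h2 + y * h1
  rw [h3, h1]
  field_simp
  ring

theorem integral_laplacianDensity {c : ℝ} (hc : 0 ≤ c) :
    ∫ t, laplacianDensity c t = 1 - max (1 - c / 2) 0 := by
  have h : laplacianDensity c = _ := funext (laplacianDensity_eq c)
  rcases hc.eq_or_lt with hc0 | hc0
  · subst hc0; rw [h]; simp
  have h1 := integral_laplacianDensity_div hc0 le_rfl
  rw [h]
  simp only [add_zero, zero_add, mul_zero, Real.sqrt_sq_eq_abs] at h1
  simp only [Set.indicator_const_mul]
  rw [h1]
  rcases le_total c 2 with h2 | h2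
  · rw [abs_of_nonpos (by linarith), max_eq_left (by linarith)]; ring
  · rw [abs_of_nonneg (by linarith), max_eq_right (by linarith)]; ring

/-- Partial fractions: `1 / (t (t + x)) = (1/x) (1/t - 1/(t + x))`. The last term of the result
cancels against the atom at `0`. -/
theorem integral_laplacianDensity_mul_inv {c x : ℝ} (hc : 0 ≤ c) (hx : 0 < x) :
    ∫ t, laplacianDensity c t * (1 / (t + x)) =
      ((2 - c) - x + √((x + c - 2) ^ 2 + 8 * x)) / (4 * x) - max (1 - c / 2) 0 / x := by
  have h : laplacianDensity c = _ := funext (laplacianDensity_eq c)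
  rcases hc.eq_or_lt with hc0 | hc0
  · subst hc0; rw [h]
    have : (x + 0 - 2) ^ 2 + 8 * x = (x + 2) ^ 2 := by ring
    rw [this, Real.sqrt_sq (by linarith)]
    simp; field_simp; ring
  have h1 := integral_laplacianDensity_div hc0 hx.le
  have h2 := integral_laplacianDensity hc
  have h3 : ∀ t, laplacianDensity c t * (1 / (t + x)) = 1 / x * (laplacianDensity c t -
      1 / (4 * Real.pi) *
      ((Set.Ioc ((√2 - √c) ^ 2) ((√2 + √c) ^ 2)).indicator (fun t =>
      √(((√2 + √c) ^ 2 - t) * (t - (√2 - √c) ^ 2)) / (t + x)) t)) := by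
    intro t
    rw [laplacianDensity_eq]
    by_cases ht : t ∈ Set.Ioc ((√2 - √c) ^ 2) ((√2 + √c) ^ 2)
    · have : 0 < t := (sq_nonneg _).trans_lt ht.1
      rw [Set.indicator_of_mem ht, Set.indicator_of_mem ht]
      field_simp
      ring
    · simp [Set.indicator_of_notMem ht]
  have hab : (√2 - √c) ^ 2 < (√2 + √c) ^ 2 := by
    nlinarith [mul_pos (Real.sqrt_pos.2 (show (0 : ℝ) < 2 by norm_num)) (Real.sqrt_pos.2 hc0)]
  have h4 : Integrable (fun t => 1 / (4 * Real.pi) *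
      ((Set.Ioc ((√2 - √c) ^ 2) ((√2 + √c) ^ 2)).indicator (fun t =>
      √(((√2 + √c) ^ 2 - t) * (t - (√2 - √c) ^ 2)) / (t + x)) t)) := by
    refine Integrable.const_mul ?_ _
    rw [integrable_indicator_iff measurableSet_Ioc]
    exact (intervalIntegrable_iff_integrableOn_Ioc_of_le hab.le).1
      (intervalIntegrable_sqrt_div_add (by positivity) hab)
  simp only [h3]
  rw [integral_const_mul, integral_sub (integrable_laplacianDensity hc) h4, h1, h2]
  field_simp
  ring

theorem isProbabilityMeasure_laplacianLimitLaw {c : ℝ} (hc : 0 ≤ c) :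
    IsProbabilityMeasure (laplacianLimitLaw c) := by
  constructor
  have h1 : ∫⁻ t, ENNReal.ofReal (laplacianDensity c t) =
      ENNReal.ofReal (1 - max (1 - c / 2) 0) := by
    rw [← integral_laplacianDensity hc, ofReal_integral_eq_lintegral_ofReal
      (integrable_laplacianDensity hc) (ae_of_all _ (laplacianDensity_nonneg c))]
  have h2 : ENNReal.ofReal (1 - c / 2) = ENNReal.ofReal (max (1 - c / 2) 0) := by
    simp
  rw [laplacianLimitLaw, Measure.add_apply, Measure.smul_apply, withDensity_apply _ .univ,
    setLIntegral_univ, h1, measure_univ, smul_eq_mul, mul_one, h2,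
    ← ENNReal.ofReal_add (le_max_right _ _)]
  · simp
  · have : max (1 - c / 2) 0 ≤ 1 := max_le (by linarith) (by norm_num)
    linarith

theorem ae_nonneg_laplacianLimitLaw (c : ℝ) : ∀ᵐ t ∂laplacianLimitLaw c, 0 ≤ t := by
  rw [laplacianLimitLaw, ae_add_measure_iff]
  constructor
  · refine Measure.ae_smul_measure ?_ _
    rw [ae_dirac_iff measurableSet_Ici]
  · have hm : Measurable fun t => ENNReal.ofReal (laplacianDensity c t) := by
      unfold laplacianDensity
      fun_prop
    rw [ae_withDensity_iff hm]
    refine ae_of_all _ fun t ht => ?_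
    by_contra h
    refine ht ?_
    rw [laplacianDensity_eq, Set.indicator_of_notMem, ENNReal.ofReal_zero]
    exact fun h' => h ((sq_nonneg _).trans h'.1.le)

theorem integral_laplacianLimitLaw_inv {c x : ℝ} (hc : 0 ≤ c) (hx : 0 < x) :
    ∫ t, 1 / (t + x) ∂laplacianLimitLaw c =
      ((2 - c) - x + √((x + c - 2) ^ 2 + 8 * x)) / (4 * x) := by
  have := isProbabilityMeasure_laplacianLimitLaw hc
  have hi : Integrable (fun t => 1 / (t + x)) (laplacianLimitLaw c) := by
    refine Integrable.of_bound (C := 1 / x)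
      ((measurable_id.add_const x).const_div 1).aestronglyMeasurable ?_
    filter_upwards [ae_nonneg_laplacianLimitLaw c] with t ht
    rw [Real.norm_of_nonneg (by positivity)]
    exact one_div_le_one_div_of_le hx (by linarith)
  have hm : Measurable fun t => (laplacianDensity c t).toNNReal := by
    unfold laplacianDensity
    fun_prop
  rw [laplacianLimitLaw, integrable_add_measure] at hi
  rw [laplacianLimitLaw, integral_add_measure hi.1 hi.2, integral_smul_measure, integral_dirac]
  have h1 : ∫ t, 1 / (t + x) ∂(volume.withDensity fun t => ENNReal.ofReal (laplacianDensity c t)) =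
      ∫ t, laplacianDensity c t * (1 / (t + x)) := by
    refine (integral_withDensity_eq_integral_smul hm _).trans ?_
    refine integral_congr_ae (ae_of_all _ fun t => ?_)
    simp only [NNReal.smul_def, smul_eq_mul, Real.coe_toNNReal _ (laplacianDensity_nonneg c t)]
  rw [h1, integral_laplacianDensity_mul_inv hc hx, ENNReal.toReal_ofReal', smul_eq_mul]
  ring

/-- The self-consistent equation of the limit law. -/
theorem laplacianLimitLaw_stieltjes {c x : ℝ} (hc : 0 ≤ c) (hx : 0 < x) :
    0 ≤ ∫ t, 1 / (t + x) ∂laplacianLimitLaw c ∧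
    1 - x * ∫ t, 1 / (t + x) ∂laplacianLimitLaw c =
      c * ((∫ t, 1 / (t + x) ∂laplacianLimitLaw c) /
        (1 + (∫ t, 1 / (t + x) ∂laplacianLimitLaw c) + ∫ t, 1 / (t + x) ∂laplacianLimitLaw c)) := by
  have h0 : 0 ≤ ∫ t, 1 / (t + x) ∂laplacianLimitLaw c := by
    refine integral_nonneg_of_ae ?_
    filter_upwards [ae_nonneg_laplacianLimitLaw c] with t ht
    simp only [Pi.zero_apply]
    positivity
  refine ⟨h0, ?_⟩
  have h1 := integral_laplacianLimitLaw_inv hc hx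
  set s := ∫ t, 1 / (t + x) ∂laplacianLimitLaw c
  have h2 : √((x + c - 2) ^ 2 + 8 * x) ^ 2 = (x + c - 2) ^ 2 + 8 * x := Real.sq_sqrt (by positivity)
  have h3 : √((x + c - 2) ^ 2 + 8 * x) = 4 * x * s + (x + c - 2) := by
    rw [h1]; field_simp; ring
  rw [h3] at h2
  -- The self-consistent equation with denominators cleared, obtained by squaring the closed form of
  -- `s`.
  have h4 : 2 * x * s ^ 2 + (x + c - 2) * s - 1 = 0 := by
    have h5 : 8 * x * (2 * x * s ^ 2 + (x + c - 2) * s - 1) = 0 := by linear_combination h2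
    exact (mul_eq_zero.1 h5).resolve_left (by positivity)
  field_simp
  linear_combination -h4

end MarchenkoPasturIntegral

/-! ### From Stieltjes transforms on a half-line to weak convergence in probability. -/

section StieltjesConvergence

variable {Ω : ℕ → Type*} [∀ r, MeasurableSpace (Ω r)] {P : ∀ r, Measure (Ω r)}
  {N : ∀ r, Ω r → Measure ℝ} {ν : Measure ℝ}

/-- A function bounded on `[0, ∞)` whose integrals against the random measures `N r` converge in
probability to its integral against `ν`. -/
structure IsConvergenceTest (P : ∀ r, Measure (Ω r)) (N : ∀ r, Ω r → Measure ℝ) (ν : Measure ℝ)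
    (g : ℝ → ℝ) : Prop where
  measurable : Measurable g
  bounded : ∃ K, ∀ t, 0 ≤ t → |g t| ≤ K
  tendsto : ∀ ε : ℝ, 0 < ε →
    Tendsto (fun r => P r {ω | ε ≤ |∫ t, g t ∂(N r ω) - ∫ t, g t ∂ν|}) atTop (𝓝 0)

/-- Eventually, almost all the measures `N r ω` are probability measures on `[0, ∞)`. -/
def EventuallyProbabilityOnNonneg (P : ∀ r, Measure (Ω r)) (N : ∀ r, Ω r → Measure ℝ) : Prop :=
  ∀ᶠ r in atTop, ∀ᵐ ω ∂P r, IsProbabilityMeasure (N r ω) ∧ ∀ᵐ t ∂N r ω, 0 ≤ t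

theorem integrable_of_bounded_on_nonneg {ρ : Measure ℝ} [IsFiniteMeasure ρ] (hρ : ∀ᵐ t ∂ρ, 0 ≤ t)
    {g : ℝ → ℝ} (hg : Measurable g) (hb : ∃ K, ∀ t, 0 ≤ t → |g t| ≤ K) : Integrable g ρ := by
  obtain ⟨K, hK⟩ := hb
  exact Integrable.of_bound hg.aestronglyMeasurable K (hρ.mono fun t ht => hK t ht)

theorem abs_integral_sub_le_of_abs_sub_le {ρ : Measure ℝ} [IsFiniteMeasure ρ]
    (hρ : ∀ᵐ t ∂ρ, 0 ≤ t) {g g' h : ℝ → ℝ} (hg : Integrable g ρ) (hg' : Integrable g' ρ)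
    (hh : Integrable h ρ) (hle : ∀ t, 0 ≤ t → |g t - g' t| ≤ h t) :
    |∫ t, g t ∂ρ - ∫ t, g' t ∂ρ| ≤ ∫ t, h t ∂ρ := by
  rw [← integral_sub hg hg']
  exact abs_integral_le_integral_abs.trans
    (integral_mono_ae (hg.sub hg').abs hh (hρ.mono fun t ht => hle t ht))

/-- The error majorant `h` is itself a test function, so its smallness under `ν` passes to the
random measures. No separate tightness argument is needed. -/
theorem IsConvergenceTest.of_approx [IsProbabilityMeasure ν] (hN : EventuallyProbabilityOnNonneg P N)
    (hν : ∀ᵐ t ∂ν, 0 ≤ t) {g : ℝ → ℝ} (hg : Measurable g) (hb : ∃ K, ∀ t, 0 ≤ t → |g t| ≤ K)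
    (happ : ∀ δ > 0, ∃ g' h, IsConvergenceTest P N ν g' ∧ IsConvergenceTest P N ν h ∧
      (∀ t, 0 ≤ t → |g t - g' t| ≤ h t) ∧ ∫ t, h t ∂ν ≤ δ) : IsConvergenceTest P N ν g := by
  refine ⟨hg, hb, fun ε hε => ?_⟩
  -- Off the two exceptional events the error is below `ε/2` on the side of `N`, `ε/4` on the side
  -- of `ν`, and `ε/4` for `g'`.
  obtain ⟨g', h, hg', hh, hle, hint⟩ := happ (ε / 4) (by positivity)
  have hlim := (hg'.tendsto (ε / 4) (by positivity)).add (hh.tendsto (ε / 4) (by positivity))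
  rw [add_zero] at hlim
  refine tendsto_of_tendsto_of_tendsto_of_le_of_le' tendsto_const_nhds hlim
    (Eventually.of_forall fun _ => zero_le) ?_
  filter_upwards [hN] with r hr
  refine le_trans (measure_mono_ae ?_) (measure_union_le _ _)
  filter_upwards [hr] with ω ⟨hω, hω0⟩ hmem
  have i := @integrable_of_bounded_on_nonneg
  have h1 := abs_integral_sub_le_of_abs_sub_le hω0 (i hω0 hg hb)
    (i hω0 hg'.measurable hg'.bounded) (i hω0 hh.measurable hh.bounded) hle
  have h2 := abs_integral_sub_le_of_abs_sub_le hν (i hν hg hb)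
    (i hν hg'.measurable hg'.bounded) (i hν hh.measurable hh.bounded) hle
  have hmem' : ε ≤ |∫ t, g t ∂(N r ω) - ∫ t, g t ∂ν| := hmem
  by_contra hcon
  have hcon' : ¬(ε / 4 ≤ |∫ t, g' t ∂(N r ω) - ∫ t, g' t ∂ν| ∨
      ε / 4 ≤ |∫ t, h t ∂(N r ω) - ∫ t, h t ∂ν|) := hcon
  push Not at hcon'
  obtain ⟨c1, c2⟩ := hcon'
  rw [abs_lt] at c1 c2
  rw [abs_le] at h1 h2
  have : |∫ t, g t ∂(N r ω) - ∫ t, g t ∂ν| < ε := by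
    rw [abs_lt]; constructor <;> linarith
  linarith

theorem IsConvergenceTest.const [IsProbabilityMeasure ν] (hN : EventuallyProbabilityOnNonneg P N)
    (a : ℝ) : IsConvergenceTest P N ν fun _ => a := by
  refine ⟨measurable_const, ⟨|a|, fun _ _ => le_rfl⟩, fun ε hε => ?_⟩
  refine tendsto_const_nhds.congr' ?_
  filter_upwards [hN] with r hr
  symm
  refine measure_mono_null (fun ω hω => ?_) (ae_iff.1 hr)
  intro hcon
  obtain ⟨h1, -⟩ := hcon
  have hω' : ε ≤ |∫ _, a ∂(N r ω) - ∫ _, a ∂ν| := hω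
  simp at hω'
  linarith

theorem IsConvergenceTest.add [IsProbabilityMeasure ν] (hN : EventuallyProbabilityOnNonneg P N)
    (hν : ∀ᵐ t ∂ν, 0 ≤ t) {g h : ℝ → ℝ} (hg : IsConvergenceTest P N ν g)
    (hh : IsConvergenceTest P N ν h) : IsConvergenceTest P N ν fun t => g t + h t := by
  refine ⟨hg.measurable.add hh.measurable, ?_, fun ε hε => ?_⟩
  · obtain ⟨K, hK⟩ := hg.bounded
    obtain ⟨K', hK'⟩ := hh.bounded
    exact ⟨K + K', fun t ht => (abs_add_le _ _).trans (add_le_add (hK t ht) (hK' t ht))⟩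
  have hlim := (hg.tendsto (ε / 2) (by positivity)).add (hh.tendsto (ε / 2) (by positivity))
  rw [add_zero] at hlim
  refine tendsto_of_tendsto_of_tendsto_of_le_of_le' tendsto_const_nhds hlim
    (Eventually.of_forall fun _ => zero_le) ?_
  filter_upwards [hN] with r hr
  refine le_trans (measure_mono_ae ?_) (measure_union_le _ _)
  filter_upwards [hr] with ω ⟨hω, hω0⟩ hmem
  have i := @integrable_of_bounded_on_nonneg
  have hmem' : ε ≤ |∫ t, (g t + h t) ∂(N r ω) - ∫ t, (g t + h t) ∂ν| := hmem
  rw [integral_add (i hω0 hg.measurable hg.bounded) (i hω0 hh.measurable hh.bounded),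
    integral_add (i hν hg.measurable hg.bounded) (i hν hh.measurable hh.bounded),
    add_sub_add_comm] at hmem'
  have h3 := hmem'.trans (abs_add_le _ _)
  by_contra hcon
  have hcon' : ¬(ε / 2 ≤ |∫ t, g t ∂(N r ω) - ∫ t, g t ∂ν| ∨
      ε / 2 ≤ |∫ t, h t ∂(N r ω) - ∫ t, h t ∂ν|) := hcon
  push Not at hcon'
  linarith [hcon'.1, hcon'.2]

theorem IsConvergenceTest.const_mul {g : ℝ → ℝ} (hg : IsConvergenceTest P N ν g) (a : ℝ) :
    IsConvergenceTest P N ν fun t => a * g t := by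
  refine ⟨hg.measurable.const_mul a, ?_, fun ε hε => ?_⟩
  · obtain ⟨K, hK⟩ := hg.bounded
    exact ⟨|a| * K, fun t ht => by
      rw [abs_mul]; exact mul_le_mul_of_nonneg_left (hK t ht) (abs_nonneg _)⟩
  have hpos : 0 < |a| + 1 := by positivity
  refine tendsto_of_tendsto_of_tendsto_of_le_of_le tendsto_const_nhds
    (hg.tendsto (ε / (|a| + 1)) (by positivity)) (fun _ => zero_le) fun r => ?_
  refine measure_mono fun ω hω => ?_
  have hω' : ε ≤ |∫ t, a * g t ∂(N r ω) - ∫ t, a * g t ∂ν| := hω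
  rw [integral_const_mul, integral_const_mul, ← mul_sub, abs_mul] at hω'
  change ε / (|a| + 1) ≤ _
  rw [div_le_iff₀ hpos]
  nlinarith [abs_nonneg (∫ t, g t ∂(N r ω) - ∫ t, g t ∂ν)]

/-- Products of `1/(t + x₀)` and `1/(t + y)` with `y ≠ x₀` are linear combinations of the factors; a
further power of `1/(t + x₀)` is the limit `y → x₀`. The two claims are needed together for the
induction. -/
theorem isConvergenceTest_inv_pow [IsProbabilityMeasure ν] (hN : EventuallyProbabilityOnNonneg P N)
    (hν : ∀ᵐ t ∂ν, 0 ≤ t) {x₀ : ℝ} (hx₀ : 1 ≤ x₀)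
    (h : ∀ x, x₀ ≤ x → IsConvergenceTest P N ν fun t => 1 / (t + x)) (k : ℕ) :
    IsConvergenceTest P N ν (fun t => (1 / (t + x₀)) ^ k) ∧
    ∀ y, x₀ < y → IsConvergenceTest P N ν fun t => (1 / (t + x₀)) ^ k * (1 / (t + y)) := by
  have hle1 : ∀ t y, 0 ≤ t → x₀ ≤ y → 1 / (t + y) ≤ 1 := fun t y ht hy => by
    rw [div_le_one (by linarith)]; linarith
  have hge0 : ∀ t y, 0 ≤ t → x₀ ≤ y → 0 ≤ 1 / (t + y) := fun t y ht hy => by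
    have : 0 < t + y := by linarith
    positivity
  induction k with
  | zero =>
    refine ⟨by simpa using IsConvergenceTest.const hN 1, fun y hy => by simpa using h y hy.le⟩
  | succ k ih =>
    obtain ⟨ih1, ih2⟩ := ih
    have hpow : IsConvergenceTest P N ν (fun t => (1 / (t + x₀)) ^ (k + 1)) := by
      refine IsConvergenceTest.of_approx hN hν
        (((measurable_id.add_const x₀).const_div 1).pow_const _)
        ⟨1, fun t ht => ?_⟩ fun δ hδ => ?_
      · rw [abs_of_nonneg (pow_nonneg (hge0 t _ ht le_rfl) _)]
        exact pow_le_one₀ (hge0 t _ ht le_rfl) (hle1 t _ ht le_rfl)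
      · refine ⟨_, fun _ => δ, ih2 (x₀ + δ) (by linarith), IsConvergenceTest.const hN δ, ?_,
          by simp⟩
        intro t ht
        have e1 : (1 / (t + x₀)) ^ (k + 1) - (1 / (t + x₀)) ^ k * (1 / (t + (x₀ + δ))) =
            δ * ((1 / (t + x₀)) ^ k * (1 / (t + x₀)) * (1 / (t + (x₀ + δ)))) := by
          have h1 : t + x₀ ≠ 0 := by linarith
          have h2 : t + (x₀ + δ) ≠ 0 := by linarith
          rw [pow_succ, ← mul_sub, mul_assoc, mul_left_comm δ]
          congr 1
          field_simp
          ring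
        rw [e1, abs_mul, abs_of_pos hδ]
        have p0 := hge0 t _ ht le_rfl
        have p1 := hle1 t _ ht le_rfl
        have q0 := hge0 t (x₀ + δ) ht (by linarith)
        have q1 := hle1 t (x₀ + δ) ht (by linarith)
        rw [abs_of_nonneg (by positivity)]
        exact mul_le_of_le_one_right hδ.le
          (mul_le_one₀ (mul_le_one₀ (pow_le_one₀ p0 p1) p0 p1) q0 q1)
    refine ⟨hpow, fun y hy => ?_⟩
    have hsum := (hpow.const_mul (1 / (y - x₀))).add hN hν ((ih2 y hy).const_mul (-(1 / (y - x₀))))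
    have hmeas : Measurable fun t : ℝ => (1 / (t + x₀)) ^ (k + 1) * (1 / (t + y)) :=
      (((measurable_id.add_const x₀).const_div 1).pow_const _).mul
        ((measurable_id.add_const y).const_div 1)
    -- The partial fraction identity is used only for `t ≥ 0`, so it enters as an approximation with
    -- error `0`.
    refine IsConvergenceTest.of_approx hN hν hmeas ⟨1, fun t ht => ?_⟩ fun δ hδ =>
      ⟨_, fun _ => 0, hsum, IsConvergenceTest.const hN 0, fun t ht => ?_, by simpa using hδ.le⟩
    · have p0 := hge0 t _ ht le_rfl
      have p1 := hle1 t _ ht le_rfl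
      have q0 := hge0 t y ht hy.le
      have q1 := hle1 t y ht hy.le
      rw [abs_of_nonneg (by positivity)]
      exact mul_le_one₀ (pow_le_one₀ p0 p1) q0 q1
    · have h1 : t + x₀ ≠ 0 := by linarith
      have h2 : t + y ≠ 0 := by linarith
      have h3 : y - x₀ ≠ 0 := by linarith
      refine le_of_eq (abs_eq_zero.2 ?_)
      have e : 1 / (t + x₀) * (1 / (t + y)) =
          1 / (y - x₀) * (1 / (t + x₀)) - 1 / (y - x₀) * (1 / (t + y)) := by
        field_simp; ring
      rw [pow_succ, mul_assoc, e]
      ring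

theorem isConvergenceTest_comp_inv [IsProbabilityMeasure ν] (hN : EventuallyProbabilityOnNonneg P N)
    (hν : ∀ᵐ t ∂ν, 0 ≤ t) {x₀ : ℝ} (hx₀ : 1 ≤ x₀)
    (h : ∀ x, x₀ ≤ x → IsConvergenceTest P N ν fun t => 1 / (t + x)) {φ : ℝ → ℝ}
    (hφ : Continuous φ) : IsConvergenceTest P N ν fun t => φ (1 / (t + x₀)) := by
  have hu : ∀ t, 0 ≤ t → 1 / (t + x₀) ∈ Set.Icc (0 : ℝ) 1 := fun t ht => by
    have : 0 < t + x₀ := by linarith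
    exact ⟨by positivity, by rw [div_le_one this]; linarith⟩
  have hpoly : ∀ p : Polynomial ℝ, IsConvergenceTest P N ν fun t => p.eval (1 / (t + x₀)) := by
    intro p
    induction p using Polynomial.induction_on' with
    | add p q hp hq => simpa using hp.add hN hν hq
    | monomial n a =>
      simpa using (isConvergenceTest_inv_pow hN hν hx₀ h n).1.const_mul a
  refine IsConvergenceTest.of_approx hN hν
    (hφ.measurable.comp ((measurable_id.add_const x₀).const_div 1)) ?_ fun δ hδ => ?_
  · obtain ⟨K, hK⟩ := isCompact_Icc.exists_bound_of_continuousOn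
      (hφ.continuousOn (s := Set.Icc (0 : ℝ) 1))
    exact ⟨K, fun t ht => hK _ (hu t ht)⟩
  · obtain ⟨p, hp⟩ := exists_polynomial_near_of_continuousOn 0 1 φ hφ.continuousOn δ hδ
    refine ⟨_, fun _ => δ, hpoly p, IsConvergenceTest.const hN δ, fun t ht => ?_, by simp⟩
    rw [abs_sub_comm]
    exact (hp _ (hu t ht)).le

/-- Convergence in probability of the Stieltjes transforms on a half-line implies weak convergence
in probability. -/
theorem convergesWeaklyInProbability_of_stieltjes [IsProbabilityMeasure ν]
    (hN : EventuallyProbabilityOnNonneg P N) (hν : ∀ᵐ t ∂ν, 0 ≤ t) {x₀ : ℝ} (hx₀ : 1 ≤ x₀)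
    (h : ∀ x, x₀ ≤ x → ∀ ε : ℝ, 0 < ε → Tendsto
      (fun r => P r {ω | ε ≤ |∫ t, 1 / (t + x) ∂(N r ω) - ∫ t, 1 / (t + x) ∂ν|}) atTop (𝓝 0)) :
    ConvergesWeaklyInProbability P N ν := by
  intro f
  have h' : ∀ x, x₀ ≤ x → IsConvergenceTest P N ν fun t => 1 / (t + x) := fun x hx =>
    ⟨(measurable_id.add_const x).const_div 1, ⟨1, fun t ht => by
      have : 0 < t + x := by linarith
      rw [abs_of_nonneg (by positivity), div_le_one this]; linarith⟩, h x hx⟩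
  -- A cutoff that vanishes for `u ≤ δ` and equals 1 for `u ≥ 2δ`. As a function of `u = 1/(t +
  -- x₀)`, `f` need not extend continuously to `u = 0`, that is to `t = ∞`. Replacing `u` by `max u
  -- δ` restores continuity, and where this changes anything `ψ` is zero.
  let ψ : ℝ → ℝ → ℝ := fun δ u => max 0 (min 1 (u / δ - 1))
  have hψc : ∀ δ, Continuous (ψ δ) := fun δ => by fun_prop
  have hψ0 : ∀ δ u, 0 ≤ ψ δ u := fun δ u => le_max_left _ _
  have hψ1 : ∀ δ u, ψ δ u ≤ 1 := fun δ u => max_le zero_le_one (min_le_left _ _)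
  have hfψ : ∀ δ, 0 < δ → IsConvergenceTest P N ν fun t =>
      f (1 / max (1 / (t + x₀)) δ - x₀) * ψ δ (1 / (t + x₀)) := by
    intro δ hδ
    refine isConvergenceTest_comp_inv hN hν hx₀ h'
      (φ := fun u => f (1 / max u δ - x₀) * ψ δ u) ?_
    refine (f.continuous.comp (Continuous.sub (continuous_const.div
      (continuous_id.max continuous_const) fun u => ?_) continuous_const)).mul (hψc δ)
    exact (hδ.trans_le (le_max_right _ _)).ne'
  have hfle : ∀ t, |f t| ≤ ‖f‖ := fun t => f.norm_coe_le_norm t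
  have htail : Tendsto (fun n : ℕ => ∫ t, ‖f‖ * (1 - ψ (1 / ((n : ℝ) + 1)) (1 / (t + x₀))) ∂ν)
      atTop (𝓝 0) := by
    have := tendsto_integral_of_dominated_convergence (μ := ν) (f := fun _ => (0 : ℝ))
      (F := fun (n : ℕ) t => ‖f‖ * (1 - ψ (1 / ((n : ℝ) + 1)) (1 / (t + x₀)))) (fun _ => ‖f‖)
      (fun n => ?_) (integrable_const _) (fun n => ae_of_all _ fun t => ?_) ?_
    · simpa using this
    · exact ((((hψc _).measurable.comp
        ((measurable_id.add_const x₀).const_div 1)).const_sub 1).const_mul _).aestronglyMeasurable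
    · have a0 := hψ0 (1 / ((n : ℝ) + 1)) (1 / (t + x₀))
      have a1 := hψ1 (1 / ((n : ℝ) + 1)) (1 / (t + x₀))
      rw [norm_mul, norm_norm, Real.norm_of_nonneg (by linarith)]
      exact mul_le_of_le_one_right (norm_nonneg _) (by linarith)
    · filter_upwards [hν] with t ht
      have hu : 0 < t + x₀ := by linarith
      refine tendsto_const_nhds.congr' ?_
      obtain ⟨n₀, hn₀⟩ := exists_nat_gt (2 * (t + x₀))
      filter_upwards [eventually_ge_atTop n₀] with n hn
      have hn' : (n₀ : ℝ) ≤ n := by exact_mod_cast hn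
      have : 1 ≤ 1 / (t + x₀) / (1 / ((n : ℝ) + 1)) - 1 := by
        have : 1 / (t + x₀) / (1 / ((n : ℝ) + 1)) = (n + 1) / (t + x₀) := by field_simp
        rw [this, le_sub_iff_add_le, le_div_iff₀ hu]
        linarith
      simp only [ψ]
      rw [min_eq_left this]
      simp
  refine (IsConvergenceTest.of_approx hN hν f.continuous.measurable ⟨‖f‖, fun t _ => hfle t⟩
    fun δ hδ => ?_).tendsto
  obtain ⟨n, hn⟩ := (htail.eventually (gt_mem_nhds hδ)).exists
  have hn0 : (0 : ℝ) < 1 / ((n : ℝ) + 1) := by positivity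
  set η := 1 / ((n : ℝ) + 1)
  refine ⟨_, fun t => ‖f‖ * (1 - ψ η (1 / (t + x₀))), hfψ η hn0,
    isConvergenceTest_comp_inv hN hν hx₀ h' (φ := fun u => ‖f‖ * (1 - ψ η u))
      (continuous_const.mul (continuous_const.sub (hψc η))), fun t ht => ?_, hn.le⟩
  have hu : 0 < t + x₀ := by linarith
  have a1 := hψ1 η (1 / (t + x₀))
  have e : f (1 / max (1 / (t + x₀)) η - x₀) * ψ η (1 / (t + x₀)) =
      f t * ψ η (1 / (t + x₀)) := by
    rcases le_total (1 / (t + x₀)) η with hle | hle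
    · have : ψ η (1 / (t + x₀)) = 0 := by
        refine max_eq_left ((min_le_right _ _).trans ?_)
        rw [sub_nonpos, div_le_one hn0]
        exact hle
      rw [this, mul_zero, mul_zero]
    · rw [max_eq_left hle, one_div_one_div, add_sub_cancel_right]
  rw [e, ← mul_one_sub, abs_mul, abs_of_nonneg (by linarith : 0 ≤ 1 - ψ η (1 / (t + x₀)))]
  exact mul_le_mul_of_nonneg_right (hfle t) (by linarith)

end StieltjesConvergence

/-! ### The block Laplacian as a Gram sum, and its spectral distribution. -/

section BlockLaplacian

open Matrix

theorem integral_empiricalSpectralDistribution {ι : Type*} [Fintype ι] [DecidableEq ι]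
    {M : Matrix ι ι ℝ} (hM : M.IsHermitian) (f : ℝ → ℝ) :
    ∫ t, f t ∂empiricalSpectralDistribution hM =
      (Fintype.card ι : ℝ)⁻¹ * ∑ i, f (hM.eigenvalues i) := by
  rw [empiricalSpectralDistribution, integral_smul_measure, integral_finsetSum_measure]
  · simp [integral_dirac, ENNReal.toReal_inv]
  · intro i _
    exact integrable_dirac (by simp [enorm_lt_top])

theorem isProbabilityMeasure_empiricalSpectralDistribution {ι : Type*} [Fintype ι] [DecidableEq ι]
    [Nonempty ι] {M : Matrix ι ι ℝ} (hM : M.IsHermitian) :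
    IsProbabilityMeasure (empiricalSpectralDistribution hM) := by
  constructor
  rw [empiricalSpectralDistribution, Measure.smul_apply, Measure.finsetSum_apply]
  simp only [measure_univ, Finset.sum_const, Finset.card_univ, smul_eq_mul, nsmul_eq_mul, mul_one]
  exact ENNReal.inv_mul_cancel (by simp) (by simp)

theorem ae_nonneg_empiricalSpectralDistribution {ι : Type*} [Fintype ι] [DecidableEq ι]
    {M : Matrix ι ι ℝ} (hM : M.PosSemidef) :
    ∀ᵐ t ∂empiricalSpectralDistribution hM.1, 0 ≤ t := by
  refine Measure.ae_smul_measure ?_ _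
  rw [ae_iff, Measure.finsetSum_apply]
  refine Finset.sum_eq_zero fun i _ => ?_
  rw [← ae_iff, ae_dirac_iff measurableSet_Ici]
  exact hM.eigenvalues_nonneg i

theorem trace_inv_smul_one_add {ι : Type*} [Fintype ι] [DecidableEq ι] {M : Matrix ι ι ℝ}
    (hM : M.PosSemidef) {x : ℝ} (hx : 0 < x) :
    ((x • (1 : Matrix ι ι ℝ) + M)⁻¹).trace = ∑ i, 1 / (hM.1.eigenvalues i + x) := by
  set U : Matrix ι ι ℝ := hM.1.eigenvectorUnitary.1 with hU
  have hUs : U * star U = 1 := Unitary.coe_mul_star_self _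
  have hsU : star U * U = 1 := Unitary.coe_star_mul_self _
  have hspec : M = U * diagonal hM.1.eigenvalues * star U := by
    have := hM.1.spectral_theorem
    rw [Unitary.conjStarAlgAut_apply] at this
    simpa using this
  set B := U * diagonal (fun i => 1 / (hM.1.eigenvalues i + x)) * star U with hB
  have hMx : x • (1 : Matrix ι ι ℝ) + M = U * diagonal (fun i => hM.1.eigenvalues i + x) * star U := by
    have h1 : diagonal (fun i => hM.1.eigenvalues i + x) =
        diagonal hM.1.eigenvalues + x • (1 : Matrix ι ι ℝ) := by
      ext i j
      by_cases h : i = j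
      · subst h; simp
      · simp [h]
    rw [h1, Matrix.mul_add, Matrix.add_mul, ← hspec, Matrix.mul_smul, Matrix.mul_one, Matrix.smul_mul, hUs,
      add_comm]
  have hinv : (x • (1 : Matrix ι ι ℝ) + M) * B = 1 := by
    rw [hMx, hB]
    calc _ = U * (diagonal (fun i => hM.1.eigenvalues i + x) * ((star U * U) *
          diagonal (fun i => 1 / (hM.1.eigenvalues i + x)))) * star U := by
          simp only [Matrix.mul_assoc]
      _ = 1 := by
          rw [hsU, Matrix.one_mul, diagonal_mul_diagonal]
          have : (fun i => (hM.1.eigenvalues i + x) * (1 / (hM.1.eigenvalues i + x))) =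
              fun _ => (1 : ℝ) := by
            ext i
            have := hM.eigenvalues_nonneg i
            field_simp
          rw [this, diagonal_one, Matrix.mul_one, hUs]
  rw [inv_eq_right_inv hinv, hB, trace_mul_comm, ← Matrix.mul_assoc, hsU, Matrix.one_mul,
    trace_diagonal]

variable {r d : ℕ}

theorem sum_edgeIx (G : EdgeIx r → ℝ) :
    ∑ e, G e = ∑ i, ∑ j, if h : i < j then G ⟨(i, j), h⟩ else 0 := by
  rw [← Fintype.sum_prod_type' (f := fun i j => if h : i < j then G ⟨(i, j), h⟩ else 0)]
  rw [← Finset.sum_filter_of_ne (p := fun e : Fin r × Fin r => e.1 < e.2)]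
  · rw [Finset.sum_subtype (p := fun e : Fin r × Fin r => e.1 < e.2) _ (by simp)]
    exact Finset.sum_congr rfl fun e _ => by simp [e.2]
  · intro e _ he
    by_contra h
    simp [h] at he

theorem sum_edgeIx_incident (F F' : EdgeIx r → ℝ) (k : Fin r) :
    ∑ e : EdgeIx r, ((if k = e.1.1 then F e else 0) + if k = e.1.2 then F' e else 0) =
      ∑ m ∈ Finset.univ.erase k, if h : m < k then F' ⟨(m, k), h⟩ else
        if h : k < m then F ⟨(k, m), h⟩ else 0 := by
  rw [Finset.sum_add_distrib, sum_edgeIx, sum_edgeIx]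
  have h1 : (∑ i, ∑ j, if h : i < j then
      (if k = (⟨(i, j), h⟩ : EdgeIx r).1.1 then F ⟨(i, j), h⟩ else 0) else 0) =
      ∑ j, if h : k < j then F ⟨(k, j), h⟩ else 0 := by
    rw [Finset.sum_eq_single k]
    · simp
    · intro i _ hi
      refine Finset.sum_eq_zero fun j _ => ?_
      simp [Ne.symm hi]
    · simp
  have h2 : (∑ i, ∑ j, if h : i < j then
      (if k = (⟨(i, j), h⟩ : EdgeIx r).1.2 then F' ⟨(i, j), h⟩ else 0) else 0) =
      ∑ i, if h : i < k then F' ⟨(i, k), h⟩ else 0 := by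
    refine Finset.sum_congr rfl fun i _ => ?_
    rw [Finset.sum_eq_single k]
    · simp
    · intro j _ hj
      simp [Ne.symm hj]
    · simp
  rw [h1, h2, ← Finset.sum_add_distrib]
  symm
  refine Finset.sum_subset_zero_on_sdiff (Finset.erase_subset _ _) ?_ ?_
  · intro m hm
    have : m = k := by simpa using hm
    subst this
    simp
  · intro m _
    rcases lt_trichotomy m k with h | h | h
    · simp [h, h.not_gt]
    · subst h; simp
    · simp [h, h.not_gt]

theorem isCompleteEdgeSet_edgeIx :
    IsCompleteEdgeSet (fun e : EdgeIx r => e.1.1) (fun e : EdgeIx r => e.1.2) := by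
  intro k F
  rw [sum_edgeIx_incident (fun e => F e.1.2) (fun e => F e.1.1)]
  refine Finset.sum_congr rfl fun m hm => ?_
  rcases lt_or_gt_of_ne (Finset.ne_of_mem_erase hm) with h | h
  · simp [h]
  · simp [h, h.not_gt]

theorem rankOneBlock_apply (x : EdgeIx r → ℝ) (u : EdgeIx r → EuclideanSpace ℝ (Fin d))
    (m k : Fin r) (a b : Fin d) :
    rankOneBlock x u m k a b = if h : m < k then x ⟨(m, k), h⟩ * (u ⟨(m, k), h⟩ a *
      u ⟨(m, k), h⟩ b) else if h : k < m then x ⟨(k, m), h⟩ * (u ⟨(k, m), h⟩ a *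
      u ⟨(k, m), h⟩ b) else 0 := by
  unfold rankOneBlock
  split_ifs <;> simp [vecMulVec_apply]

/-- The block Laplacian is a sum of rank one matrices over the edges. -/
theorem blockLaplacian_eq_sum (x : EdgeIx r → ℝ) (u : EdgeIx r → EuclideanSpace ℝ (Fin d))
    (hx : ∀ e, x e = 0 ∨ x e = 1) :
    blockLaplacian x u = ∑ e, vecMulVec
      (edgeVector (fun e : EdgeIx r => e.1.1) (fun e => e.1.2) (fun e => x e • u e) e)
      (edgeVector (fun e : EdgeIx r => e.1.1) (fun e => e.1.2) (fun e => x e • u e) e) := by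
  -- For 0/1 weights `ξ v vᵀ = (ξ v) (ξ v)ᵀ`, so the weight is absorbed into the vector.
  have hsq : ∀ e, x e * x e = x e := fun e => by rcases hx e with h | h <;> simp [h]
  ext ⟨k, a⟩ ⟨l, b⟩
  rw [Matrix.sum_apply]
  by_cases hkl : k = l
  · subst hkl
    have h1 : ∀ e : EdgeIx r, vecMulVec
        (edgeVector (fun e : EdgeIx r => e.1.1) (fun e => e.1.2) (fun e => x e • u e) e)
        (edgeVector (fun e : EdgeIx r => e.1.1) (fun e => e.1.2) (fun e => x e • u e) e)
        (k, a) (k, b) = (if k = e.1.1 then x e * (u e a * u e b) else 0) +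
          if k = e.1.2 then x e * (u e a * u e b) else 0 := by
      intro e
      have he : e.1.1 ≠ e.1.2 := e.2.ne
      rw [vecMulVec_apply]
      simp only [edgeVector, blockSingle, Pi.sub_apply, PiLp.smul_apply, smul_eq_mul]
      by_cases h1 : k = e.1.1
      · have h2 : k ≠ e.1.2 := h1 ▸ he
        simp only [h1, he, if_true, if_false]
        linear_combination (u e a * u e b) * hsq e
      · by_cases h2 : k = e.1.2
        · simp only [h2, he.symm, if_true, if_false]
          linear_combination (u e a * u e b) * hsq e
        · simp [h1, h2]
    simp only [h1]
    rw [sum_edgeIx_incident]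
    simp only [blockLaplacian, blockAdjacency, Matrix.sub_apply, Matrix.of_apply, if_true, sub_zero,
      rankOneBlock_apply]
  · have h1 : ∀ e : EdgeIx r, vecMulVec
        (edgeVector (fun e : EdgeIx r => e.1.1) (fun e => e.1.2) (fun e => x e • u e) e)
        (edgeVector (fun e : EdgeIx r => e.1.1) (fun e => e.1.2) (fun e => x e • u e) e)
        (k, a) (l, b) =
          (if k = e.1.1 then (if l = e.1.2 then -(x e * (u e a * u e b)) else 0) else 0) +
          if k = e.1.2 then (if l = e.1.1 then -(x e * (u e a * u e b)) else 0) else 0 := by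
      intro e
      have he : e.1.1 ≠ e.1.2 := e.2.ne
      rw [vecMulVec_apply]
      simp only [edgeVector, blockSingle, Pi.sub_apply, PiLp.smul_apply, smul_eq_mul]
      by_cases h1 : k = e.1.1
      · have h3 : l ≠ e.1.1 := fun h => hkl (h1.trans h.symm)
        by_cases h2 : l = e.1.2
        · simp only [h1, h2, he, he.symm, if_true, if_false]
          linear_combination -(u e a * u e b) * hsq e
        · simp [h1, h2, h3, he]
      · by_cases h2 : k = e.1.2
        · have h3 : l ≠ e.1.2 := fun h => hkl (h2.trans h.symm)
          by_cases h4 : l = e.1.1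
          · simp only [h2, h4, he, he.symm, if_true, if_false]
            linear_combination -(u e a * u e b) * hsq e
          · simp [h2, h3, h4, he.symm]
        · simp [h1, h2]
    simp only [h1]
    rw [sum_edgeIx_incident, Finset.sum_eq_single l]
    · simp only [blockLaplacian, blockAdjacency, Matrix.sub_apply, Matrix.of_apply, hkl, if_false,
        zero_sub, rankOneBlock_apply, if_true]
      rcases lt_or_gt_of_ne hkl with h | h
      · simp [h, h.not_gt]
      · simp [h, h.not_gt]
    · intro m _ hm
      simp [Ne.symm hm]
    · intro h
      exact absurd (Finset.mem_erase.2 ⟨Ne.symm hkl, Finset.mem_univ _⟩) h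

theorem blockLaplacian_posSemidef (x : EdgeIx r → ℝ) (u : EdgeIx r → EuclideanSpace ℝ (Fin d))
    (hx : ∀ e, x e = 0 ∨ x e = 1) : (blockLaplacian x u).PosSemidef := by
  rw [blockLaplacian_eq_sum x u hx]
  exact posSemidef_sum _ fun e _ => by
    simpa using posSemidef_vecMulVec_self_star (R := ℝ)
      (edgeVector (fun e : EdgeIx r => e.1.1) (fun e => e.1.2) (fun e => x e • u e) e)

theorem integral_inv_empiricalSpectralDistribution (x : EdgeIx r → ℝ)
    (u : EdgeIx r → EuclideanSpace ℝ (Fin d)) (hx : ∀ e, x e = 0 ∨ x e = 1) {y : ℝ} (hy : 0 < y) :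
    ∫ t, 1 / (t + y) ∂empiricalSpectralDistribution (blockLaplacian_isHermitian x u) =
      ((r : ℝ) * d)⁻¹ * (edgeResolvent (fun e : EdgeIx r => e.1.1) (fun e => e.1.2) y
        (fun e => x e • u e)).trace := by
  rw [integral_empiricalSpectralDistribution,
    edgeResolvent, gramResolvent, shiftedGram, ← blockLaplacian_eq_sum x u hx,
    trace_inv_smul_one_add (blockLaplacian_posSemidef x u hx) hy]
  simp

end BlockLaplacian

/-! ### The law of the edge vectors `ξ v`. -/

section EdgeLaw

open Matrix

variable {Ω : Type*} [MeasurableSpace Ω] {P : Measure Ω} [IsProbabilityMeasure P] {d : ℕ}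

/-- The joint law is (product of the laws of `ξ`) × (product of the laws of `v`); regrouping it by
edges and mapping each pair by scalar multiplication again gives a product. -/
theorem map_smul_eq_pi {E X : Type*} [Fintype E] [NormedAddCommGroup X] [NormedSpace ℝ X]
    [MeasurableSpace X] [BorelSpace X] [SecondCountableTopology X]
    {ξ : E → Ω → ℝ} {v : E → Ω → X} (hξ : ∀ e, Measurable (ξ e)) (hv : ∀ e, Measurable (v e))
    (hξ_indep : iIndepFun ξ P) (hv_indep : iIndepFun v P)
    (hξv : IndepFun (fun ω e => ξ e ω) (fun ω e => v e ω) P) :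
    P.map (fun ω e => ξ e ω • v e ω) = Measure.pi fun e => P.map fun ω => ξ e ω • v e ω := by
  have hξm : Measurable fun ω e => ξ e ω := measurable_pi_lambda _ hξ
  have hvm : Measurable fun ω e => v e ω := measurable_pi_lambda _ hv
  have i1 : ∀ e, IsProbabilityMeasure (P.map (ξ e)) := fun e =>
    Measure.isProbabilityMeasure_map (hξ e).aemeasurable
  have i2 : ∀ e, IsProbabilityMeasure (P.map (v e)) := fun e =>
    Measure.isProbabilityMeasure_map (hv e).aemeasurable
  have h1 := (iIndepFun_iff_map_fun_eq_pi_map fun e => (hξ e).aemeasurable).1 hξ_indep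
  have h2 := (iIndepFun_iff_map_fun_eq_pi_map fun e => (hv e).aemeasurable).1 hv_indep
  have h3 := (indepFun_iff_map_prod_eq_prod_map_map hξm.aemeasurable hvm.aemeasurable).1 hξv
  rw [h1, h2] at h3
  have h4 : ∀ e, P.map (fun ω => (ξ e ω, v e ω)) = (P.map (ξ e)).prod (P.map (v e)) := fun e =>
    (indepFun_iff_map_prod_eq_prod_map_map (hξ e).aemeasurable (hv e).aemeasurable).1
      (hξv.comp (measurable_pi_apply e) (measurable_pi_apply e))
  have hsm : Measurable fun w : ℝ × X => w.1 • w.2 := by fun_prop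
  have h5 : ∀ e, MeasurePreserving (fun w : ℝ × X => w.1 • w.2)
      ((P.map (ξ e)).prod (P.map (v e))) (P.map fun ω => ξ e ω • v e ω) := fun e =>
    ⟨hsm, by rw [← h4, Measure.map_map hsm ((hξ e).prodMk (hv e))]; rfl⟩
  have i3 : ∀ e, IsProbabilityMeasure (P.map fun ω => ξ e ω • v e ω) := fun e =>
    Measure.isProbabilityMeasure_map (hsm.comp ((hξ e).prodMk (hv e))).aemeasurable
  have h6 := measurePreserving_pi _ _ h5
  have h7 := (measurePreserving_arrowProdEquivProdArrow ℝ X E (fun e => P.map (ξ e))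
    (fun e => P.map (v e))).symm
  rw [← (h6.comp h7).map_eq, ← h3, Measure.map_map (h6.comp h7).measurable (hξm.prodMk hvm)]
  rfl

theorem integrable_quadratic {v : Ω → EuclideanSpace ℝ (Fin d)} (hv : Measurable v) {C : ℝ}
    (hC : ∀ᵐ ω ∂P, ‖v ω‖ ≤ C) (D : Matrix (Fin d) (Fin d) ℝ) :
    MemLp (fun ω => (v ω).ofLp ⬝ᵥ D *ᵥ (v ω).ofLp) 2 P := by
  have hm : Measurable fun ω => (v ω).ofLp ⬝ᵥ D *ᵥ (v ω).ofLp := by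
    simp only [dotProduct, mulVec]
    have : ∀ a, Measurable fun ω => v ω a := fun a => by fun_prop
    exact Finset.measurable_sum _ fun a _ => (this a).mul
      (Finset.measurable_sum _ fun b _ => (this b).const_mul _)
  refine MemLp.of_bound hm.aestronglyMeasurable (‖toEuclideanCLM (𝕜 := ℝ) D‖ * C ^ 2) ?_
  filter_upwards [hC] with ω hω
  exact (abs_quadratic_le D _).trans (by gcongr)

theorem integral_quadratic {v : Ω → EuclideanSpace ℝ (Fin d)} (hv : Measurable v) {C : ℝ}
    (hC : ∀ᵐ ω ∂P, ‖v ω‖ ≤ C)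
    (hiso : ∀ a b : Fin d, ∫ ω, v ω a * v ω b ∂P = if a = b then ((d : ℝ))⁻¹ else 0)
    (D : Matrix (Fin d) (Fin d) ℝ) :
    ∫ ω, (v ω).ofLp ⬝ᵥ D *ᵥ (v ω).ofLp ∂P = (d : ℝ)⁻¹ * D.trace := by
  have hi : ∀ a b, Integrable (fun ω => v ω a * v ω b) P := by
    intro a b
    refine Integrable.of_bound (C := C * C) (by fun_prop) ?_
    filter_upwards [hC] with ω hω
    rw [norm_mul]
    have h1 := (PiLp.norm_apply_le (v ω) a).trans hω
    have h2 := (PiLp.norm_apply_le (v ω) b).trans hω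
    exact mul_le_mul h1 h2 (norm_nonneg _) ((norm_nonneg _).trans h1)
  have h1 : ∀ ω, (v ω).ofLp ⬝ᵥ D *ᵥ (v ω).ofLp = ∑ a, ∑ b, D a b * (v ω a * v ω b) := by
    intro ω
    simp only [dotProduct, mulVec, Finset.mul_sum]
    exact Finset.sum_congr rfl fun a _ => Finset.sum_congr rfl fun b _ => by ring
  have hi2 : ∀ a b, Integrable (fun ω => D a b * (v ω a * v ω b)) P := fun a b =>
    (hi a b).const_mul _
  calc ∫ ω, (v ω).ofLp ⬝ᵥ D *ᵥ (v ω).ofLp ∂P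
      = ∫ ω, ∑ a, ∑ b, D a b * (v ω a * v ω b) ∂P := integral_congr_ae (ae_of_all _ h1)
    _ = ∑ a, ∫ ω, ∑ b, D a b * (v ω a * v ω b) ∂P :=
        integral_finsetSum _ fun a _ => integrable_finsetSum _ fun b _ => hi2 a b
    _ = ∑ a, ∑ b, D a b * (if a = b then ((d : ℝ))⁻¹ else 0) :=
        Finset.sum_congr rfl fun a _ => (integral_finsetSum _ fun b _ => hi2 a b).trans
          (Finset.sum_congr rfl fun b _ => by rw [integral_const_mul, hiso])
    _ = (d : ℝ)⁻¹ * D.trace := by simp [Matrix.trace, Finset.mul_sum, mul_comm]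

theorem abs_normalized_trace_le (hd : 0 < d) (D : Matrix (Fin d) (Fin d) ℝ) :
    |(d : ℝ)⁻¹ * D.trace| ≤ ‖toEuclideanCLM (𝕜 := ℝ) D‖ := by
  have hd' : (0 : ℝ) < d := by exact_mod_cast hd
  have h : ∀ a, |D a a| ≤ ‖toEuclideanCLM (𝕜 := ℝ) D‖ := fun a => by
    have := abs_quadratic_le D (EuclideanSpace.single a 1)
    simpa using this
  rw [abs_mul, abs_of_pos (by positivity), inv_mul_le_iff₀ hd']
  refine (Finset.abs_sum_le_sum_abs _ _).trans ((Finset.sum_le_sum fun a _ => h a).trans ?_)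
  simp

/-- Concentration of quadratic forms of `v` gives the approximate formula for expected ratios. -/
theorem hasQuadraticRatios_map_smul (hd : 0 < d) {ξ : Ω → ℝ} {v : Ω → EuclideanSpace ℝ (Fin d)}
    (hξ : Measurable ξ) (hv : Measurable v) (hξv : IndepFun ξ v P)
    (h01 : ∀ᵐ ω ∂P, ξ ω = 0 ∨ ξ ω = 1) {p : ℝ} (hp : P.real {ω | ξ ω = 1} = p) {C : ℝ}
    (hC : ∀ᵐ ω ∂P, ‖v ω‖ ≤ C)
    (hiso : ∀ a b : Fin d, ∫ ω, v ω a * v ω b ∂P = if a = b then ((d : ℝ))⁻¹ else 0) {κ : ℝ}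
    (hκ : 0 < κ) (hvar : ∀ D : Matrix (Fin d) (Fin d) ℝ, ‖toEuclideanCLM (𝕜 := ℝ) D‖ ≤ 4 →
      variance (fun ω => inner ℝ (toEuclideanCLM (𝕜 := ℝ) D (v ω)) (v ω)) P ≤ κ ^ 2) :
    HasQuadraticRatios (P.map fun ω => ξ ω • v ω) p (5 * κ) := by
  intro D₁ D₂ h1 h2 hpos
  set φ : EuclideanSpace ℝ (Fin d) → ℝ := fun u =>
    (u.ofLp ⬝ᵥ D₁ *ᵥ u.ofLp) / (1 + u.ofLp ⬝ᵥ D₂ *ᵥ u.ofLp) with hφ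
  have hquad : ∀ D : Matrix (Fin d) (Fin d) ℝ,
      Measurable fun u : EuclideanSpace ℝ (Fin d) => u.ofLp ⬝ᵥ D *ᵥ u.ofLp := by
    intro D
    simp only [dotProduct, mulVec]
    fun_prop
  have hφm : Measurable φ := (hquad D₁).div (measurable_const.add (hquad D₂))
  have hp0 : 0 ≤ p := hp ▸ measureReal_nonneg
  have hsm : Measurable fun ω => ξ ω • v ω := hξ.smul hv
  rw [integral_map hsm.aemeasurable hφm.aestronglyMeasurable]
  -- `φ 0 = 0` and `ξ` takes only the values 0 and 1.
  have e1 : ∫ ω, φ (ξ ω • v ω) ∂P = ∫ ω, ξ ω * φ (v ω) ∂P := by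
    refine integral_congr_ae ?_
    filter_upwards [h01] with ω hω
    rcases hω with h | h
    · simp [h, hφ]
    · simp [h]
  have e2 : ∫ ω, ξ ω ∂P = p := by
    have : ξ =ᵐ[P] Set.indicator {ω | ξ ω = 1} 1 := by
      filter_upwards [h01] with ω hω
      rcases hω with h | h
      · simp [h]
      · simp [h]
    have hms : MeasurableSet {ω | ξ ω = 1} := hξ (measurableSet_singleton 1)
    rw [integral_congr_ae this, integral_indicator_one hms, hp]
  have e3 : ∫ ω, ξ ω * φ (v ω) ∂P = p * ∫ ω, φ (v ω) ∂P := by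
    rw [← e2]
    exact IndepFun.integral_fun_mul_eq_mul_integral
      (hξv.comp measurable_id hφm) hξ.aestronglyMeasurable
      (hφm.comp hv).aestronglyMeasurable
  rw [e1, e3, ← mul_sub, abs_mul, abs_of_nonneg hp0]
  refine mul_le_mul_of_nonneg_left ?_ hp0
  have hdev : ∀ D : Matrix (Fin d) (Fin d) ℝ, ‖toEuclideanCLM (𝕜 := ℝ) D‖ ≤ 4 →
      Integrable (fun ω => |(v ω).ofLp ⬝ᵥ D *ᵥ (v ω).ofLp - (d : ℝ)⁻¹ * D.trace|) P ∧
      ∫ ω, |(v ω).ofLp ⬝ᵥ D *ᵥ (v ω).ofLp - (d : ℝ)⁻¹ * D.trace| ∂P ≤ κ := by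
    intro D hD
    have hL := integrable_quadratic hv hC D
    have hL2 : MemLp (fun ω => (v ω).ofLp ⬝ᵥ D *ᵥ (v ω).ofLp - (d : ℝ)⁻¹ * D.trace) 2 P :=
      hL.sub (memLp_const _)
    refine ⟨(hL2.integrable one_le_two).abs, ?_⟩
    refine integral_abs_le_of_integral_sq_le hκ (hL2.integrable one_le_two) hL2.integrable_sq ?_
    have hv2 := hvar D hD
    have e : (fun ω => inner ℝ (toEuclideanCLM (𝕜 := ℝ) D (v ω)) (v ω)) =
        fun ω => (v ω).ofLp ⬝ᵥ D *ᵥ (v ω).ofLp := by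
      ext ω
      simp [PiLp.inner_apply, dotProduct]
    rw [e, variance_eq_integral (by exact hL.1.aemeasurable),
      integral_quadratic hv hC hiso] at hv2
    exact hv2
  obtain ⟨i1, b1⟩ := hdev D₁ h1
  obtain ⟨i2, b2⟩ := hdev D₂ h2
  set τ := (d : ℝ)⁻¹ * D₁.trace
  set σ := (d : ℝ)⁻¹ * D₂.trace
  have hσ : 0 ≤ σ := mul_nonneg (by positivity) (trace_nonneg_of_quadratic_nonneg hpos)
  have hτ : |τ| ≤ 4 := (abs_normalized_trace_le hd D₁).trans h1
  -- The denominators are at least 1 and `|τ| ≤ 4`; with both mean deviations at most `κ` this gives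
  -- `5 κ`.
  have hpt : ∀ ω, |φ (v ω) - τ / (1 + σ)| ≤ |(v ω).ofLp ⬝ᵥ D₁ *ᵥ (v ω).ofLp - τ| +
      4 * |(v ω).ofLp ⬝ᵥ D₂ *ᵥ (v ω).ofLp - σ| := by
    intro ω
    have hβ := hpos (v ω).ofLp
    set α := (v ω).ofLp ⬝ᵥ D₁ *ᵥ (v ω).ofLp with hα
    set β := (v ω).ofLp ⬝ᵥ D₂ *ᵥ (v ω).ofLp with hβ'
    have : φ (v ω) - τ / (1 + σ) = (α - τ) / (1 + β) - τ * (β - σ) / ((1 + β) * (1 + σ)) := by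
      change α / (1 + β) - _ = _
      field_simp
      ring
    rw [this]
    refine (abs_sub _ _).trans (add_le_add ?_ ?_)
    · rw [abs_div, abs_of_pos (by positivity : 0 < 1 + β)]
      exact div_le_self (abs_nonneg _) (by linarith)
    · rw [abs_div, abs_of_pos (by positivity : 0 < (1 + β) * (1 + σ)), abs_mul]
      exact (div_le_self (by positivity) (by nlinarith)).trans
        (mul_le_mul_of_nonneg_right hτ (abs_nonneg _))
  have hφi : Integrable (fun ω => φ (v ω) - τ / (1 + σ)) P :=
    (i1.add (i2.const_mul 4)).mono' ((hφm.comp hv).sub_const _).aestronglyMeasurable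
      (ae_of_all _ hpt)
  have hsub : ∫ ω, φ (v ω) ∂P - τ / (1 + σ) = ∫ ω, (φ (v ω) - τ / (1 + σ)) ∂P := by
    have : Integrable (fun ω => φ (v ω)) P :=
      (hφi.add (integrable_const (τ / (1 + σ)))).congr
        (ae_of_all _ fun ω => sub_add_cancel (φ (v ω)) _)
    rw [integral_sub this (integrable_const _)]
    simp
  rw [hsub]
  refine abs_integral_le_integral_abs.trans ?_
  refine (integral_mono hφi.abs (i1.add (i2.const_mul 4)) hpt).trans ?_
  simp only [Pi.add_apply]
  rw [integral_add i1 (i2.const_mul 4), integral_const_mul]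
  linarith

end EdgeLaw

/-! ### Uniformity of the concentration of quadratic forms. -/

section Main

/-- The hypothesis concerns one sequence of matrices at a time. Applied to a sequence that picks, at
each `r`, a normalized violating matrix whenever there is one, it becomes uniform. -/
theorem HasConcentratedForms.eventually_variance_le {Ω : ℕ → Type*} [∀ r, MeasurableSpace (Ω r)]
    {P : ∀ r, Measure (Ω r)} {d : ℕ → ℕ} (hd : ∀ r, 0 < d r)
    {v : ∀ r, EdgeIx r → Ω r → EuclideanSpace ℝ (Fin (d r))} (hv : HasConcentratedForms P d v)
    {κ : ℝ} (hκ : 0 < κ) :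
    ∀ᶠ r in atTop, ∀ e (D : Matrix (Fin (d r)) (Fin (d r)) ℝ),
      ‖Matrix.toEuclideanCLM (𝕜 := ℝ) D‖ ≤ 4 →
      variance (fun ω => inner ℝ (Matrix.toEuclideanCLM (𝕜 := ℝ) D (v r e ω)) (v r e ω)) (P r) ≤
        κ ^ 2 := by
  classical
  set Q : ∀ r, EdgeIx r → Matrix (Fin (d r)) (Fin (d r)) ℝ → ℝ := fun r e D =>
    variance (fun ω => inner ℝ (Matrix.toEuclideanCLM (𝕜 := ℝ) D (v r e ω)) (v r e ω)) (P r) with hQ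
  have hQs : ∀ r e (a : ℝ) D, Q r e (a • D) = a ^ 2 * Q r e D := by
    intro r e a D
    simp only [hQ]
    rw [← variance_const_mul]
    congr 1
    ext ω
    rw [map_smul, _root_.smul_apply, real_inner_smul_left]
  -- Normalizing a matrix of norm `m ≤ 4` divides the variance by `m² ≤ 16`. Without a violating
  -- matrix the identity serves; its norm is 1 because `d r > 0`.
  have hex : ∀ r, ∃ D : Matrix (Fin (d r)) (Fin (d r)) ℝ,
      ‖Matrix.toEuclideanCLM (𝕜 := ℝ) D‖ = 1 ∧
      ∀ (e : EdgeIx r) (D' : Matrix (Fin (d r)) (Fin (d r)) ℝ),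
        ‖Matrix.toEuclideanCLM (𝕜 := ℝ) D'‖ ≤ 4 → κ ^ 2 < Q r e D' →
        ∃ e', κ ^ 2 / 16 < Q r e' D := by
    intro r
    by_cases hbad : ∃ (e : EdgeIx r) (D' : Matrix (Fin (d r)) (Fin (d r)) ℝ),
        ‖Matrix.toEuclideanCLM (𝕜 := ℝ) D'‖ ≤ 4 ∧ κ ^ 2 < Q r e D'
    · obtain ⟨e, D', hD4, hlt⟩ := hbad
      set m := ‖Matrix.toEuclideanCLM (𝕜 := ℝ) D'‖ with hm
      have hm0 : 0 < m := by
        refine (norm_nonneg _).lt_of_ne' fun h => ?_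
        have hz : D' = 0 := by
          have := norm_eq_zero.1 h
          exact (map_eq_zero_iff _ (Matrix.toEuclideanCLM (𝕜 := ℝ)).injective).1 this
        have : Q r e D' = 0 := by
          have := hQs r e 0 D'
          rw [hz] at this ⊢
          simpa using this
        rw [this] at hlt
        nlinarith
      refine ⟨m⁻¹ • D', ?_, fun _ _ _ _ => ⟨e, ?_⟩⟩
      · rw [map_smul, norm_smul, norm_inv, Real.norm_of_nonneg hm0.le, ← hm,
          inv_mul_cancel₀ hm0.ne']
      · rw [hQs, inv_pow, div_lt_iff₀ (by norm_num), mul_comm, ← mul_assoc]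
        have h16 : m ^ 2 ≤ 16 := by nlinarith
        have : 1 ≤ 16 * (m ^ 2)⁻¹ := by
          rw [← div_eq_mul_inv, le_div_iff₀ (by positivity)]; linarith
        have hQ0 : 0 ≤ Q r e D' := variance_nonneg _ _
        nlinarith
    · refine ⟨1, ?_, fun e D' h1 h2 => absurd ⟨e, D', h1, h2⟩ hbad⟩
      have : Nonempty (Fin (d r)) := ⟨⟨0, hd r⟩⟩
      rw [map_one, norm_one]
  choose D hD1 hD2 using hex
  have hlim := hv D hD1
  filter_upwards [hlim.eventually (gt_mem_nhds (show (0 : ℝ) < κ ^ 2 / 16 by positivity))] with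
    r hr e D' hD'
  by_contra hcon
  obtain ⟨e', he'⟩ := hD2 r e D' hD' (not_le.1 hcon)
  have hle : Q r e' (D r) ≤ ⨆ e : EdgeIx r, Q r e (D r) :=
    le_ciSup (f := fun e => Q r e (D r)) (Set.finite_range _).bddAbove e'
  have hr' : ⨆ e : EdgeIx r, Q r e (D r) < κ ^ 2 / 16 := hr
  linarith

end Main

/-! ### Stieltjes transforms in probability, and conclusion. -/

section MainTheorem

theorem integrable_normalized_trace {V E : Type*} [Fintype V] [DecidableEq V] [Fintype E]
    [DecidableEq E] {d : ℕ}
    (μ : Measure (E → EuclideanSpace ℝ (Fin d))) [IsProbabilityMeasure μ] (s t : E → V) {x : ℝ}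
    (hx : 0 < x) (a σ : ℝ) :
    Measurable (fun b : E → EuclideanSpace ℝ (Fin d) => |a * (edgeResolvent s t x b).trace - σ|) ∧
    Integrable (fun b => |a * (edgeResolvent s t x b).trace - σ|) μ := by
  have hm : Measurable fun b : E → EuclideanSpace ℝ (Fin d) =>
      |a * (edgeResolvent s t x b).trace - σ| :=
    (((continuous_edgeResolvent s t hx).matrix_trace.const_mul a).sub continuous_const).abs.measurable
  refine ⟨hm, integrable_of_abs_le hm (K := |a| * (Fintype.card (V × Fin d) * (1 / x)) + |σ|)
    fun b => ?_⟩
  rw [abs_abs]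
  refine (abs_sub _ _).trans ?_
  rw [abs_mul]
  gcongr
  refine (Finset.abs_sum_le_sum_abs _ _).trans ?_
  refine (Finset.sum_le_sum fun i _ => show |edgeResolvent s t x b i i| ≤ 1 / x from ?_).trans
    (by simp)
  rw [edgeResolvent, abs_of_nonneg (gramResolvent_diag_nonneg hx _ i)]
  exact gramResolvent_diag_le hx _ i

variable {Ω : Type*} [MeasurableSpace Ω] {P : Measure Ω} [IsProbabilityMeasure P] {r d : ℕ}

/-- Quantitative convergence in probability of the Stieltjes transform. -/
theorem measureReal_stieltjes_le (hr : 0 < r) (hd : 0 < d) {ξ : EdgeIx r → Ω → ℝ}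
    {v : EdgeIx r → Ω → EuclideanSpace ℝ (Fin d)} {p C κ x c σ ε : ℝ} (hp0 : 0 ≤ p)
    (hξ : ∀ e, Measurable (ξ e)) (hv : ∀ e, Measurable (v e))
    (hξ_indep : iIndepFun ξ P) (hv_indep : iIndepFun v P)
    (hξv : IndepFun (fun ω e => ξ e ω) (fun ω e => v e ω) P)
    (h01 : ∀ e, ∀ᵐ ω ∂P, ξ e ω = 0 ∨ ξ e ω = 1) (hp : ∀ e, P.real {ω | ξ e ω = 1} = p)
    (hC : ∀ e, ∀ᵐ ω ∂P, ‖v e ω‖ ≤ C)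
    (hiso : ∀ e (a b : Fin d), ∫ ω, v e ω a * v e ω b ∂P = if a = b then ((d : ℝ))⁻¹ else 0)
    (hκ : 0 < κ) (hvar : ∀ e (D : Matrix (Fin d) (Fin d) ℝ),
      ‖Matrix.toEuclideanCLM (𝕜 := ℝ) D‖ ≤ 4 →
      variance (fun ω => inner ℝ (Matrix.toEuclideanCLM (𝕜 := ℝ) D (v e ω)) (v e ω)) P ≤ κ ^ 2)
    (hx : 1 ≤ x) (hσ : 0 ≤ σ) (hσeq : 1 - x * σ = c * (σ / (1 + σ + σ)))
    (hxp : 2 * (r * p / d) + 1 ≤ x) :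
    ε * P.real {ω | ε ≤ |∫ t, 1 / (t + x) ∂empiricalSpectralDistribution
        (blockLaplacian_isHermitian (fun e => ξ e ω) (fun e => v e ω)) - σ|} ≤
      √(2 * (1 + 2 * C ^ 2) / d) + (r * p / d *
        (5 * κ + 3 * √(2 * (1 + 2 * C ^ 2) / d) + 6 / d + 3 / √r) +
        |r * p / d - c| + p / d) := by
  have hx0 : 0 < x := by linarith
  have : Nonempty (Fin r) := ⟨⟨0, hr⟩⟩
  set s : EdgeIx r → Fin r := fun e => e.1.1
  set t : EdgeIx r → Fin r := fun e => e.1.2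
  set μ : EdgeIx r → Measure (EuclideanSpace ℝ (Fin d)) := fun e => P.map fun ω => ξ e ω • v e ω
  have hsm : ∀ e, Measurable fun ω => ξ e ω • v e ω := fun e => (hξ e).smul (hv e)
  have hμ : ∀ e, IsProbabilityMeasure (μ e) := fun e =>
    Measure.isProbabilityMeasure_map (hsm e).aemeasurable
  have hlaw : P.map (fun ω e => ξ e ω • v e ω) = Measure.pi μ :=
    map_smul_eq_pi hξ hv hξ_indep hv_indep hξv
  have hall : ∀ᵐ ω ∂P, ∀ e, ξ e ω = 0 ∨ ξ e ω = 1 := eventually_all.2 h01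
  have hCμ : ∀ e, ∀ᵐ u ∂μ e, ‖u‖ ≤ C := by
    intro e
    rw [ae_map_iff (hsm e).aemeasurable (measurableSet_le measurable_norm measurable_const)]
    filter_upwards [h01 e, hC e] with ω h1 h2
    rcases h1 with h | h
    · rw [h, zero_smul, norm_zero]; exact (norm_nonneg _).trans h2
    · rwa [h, one_smul]
  have hquad : ∀ e, HasQuadraticRatios (μ e) p (5 * κ) := fun e =>
    hasQuadraticRatios_map_smul hd (hξ e) (hv e)
      (hξv.comp (measurable_pi_apply e) (measurable_pi_apply e)) (h01 e) (hp e) (hC e) (hiso e) hκ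
      (hvar e)
  have hmain := integral_abs_trace_sub_le (μ := μ) (s := s) (t := t) (fun e => e.2.ne)
    isCompleteEdgeSet_edgeIx hx hd hp0 (by positivity) hCμ hquad hσ hσeq (by simpa using hxp)
  rw [Fintype.card_fin] at hmain
  refine le_trans ?_ hmain
  obtain ⟨hm, hi⟩ := integrable_normalized_trace (Measure.pi μ) s t hx0 ((r : ℝ) * d)⁻¹ σ
  have hbm : Measurable fun ω e => ξ e ω • v e ω := measurable_pi_lambda _ hsm
  have hset : P.real {ω | ε ≤ |∫ t, 1 / (t + x) ∂empiricalSpectralDistribution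
        (blockLaplacian_isHermitian (fun e => ξ e ω) (fun e => v e ω)) - σ|} =
      (Measure.pi μ).real {b | ε ≤ |((r : ℝ) * d)⁻¹ * (edgeResolvent s t x b).trace - σ|} := by
    rw [← hlaw, measureReal_def, measureReal_def,
      Measure.map_apply hbm (measurableSet_le measurable_const hm)]
    congr 1
    refine measure_congr ?_
    filter_upwards [hall] with ω hω
    refine propext ?_
    change ε ≤ _ ↔ ε ≤ _
    rw [integral_inv_empiricalSpectralDistribution _ _ hω hx0]
  rw [hset]
  -- Markov's inequality.
  exact mul_meas_ge_le_integral_of_nonneg (ae_of_all _ fun b => abs_nonneg _) hi ε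

end MainTheorem

theorem theoremt {Ω : ℕ → Type*} [∀ r, MeasurableSpace (Ω r)]
    (P : ∀ r, Measure (Ω r)) [∀ r, IsProbabilityMeasure (P r)]
    (d : ℕ → ℕ) (hd : ∀ r, 0 < d r) (p : ℕ → ℝ) (c : ℝ) (hc : 0 ≤ c)
    (ξ : ∀ r, EdgeIx r → Ω r → ℝ)
    (v : ∀ r, EdgeIx r → Ω r → EuclideanSpace ℝ (Fin (d r)))
    (hξ_meas : ∀ r e, Measurable (ξ r e))
    (hv_meas : ∀ r e, Measurable (v r e))
    -- for every `r`, all the `ξ_{kl}` and `v^{kl}` together are mutually independent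
    (hξ_indep : ∀ r, iIndepFun (ξ r) (P r))
    (hv_indep : ∀ r, iIndepFun (v r) (P r))
    (hξv_indep : ∀ r, IndepFun (fun ω e => ξ r e ω) (fun ω e => v r e ω) (P r))
    -- each `ξ_{kl}` is Bernoulli with parameter `p r`
    (hξ_zero_one : ∀ r e, ∀ᵐ ω ∂(P r), ξ r e ω = 0 ∨ ξ r e ω = 1)
    (hξ_prob : ∀ r e, (P r).real {ω | ξ r e ω = 1} = p r)
    -- `E v vᵀ = d⁻¹ I`
    (hv_isotropic : ∀ r e (a b : Fin (d r)),
      ∫ ω, v r e ω a * v r e ω b ∂(P r) = if a = b then ((d r : ℝ))⁻¹ else 0)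
    (hv_conc : HasConcentratedForms P d v)
    (hv_bdd : ∃ C : ℝ, ∀ r e, ∀ᵐ ω ∂(P r), ‖v r e ω‖ ≤ C)
    -- the asymptotic regime
    (hd_lim : Tendsto d atTop atTop)
    (hp_lim : Tendsto (fun r : ℕ => (r : ℝ) * p r / (d r : ℝ)) atTop (𝓝 c)) :
    IsProbabilityMeasure (laplacianLimitLaw c) ∧
    ConvergesWeaklyInProbability P
      (fun r ω => empiricalSpectralDistribution
        (blockLaplacian_isHermitian (fun e => ξ r e ω) (fun e => v r e ω)))
      (laplacianLimitLaw c) := by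
  have hprob := isProbabilityMeasure_laplacianLimitLaw hc
  refine ⟨hprob, ?_⟩
  obtain ⟨C, hC⟩ := hv_bdd
  have hN : EventuallyProbabilityOnNonneg P (fun r ω => empiricalSpectralDistribution
      (blockLaplacian_isHermitian (fun e => ξ r e ω) (fun e => v r e ω))) := by
    filter_upwards [eventually_gt_atTop 0] with r hr
    have : Nonempty (Fin r × Fin (d r)) := ⟨(⟨0, hr⟩, ⟨0, hd r⟩)⟩
    filter_upwards [eventually_all.2 (hξ_zero_one r)] with ω hω
    exact ⟨isProbabilityMeasure_empiricalSpectralDistribution _,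
      ae_nonneg_empiricalSpectralDistribution (blockLaplacian_posSemidef _ _ hω)⟩
  -- Eventually `r p / d < c + 1/2`, so `x ≥ 2 c + 2` meets the stability requirement `2 r p / d + 1
  -- ≤ x`.
  refine convergesWeaklyInProbability_of_stieltjes hN (ae_nonneg_laplacianLimitLaw c)
    (x₀ := 2 * c + 2) (by linarith) fun x hx ε hε => ?_
  have hx1 : 1 ≤ x := by linarith
  obtain ⟨hσ, hσeq⟩ := laplacianLimitLaw_stieltjes hc (show 0 < x by linarith)
  set σ := ∫ t, 1 / (t + x) ∂laplacianLimitLaw c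
  rw [← ENNReal.tendsto_toReal_zero_iff fun r => measure_ne_top _ _]
  refine tendsto_order.2 ⟨fun a ha => Eventually.of_forall fun r =>
    ha.trans_le ENNReal.toReal_nonneg, fun δ hδ => ?_⟩
  -- The only error that does not vanish as `r → ∞` is `5 c κ = c / (c + 1) * (ε δ)`, which is below
  -- `ε δ`; `c + 1` rather than `c` covers `c = 0`.
  set κ := δ * ε / (5 * (c + 1)) with hκ_def
  have hκ : 0 < κ := by positivity
  have hdR : Tendsto (fun r => (d r : ℝ)) atTop atTop := tendsto_natCast_atTop_atTop.comp hd_lim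
  have hρ : Tendsto (fun r => √(2 * (1 + 2 * C ^ 2) / d r)) atTop (𝓝 0) := by
    have := (hdR.const_div_atTop (2 * (1 + 2 * C ^ 2))).sqrt
    simpa using this
  have hr_sqrt : Tendsto (fun r : ℕ => 3 / √(r : ℝ)) atTop (𝓝 0) :=
    (Real.tendsto_sqrt_atTop.comp tendsto_natCast_atTop_atTop).const_div_atTop 3
  have hpd : Tendsto (fun r => p r / d r) atTop (𝓝 0) := by
    have := hp_lim.mul (tendsto_one_div_atTop_nhds_zero_nat (𝕜 := ℝ))
    rw [mul_zero] at this
    refine this.congr' ?_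
    filter_upwards [eventually_gt_atTop 0] with r hr
    have : (0 : ℝ) < r := by exact_mod_cast hr
    field_simp
  have hB : Tendsto (fun r : ℕ => √(2 * (1 + 2 * C ^ 2) / d r) + (r * p r / d r *
      (5 * κ + 3 * √(2 * (1 + 2 * C ^ 2) / d r) + 6 / d r + 3 / √r) +
      |r * p r / d r - c| + p r / d r)) atTop
      (𝓝 (0 + (c * (5 * κ + 3 * 0 + 0 + 0) + |c - c| + 0))) :=
    hρ.add (((hp_lim.mul (((tendsto_const_nhds.add (hρ.const_mul 3)).add
      (hdR.const_div_atTop 6)).add hr_sqrt)).add (hp_lim.sub_const c).abs).add hpd)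
  have hlt : 0 + (c * (5 * κ + 3 * 0 + 0 + 0) + |c - c| + 0) < ε * δ := by
    have : c * (5 * κ) = c / (c + 1) * (ε * δ) := by
      rw [hκ_def]; field_simp
    have h1 : c / (c + 1) < 1 := by rw [div_lt_one (by linarith)]; linarith
    have h2 : 0 < ε * δ := by positivity
    simp only [sub_self, abs_zero, mul_zero, add_zero, zero_add]
    rw [this]
    nlinarith
  filter_upwards [hB.eventually (gt_mem_nhds hlt), hv_conc.eventually_variance_le hd hκ,
    hp_lim.eventually (gt_mem_nhds (show c < c + 1 / 2 by linarith)), eventually_ge_atTop 2]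
    with r h1 h2 h3 h4
  -- `p r` is known to be a probability only if an edge exists, hence the restriction to `r ≥ 2`.
  have hp0 : 0 ≤ p r := by
    rw [← hξ_prob r ⟨(⟨0, by lia⟩, ⟨1, by lia⟩), by simp⟩]
    exact measureReal_nonneg
  have h5 := measureReal_stieltjes_le (ε := ε) (by lia) (hd r) hp0 (hξ_meas r) (hv_meas r)
    (hξ_indep r) (hv_indep r) (hξv_indep r) (hξ_zero_one r) (hξ_prob r) (hC r) (hv_isotropic r) hκ
    h2 hx1 hσ hσeq (by linarith)
  exact lt_of_mul_lt_mul_left (h5.trans_lt h1) hε.le
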